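/- **Setting.** Let $\mathcal M$ be the space of finite signed Borel measures on $\mathbb R^d$ with the norm $\|\mu\|^*=\sup\{|(f,\mu)|: f\in C_\infty(\mathbb R^d),\ \|f\|_\infty\le 1\}$ and the $\sigma$-algebra generated by the evaluations $\mu\mapsto\mu(B)$, $\mathcal M_1$ its closed unit ball, $U\subset\mathbb R^m$, $T>0$. A functional $F$ on $\mathcal M_1$ is twice variationally differentiable if there are $\delta_{[\mu]}F\in C_\infty(\mathbb R^d)$ and $\delta^2_{[\mu]}F\in C_\infty(\mathbb R^{2d})$ such that, for all $\mu,\eta\in\mathcal M_1$ and all $x$, the right derivatives at $s=0$ of $s\mapsto F(\mu+s(\eta-\mu))$ and of $s\mapsto\delta_{[\mu+s(\eta-\mu);x]}F$ are $(\delta_{[\mu]}F,\eta-\mu)$ and $(\delta^2_{[\mu;x,\cdot]}F,\eta-\mu)$. Put $\|F\|_{C^2(\mathcal M_1)}=\sup_\mu|F(\mu)|+\sup_\mu(\|\delta_{[\mu]}F\|_\infty+\|\delta^2_{[\mu]}F\|_\infty)$. Let $C^{2,2}(\mathbb R^d\times\mathcal M_1)$ be the measurable $F(x,\mu)$ that are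 $C^2$ in $x$, twice variationally differentiable in $\mu$, and have finite norm $\|F\|_{C^{2,2}}=\sup_\mu\sup_x(|F|+|F'_x|+|F''_{xx}|)+\sup_x\|F(x,\cdot)\|_{C^2(\mathcal M_1)}$. Let $\nu(t,x,\rho,u,dy)$ be a jointly measurable, uniformly bounded, positive kernel with $\nu(t,x,\rho,u,\{x\})=0$ that, for $t\in[0,T]$, $x\in\mathbb R^d$, $\rho\in\mathcal M_1$, $u\in U$, is $\|\cdot\|^*$-continuous in $t$, uniformly Lipschitz in $(x,\rho,u)$ in $\|\cdot\|^*$, and twice variationally differentiable in $\rho$ with uniformly bounded derivatives: for every $g\in C_\infty(\mathbb R^d)$ the functional $\rho\mapsto\int g\,d\nu(t,x,\rho,u,\cdot)$ is twice variationally differentiable, with derivatives bounded by $K\|g\|_\infty$, $K$ independent of $t,x,u,g$. For a strategy $\gamma$ let $A[t,\rho,\gamma]f(x)=\int(f(y)-f(x))\,\nu(t,x,\rho,\gamma(t,x),dy)$. Let $\mathcal U_L$ be the set of strategies $\gamma:[0,T]\times\mathbb R^d\to U$ that are continuous in $t$ and $L$-Lipschitz in $x$. For $\gamma,\tilde\gamma\in\mathcal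 U_L$ consider $N\ge1$ players in which player $i$ jumps according to $A[t,\mu^N,\gamma_i]$, with $\mu^N=\frac1N\sum_i\delta_{x_i}$, $\gamma_1=\tilde\gamma$ and $\gamma_i=\gamma$ for $i\ge2$. Let $\xi^{0,t}_{N,\gamma,\tilde\gamma}$ be the Markov propagator of the pair (state of player 1, empirical measure). Let $\mu_t$ be the probability-measure-valued solution of the kinetic equation $\frac{d}{dt}(g,\mu_t)=(A[t,\mu_t,\gamma]g,\mu_t)$, $g\in C_\infty(\mathbb R^d)$, started at a probability measure $\mu_0$. Let $\phi^{0,t}_{tag,\gamma}$ be the limiting tagged propagator, $(\phi^{0,t}_{tag,\gamma}F)(x,\mu_0)=\mathbb E_x F(X^1_t,\mu_t)$, where $X^1$ is the Markov jump process generated by $A[t,\mu_t,\tilde\gamma]$. **Lemma H.** For every such $\nu$, $U$, $T$ and every $L\ge0$ there is a constant $C\ge0$ such that for all $N\ge1$, $\gamma,\tilde\gamma\in\mathcal U_L$, all $\mu_0$ and all $k_1,k_2\ge0$ the following bounds hold with $C(T)=C\,(1+k_1+k_2)$. i) If $F\in C^{2,2}(\mathbb R^d\times\mathcal M_1)$,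 $t\in[0,T]$, and the initial states satisfy $\|\mu^N_0-\mu_0\|^*\le k_1/N$ and $|X^{N,1}_0-X^1_0|\le k_2/N$, where $\mu_0^N=\frac1N\sum_i\delta_{X_0^{N,i}}$, then $$\bigl|(\xi^{0,t}_{N,\gamma,\tilde\gamma}F)(X^{N,1}_0,\mu^N_0)-(\phi^{0,t}_{tag,\gamma}F)(X^1_0,\mu_0)\bigr|\le\frac{C(T)}N\bigl(\|F\|_{C^{2,2}}+k_1\bigr).$$ ii) Let the running cost $J(t,x,\mu,u)$ be jointly measurable, of class $C^{2,2}$ in $(x,\mu)$ with $\|J\|:=\sup_{t\in[0,T],u\in U}\|J(t,\cdot,\cdot,u)\|_{C^{2,2}}<\infty$, and Lipschitz in $u$ with constant $\ell$, uniformly in $t\in[0,T]$, $x\in\mathbb R^d$ and $\mu\in\mathcal M_1$. If the $N$-player process and the limiting process $X^1$ are realized with right-continuous paths on a common probability space, with (possibly random) initial states satisfying the two bounds in i) almost surely, then for all $t\in[0,T]$ $$\Bigl|\mathbb E\int_t^T J\bigl(s,X^{N,1}_s,\mu^N_s,\tilde\gamma(s,X^{N,1}_s)\bigr)ds-\mathbb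 E\int_t^T J\bigl(s,X^1_s,\mu_s,\tilde\gamma(s,X^1_s)\bigr)ds\Bigr|\le\frac{C(T)}N\bigl((T+k_2)\|J\|+k_2\,\ell+k_1\bigr).$$ -/

import Mathlib

open MeasureTheory ProbabilityTheory Set Filter Topology
open scoped ENNReal ZeroAtInfty

noncomputable section

namespace JumpGame

/-! ### Spaces of states and of measures -/

/-- The Euclidean space `ℝᵈ`. -/
abbrev Euc (d : ℕ) := EuclideanSpace ℝ (Fin d)

/-- The space `𝓜` of finite signed Borel measures on `ℝᵈ`. -/
abbrev Meas (d : ℕ) := SignedMeasure (Euc d)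

/-- The σ-algebra on `𝓜` generated by the evaluations `μ ↦ μ B`, `B` Borel. -/
instance instMeasurableSpaceMeas (d : ℕ) : MeasurableSpace (Meas d) :=
  ⨆ B : {B : Set (Euc d) // MeasurableSet B},
    MeasurableSpace.comap (fun μ : Meas d => μ B.1) inferInstance

/-- The norm `‖μ‖* = sup {|(f, μ)| : f ∈ C_∞(ℝᵈ), ‖f‖_∞ ≤ 1}`. -/
def dualNorm {d : ℕ} (μ : Meas d) : ℝ≥0∞ :=
  ⨆ f : C₀(Euc d, ℝ), ⨆ _ : ‖f‖ ≤ 1, ‖∫ᵛ x, f x ∂<•μ‖ₑ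

/-- The unit ball `𝓜₁` of `𝓜`. -/
def unitBall (d : ℕ) : Set (Meas d) := {μ | dualNorm μ ≤ 1}

/-- The empirical measure `(1/N) ∑ δ_{x_i}`. -/
def emp {d N : ℕ} (x : Fin N → Euc d) : Meas d :=
  (N : ℝ)⁻¹ • ∑ i, (Measure.dirac (x i)).toSignedMeasure

/-- A probability measure, seen as an element of `𝓜`. -/
def ofProb {d : ℕ} (μ : ProbabilityMeasure (Euc d)) : Meas d :=
  (μ : Measure (Euc d)).toSignedMeasure

/-! ### Variational derivatives and the classes `C²(𝓜₁)`, `C^{2,2}(ℝᵈ × 𝓜₁)` -/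

/-- `F` is twice differentiable on `𝓜₁` in the variational sense, `D1 μ x = δ_{[μ;x]} F` and
`D2 μ (x, y) = δ²_{[μ;x,y]} F`, both in `C_∞`.  The directional derivative of `F` at `μ` in
direction `ζ` is `(D1 μ, ζ)`, so `D1 μ x` is the derivative in direction `δ_x`; likewise for the
functionals `μ ↦ D1 μ x`.  Probability measures have norm one, so that `μ + s δ_x` leaves `𝓜₁`;
therefore the derivatives are taken along the segments inside the convex set `𝓜₁`. -/
structure HasVarDeriv2 {d : ℕ} (F : Meas d → ℝ) (D1 : Meas d → C₀(Euc d, ℝ))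
    (D2 : Meas d → C₀(Euc d × Euc d, ℝ)) : Prop where
  first : ∀ μ ∈ unitBall d, ∀ η ∈ unitBall d,
    HasDerivWithinAt (fun s : ℝ => F (μ + s • (η - μ)))
      (∫ᵛ x, D1 μ x ∂<•(η - μ)) (Icc 0 1) 0
  second : ∀ x : Euc d, ∀ μ ∈ unitBall d, ∀ η ∈ unitBall d,
    HasDerivWithinAt (fun s : ℝ => D1 (μ + s • (η - μ)) x)
      (∫ᵛ y, D2 μ (x, y) ∂<•(η - μ)) (Icc 0 1) 0

/-- The norm of `C²(𝓜₁)`: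
`sup_μ |F(μ)| + sup_μ (‖δ_{[μ]} F‖_∞ + ‖δ²_{[μ]} F‖_∞)`. -/
def c2Norm {d : ℕ} (F : Meas d → ℝ) (D1 : Meas d → C₀(Euc d, ℝ))
    (D2 : Meas d → C₀(Euc d × Euc d, ℝ)) : ℝ≥0∞ :=
  (⨆ μ ∈ unitBall d, ‖F μ‖ₑ) + ⨆ μ ∈ unitBall d, (‖D1 μ‖ₑ + ‖D2 μ‖ₑ)

/-- The norm of `C²(ℝᵈ)`: `sup_x (|f(x)| + |f'(x)| + |f''(x)|)`. -/
def spaceC2Norm {d : ℕ} (f : Euc d → ℝ) : ℝ≥0∞ :=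
  ⨆ x, (‖f x‖ₑ + ‖fderiv ℝ f x‖ₑ + ‖fderiv ℝ (fderiv ℝ f) x‖ₑ)

/-- The norm of `C^{2,2}(ℝᵈ × 𝓜₁)`: `sup_μ ‖F(·, μ)‖_{C²(ℝᵈ)} + sup_x ‖F(x, ·)‖_{C²(𝓜₁)}`. -/
def c22Norm {d : ℕ} (F : Euc d → Meas d → ℝ) (D1 : Euc d → Meas d → C₀(Euc d, ℝ))
    (D2 : Euc d → Meas d → C₀(Euc d × Euc d, ℝ)) : ℝ≥0∞ :=
  (⨆ μ ∈ unitBall d, spaceC2Norm (fun x => F x μ)) + ⨆ x, c2Norm (F x) (D1 x) (D2 x)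

/-- `F ∈ C^{2,2}(ℝᵈ × 𝓜₁)`, with variational derivatives `D1 x`, `D2 x` of `F(x, ·)`.  Decay of
`F(·, μ)` and its derivatives at infinity is not required, so the class contains
`C^{2,2}_∞(ℝᵈ × 𝓜₁)`. -/
structure IsC22 {d : ℕ} (F : Euc d → Meas d → ℝ) (D1 : Euc d → Meas d → C₀(Euc d, ℝ))
    (D2 : Euc d → Meas d → C₀(Euc d × Euc d, ℝ)) : Prop where
  meas : Measurable (fun p : Euc d × Meas d => F p.1 p.2)
  space : ∀ μ ∈ unitBall d, ContDiff ℝ 2 (fun x => F x μ)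
  var : ∀ x, HasVarDeriv2 (F x) (D1 x) (D2 x)
  finite : c22Norm F D1 D2 < ⊤

/-! ### Kernels and strategies -/

/-- The jump kernels `ν(t, x, ρ, u, dy)`: finite positive measures, jointly measurable in the
parameters. -/
abbrev JumpKernel (d m : ℕ) := Kernel (ℝ × Euc d × Meas d × Euc m) (Euc d)

/-- The regularity hypotheses on the jump kernel: (A1) positive, uniformly bounded, no mass at the
present state; (A2) continuity in time; (A3) uniform Lipschitz continuity in `x`, `ρ` and `u`;
(A4) first and second variational derivatives in `ρ`, in `C_∞` and uniformly bounded.  Measures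
are compared in the norm `‖·‖*`; (A4) is tested with `g ∈ C_∞(ℝᵈ)`. -/
structure KernelHyp {d m : ℕ} (T : ℝ) (U : Set (Euc m)) (ν : JumpKernel d m) : Prop where
  bounded : IsFiniteKernel ν
  no_self_jump : ∀ t ∈ Icc 0 T, ∀ x, ∀ ρ ∈ unitBall d, ∀ u ∈ U, ν (t, x, ρ, u) {x} = 0
  time_cont : ∀ x, ∀ ρ ∈ unitBall d, ∀ u ∈ U, ∀ t ∈ Icc 0 T,
    Tendsto (fun s => dualNorm ((ν (s, x, ρ, u)).toSignedMeasure
      - (ν (t, x, ρ, u)).toSignedMeasure)) (𝓝[Icc 0 T] t) (𝓝 0)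
  lipschitz : ∃ K : ℝ, ∀ t ∈ Icc 0 T, ∀ x x' : Euc d, ∀ ρ ∈ unitBall d, ∀ ρ' ∈ unitBall d,
    ∀ u ∈ U, ∀ u' ∈ U,
    dualNorm ((ν (t, x, ρ, u)).toSignedMeasure - (ν (t, x', ρ', u')).toSignedMeasure)
      ≤ ENNReal.ofReal K * (‖x - x'‖ₑ + dualNorm (ρ - ρ') + ‖u - u'‖ₑ)
  var_deriv : ∃ K : ℝ, ∀ t ∈ Icc 0 T, ∀ x : Euc d, ∀ u ∈ U, ∀ g : C₀(Euc d, ℝ),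
    ∃ (D1 : Meas d → C₀(Euc d, ℝ)) (D2 : Meas d → C₀(Euc d × Euc d, ℝ)),
      HasVarDeriv2 (fun ρ => ∫ y, g y ∂ν (t, x, ρ, u)) D1 D2 ∧
      ∀ ρ ∈ unitBall d, ‖D1 ρ‖ + ‖D2 ρ‖ ≤ K * ‖g‖

/-- The feedback strategies `γ : [0,T] × ℝᵈ → U`, continuous in time and Lipschitz continuous in
space with constant `L`. -/
structure IsStrategy {d m : ℕ} (T : ℝ) (U : Set (Euc m)) (L : ℝ)
    (γ : ℝ → Euc d → Euc m) : Prop where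
  mem : ∀ t ∈ Icc 0 T, ∀ x, γ t x ∈ U
  time_cont : ∀ x, ContinuousOn (fun t => γ t x) (Icc 0 T)
  lipschitz : ∀ t ∈ Icc 0 T, ∀ x y, ‖γ t x - γ t y‖ ≤ L * ‖x - y‖

/-! ### Generators, propagators and processes -/

/-- The one-player operator
`(A[t, ρ, γ] f)(x) = ∫ (f(y) - f(x)) ν(t, x, ρ, γ(t, x), dy)`. -/
def jumpOp {d m : ℕ} (ν : JumpKernel d m) (γ : ℝ → Euc d → Euc m) (t : ℝ) (ρ : Meas d)
    (f : Euc d → ℝ) (x : Euc d) : ℝ :=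
  ∫ y, (f y - f x) ∂ν (t, x, ρ, γ t x)

/-- The generator of the `N`-player dynamics in which player `0` (the tagged one) plays `γ'` and
every other player plays `γ`: the one-player operators, with `ρ` the empirical measure of all
players, act on one component of `x` each and are added up. -/
def playersGen {d m N : ℕ} [NeZero N] (ν : JumpKernel d m) (γ γ' : ℝ → Euc d → Euc m)
    (t : ℝ) (f : (Fin N → Euc d) → ℝ) (x : Fin N → Euc d) : ℝ :=
  ∑ i, jumpOp ν (if i = 0 then γ' else γ) t (emp x) (fun y => f (Function.update x i y)) (x i)

/-- `P` is the Markov propagator (transition function) on `[0,T]` generated by the family `A t`: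
Markov kernels with the cocycle property, solving the forward Kolmogorov equation
`d/dt P^{s,t} f = P^{s,t} A_t f` (in integrated form) for bounded measurable `f`. -/
structure IsPropagator {S : Type*} [MeasurableSpace S] (T : ℝ) (A : ℝ → (S → ℝ) → S → ℝ)
    (P : ℝ → ℝ → Kernel S S) : Prop where
  markov : ∀ s t, 0 ≤ s → s ≤ t → t ≤ T → IsMarkovKernel (P s t)
  refl : ∀ s, 0 ≤ s → s ≤ T → P s s = Kernel.id
  cocycle : ∀ r s t, 0 ≤ r → r ≤ s → s ≤ t → t ≤ T → P s t ∘ₖ P r s = P r t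
  forward : ∀ f : S → ℝ, Measurable f → (∃ c, ∀ x, |f x| ≤ c) →
    ∀ s t, 0 ≤ s → s ≤ t → t ≤ T → ∀ x,
      IntervalIntegrable (fun r => ∫ y, A r f y ∂P s r x) volume s t ∧
      ∫ y, f y ∂P s t x = f x + ∫ r in s..t, ∫ y, A r f y ∂P s r x

/-- `X` is a Markov process on `[0,T]` with right-continuous paths and transition function `P`. -/
structure IsMarkovProcess {S Ω : Type*} [MeasurableSpace S] [TopologicalSpace S]
    [mΩ : MeasurableSpace Ω] (T : ℝ) (P : ℝ → ℝ → Kernel S S) (Pr : Measure Ω)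
    (X : ℝ → Ω → S) : Prop where
  right_cont : ∀ ω, ∀ t ∈ Ico 0 T, ContinuousWithinAt (fun s => X s ω) (Ici t) t
  markov : ∃ ℱ : Filtration ℝ mΩ, (∀ t ∈ Icc 0 T, Measurable[ℱ t] (X t)) ∧
    ∀ s t, 0 ≤ s → s ≤ t → t ≤ T → ∀ f : S → ℝ, Measurable f → (∃ c, ∀ x, |f x| ≤ c) →
      Pr[fun ω => f (X t ω) | ℱ s] =ᵐ[Pr] fun ω => ∫ y, f y ∂P s t (X s ω)

/-- `μ` solves on `[0,T]`, within the probability measures, the kinetic equation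
`(g, dμ_t/dt) = (A[t, μ_t, γ] g, μ_t)` for all `g ∈ C_∞(ℝᵈ)`, in integrated form. -/
def IsKineticSolution {d m : ℕ} (T : ℝ) (ν : JumpKernel d m) (γ : ℝ → Euc d → Euc m)
    (μ : ℝ → ProbabilityMeasure (Euc d)) : Prop :=
  ∀ g : C₀(Euc d, ℝ), ∀ t ∈ Icc 0 T,
    IntervalIntegrable (fun s => ∫ x, jumpOp ν γ s (ofProb (μ s)) g x ∂(μ s : Measure (Euc d)))
      volume 0 t ∧
    ∫ x, g x ∂(μ t : Measure (Euc d)) = ∫ x, g x ∂(μ 0 : Measure (Euc d))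
      + ∫ s in 0..t, ∫ x, jumpOp ν γ s (ofProb (μ s)) g x ∂(μ s : Measure (Euc d))

/-- `(ξ^{0,t} F)(x_0, emp x)`: the propagator of the pair (tagged state, empirical measure), where
`P` is the propagator of the configuration of all players. -/
def pairProp {d N : ℕ} [NeZero N] (P : ℝ → ℝ → Kernel (Fin N → Euc d) (Fin N → Euc d))
    (t : ℝ) (F : Euc d → Meas d → ℝ) (x : Fin N → Euc d) : ℝ :=
  ∫ y, F (y 0) (emp y) ∂P 0 t x

/-- `(φ_tag^{0,t} F)(x, μ_0)`: the measure component follows the solution `μ` of the kinetic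
equation and the state component follows the propagator `Q` generated by `A[t, μ_t, γ']`; on
differentiable functionals the generator of this pair is the sum of the operator `A[t, μ, γ']`,
acting on the state, and of the generator of the Koopman propagator `G ↦ G(μ_t)`. -/
def limitProp {d : ℕ} (Q : ℝ → ℝ → Kernel (Euc d) (Euc d)) (μ : ℝ → ProbabilityMeasure (Euc d))
    (t : ℝ) (F : Euc d → Meas d → ℝ) (x : Euc d) : ℝ :=
  ∫ y, F y (ofProb (μ t)) ∂Q 0 t x

/-! ### Running costs -/

/-- The norm of `C([0,T] × U, C^{2,2}(ℝᵈ × 𝓜₁))`: the supremum of `‖J(t, ·, ·, u)‖_{C^{2,2}}`. -/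
def costNorm {d m : ℕ} (T : ℝ) (U : Set (Euc m)) (J : ℝ → Euc d → Meas d → Euc m → ℝ)
    (D1 : ℝ → Euc m → Euc d → Meas d → C₀(Euc d, ℝ))
    (D2 : ℝ → Euc m → Euc d → Meas d → C₀(Euc d × Euc d, ℝ)) : ℝ≥0∞ :=
  ⨆ t ∈ Icc 0 T, ⨆ u ∈ U, c22Norm (fun x μ => J t x μ u) (D1 t u) (D2 t u)

/-- Running costs `J(t, x, μ, u)`, of class `C^{2,2}` in `(x, μ)` with finite norm, and Lipschitz
continuous in the control `u` with constant `ℓ`. -/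
structure IsCost {d m : ℕ} (T : ℝ) (U : Set (Euc m)) (ℓ : ℝ)
    (J : ℝ → Euc d → Meas d → Euc m → ℝ)
    (D1 : ℝ → Euc m → Euc d → Meas d → C₀(Euc d, ℝ))
    (D2 : ℝ → Euc m → Euc d → Meas d → C₀(Euc d × Euc d, ℝ)) : Prop where
  meas : Measurable (fun p : ℝ × Euc d × Meas d × Euc m => J p.1 p.2.1 p.2.2.1 p.2.2.2)
  c22 : ∀ t ∈ Icc 0 T, ∀ u ∈ U, IsC22 (fun x μ => J t x μ u) (D1 t u) (D2 t u)
  finite : costNorm T U J D1 D2 < ⊤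
  lipschitz : ∀ t ∈ Icc 0 T, ∀ x, ∀ μ ∈ unitBall d, ∀ u ∈ U, ∀ u' ∈ U,
    |J t x μ u - J t x μ u'| ≤ ℓ * ‖u - u'‖

end JumpGame

end

open JumpGame

/-! Both propagators are compared with one discretized backward evolution of functionals. Cut `[0,
t]` into `n` steps of length `h`. In each step `V(x, ρ)` is replaced by `∫ V(y, ρ⁺) K'(x, ρ, dy)`,
where `ρ⁺` is the law `ρ` moved by the Euler kernel `K` of an ordinary player and `K'` is the Euler
kernel of the tagged player (`stepOp`).

The limiting pair follows this recursion up to `O(h²)` per step (`abs_limit_sub_stepOp_le`). For `N`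
players, if the tagged player is treated like the others, the empirical measure after one Euler step
has mean exactly `ρ⁺`. A single jump moves it by at most `2/N` in total variation, and some player
jumps with probability at most `N Θ h`, so its mean square displacement is at most `4 Θ h / N`. A
functional that feels such a displacement only to second order therefore has local error `O(h/N)`,
and correcting for the tagged player costs no more. What remains is `O(h²)` with a factor `N²`.
Summing `n` steps and letting `n → ∞` with `N` fixed removes this remainder and leaves `O(1/N)`
(`abs_players_sub_limit_le`).

It remains to see that second order sensitivity survives arbitrarily many steps. Instead of
differentiating the nonlinear flow twice in its initial measure, the bound on the second derivative
is replaced by the integrated inequality `HasGap`: the average of `W` over a random measure differs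
from `W` at the mean measure by at most a constant times the mean square spread. Taylor's formula
derives it from the variational derivatives (`HasVarDeriv2.lip_and_gap`). It is stable under
integration, restriction to the diagonal and composition (`HasGap.integral`, `HasGap.diag`,
`HasGap.comp`). Hence one step multiplies the constant by `1 + O(h)` only
(`RegularFunctional.step`), and `n` steps by a factor bounded by an exponential of `Θ T`.

All distances are total variation distances, which the test functions in `C_∞` already determine
(`tvLe_of_forall_zeroAtInfty`), so bounded measurable test functions are available throughout. Part
ii) needs no dynamics of its own: at each fixed time the two expectations depend only on the
propagators and the initial states, so the estimate behind i) is applied to the running cost at that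
time and integrated. -/

/-! ### Bounded measurable functions and total variation bounds -/

section TotalVariation

variable {E Y : Type*} [MeasurableSpace E] [MeasurableSpace Y]

lemma integrable_of_abs_le {μ : Measure E} [IsFiniteMeasure μ] {f : E → ℝ} {c : ℝ}
    (hf : Measurable f) (hc : ∀ x, |f x| ≤ c) : Integrable f μ :=
  Integrable.of_bound hf.aestronglyMeasurable c (Eventually.of_forall hc)

lemma abs_integral_le_of_abs_le {μ : Measure E} [IsFiniteMeasure μ] {f : E → ℝ} {c : ℝ}
    (hc : ∀ x, |f x| ≤ c) : |∫ x, f x ∂μ| ≤ c * μ.real univ :=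
  (Real.norm_eq_abs _).symm.trans_le
    (norm_integral_le_of_norm_le_const (Eventually.of_forall hc))

lemma abs_integral_le_integral {μ : Measure E} {f b : E → ℝ} (hb : Integrable b μ)
    (hfb : ∀ x, |f x| ≤ b x) : |∫ x, f x ∂μ| ≤ ∫ x, b x ∂μ :=
  (Real.norm_eq_abs _).symm.trans_le
    (norm_integral_le_of_norm_le hb (Eventually.of_forall hfb))

lemma abs_integral_le_of_prob {μ : Measure E} [IsProbabilityMeasure μ] {f : E → ℝ} {c : ℝ}
    (hc : ∀ x, |f x| ≤ c) : |∫ x, f x ∂μ| ≤ c := by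
  simpa using abs_integral_le_of_abs_le (μ := μ) hc

lemma integral_bind_kernel (μ : Measure Y) [IsFiniteMeasure μ] (k : Kernel Y E)
    [IsFiniteKernel k] {f : E → ℝ} {c : ℝ} (hf : Measurable f) (hc : ∀ x, |f x| ≤ c) :
    ∫ x, f x ∂(μ.bind k) = ∫ y, (∫ x, f x ∂(k y)) ∂μ := by
  have hi : Integrable f ((k ∘ₖ Kernel.const Unit μ) ()) := integrable_of_abs_le hf hc
  rw [Measure.comp_eq_comp_const_apply, Kernel.integral_comp hi, Kernel.const_apply]

/-- The total variation distance of `μ` and `ν`, normalized as the norm of `μ - ν` in the dual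
of the bounded measurable functions, is at most `r`. -/
def TVLe (μ ν : Measure E) (r : ℝ) : Prop :=
  ∀ f : E → ℝ, Measurable f → (∀ x, |f x| ≤ 1) → |∫ x, f x ∂μ - ∫ x, f x ∂ν| ≤ r

namespace TVLe

variable {μ ν : Measure E} {r s : ℝ}

lemma nonneg (h : TVLe μ ν r) : 0 ≤ r := by
  simpa using h (fun _ => 0) measurable_const (by simp)

lemma mono (h : TVLe μ ν r) (hrs : r ≤ s) : TVLe μ ν s :=
  fun f hf h1 => (h f hf h1).trans hrs

lemma refl (μ : Measure E) : TVLe μ μ 0 := fun f _ _ => by simp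

lemma abs_sub_le (h : TVLe μ ν r) {f : E → ℝ} {c : ℝ} (hf : Measurable f)
    (hc : ∀ x, |f x| ≤ c) (hc0 : 0 ≤ c) : |∫ x, f x ∂μ - ∫ x, f x ∂ν| ≤ c * r := by
  rcases hc0.eq_or_lt with rfl | hpos
  · have : f = fun _ => 0 := funext fun x => abs_nonpos_iff.mp (hc x)
    simp [this]
  · have := h (fun x => c⁻¹ * f x) (hf.const_mul _) fun x => by
      rw [abs_mul, abs_inv, abs_of_pos hpos, inv_mul_le_iff₀ hpos, mul_one]
      exact hc x
    rw [integral_const_mul, integral_const_mul, ← mul_sub, abs_mul, abs_inv, abs_of_pos hpos,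
      inv_mul_le_iff₀ hpos] at this
    exact this

end TVLe

end TotalVariation

/-! ### Total variation and the dual norm of `C_∞` -/

section ContinuousTest

variable {d : ℕ}

/-- The total variation distance is determined by the test functions in `C_∞`. -/
lemma tvLe_of_forall_zeroAtInfty {μ ν : Measure (Euc d)} [IsFiniteMeasure μ] [IsFiniteMeasure ν]
    {r : ℝ} (h : ∀ g : C₀(Euc d, ℝ), ‖g‖ ≤ 1 → |∫ x, g x ∂μ - ∫ x, g x ∂ν| ≤ r) :
    TVLe μ ν r := by
  intro f hf h1
  refine le_of_forall_pos_le_add fun ε hε => ?_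
  -- Approximation in `L¹` of the sum `μ + ν` controls the error under both measures at once.
  obtain ⟨g, hgs, hgi, hgc, -⟩ :=
    (integrable_of_abs_le (μ := μ + ν) hf h1).exists_hasCompactSupport_integral_sub_le
      (half_pos hε)
  -- Clipping to `[-1, 1]` is a contraction that fixes `f`, so `k` is no farther from `f` than `g`
  -- is, and it is an admissible test function.
  set k : Euc d → ℝ := fun x => max (-1) (min 1 (g x)) with hk
  have hkc : Continuous k := by fun_prop
  have hks : HasCompactSupport k := by
    refine hgs.mono fun x hx => ?_
    contrapose! hx
    simp only [Function.mem_support, not_not] at hx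
    simp [hk, hx]
  have hk1 : ∀ x, |k x| ≤ 1 := fun x =>
    abs_le.mpr ⟨le_max_left _ _, max_le (by norm_num) (min_le_left _ _)⟩
  have hfk : ∀ x, |f x - k x| ≤ ‖f x - g x‖ := fun x => by
    have h1x := abs_le.mp (h1 x)
    rw [Real.norm_eq_abs]
    have h2 : f x = max (-1) (min 1 (f x)) := by
      rw [min_eq_right h1x.2, max_eq_right h1x.1]
    calc |f x - k x| = |max (-1) (min 1 (f x)) - max (-1) (min 1 (g x))| := by rw [← h2]
      _ ≤ |min 1 (f x) - min 1 (g x)| := by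
        have := abs_max_sub_max_le_max (-1 : ℝ) (min 1 (f x)) (-1) (min 1 (g x))
        simpa using this
      _ ≤ |f x - g x| := by
        have := abs_min_sub_min_le_max (1 : ℝ) (f x) 1 (g x)
        simpa using this
  let k₀ : C₀(Euc d, ℝ) := ⟨⟨k, hkc⟩, hks.is_zero_at_infty⟩
  have hk₀ : ‖k₀‖ ≤ 1 := by
    rw [← ZeroAtInftyContinuousMap.norm_toBCF_eq_norm]
    exact (BoundedContinuousFunction.norm_le zero_le_one).mpr hk1
  have key := h k₀ hk₀
  have hkm := hkc.measurable
  have hdm : Measurable fun x => f x - k x := hf.sub hkm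
  have hint : ∀ (m : Measure (Euc d)) [IsFiniteMeasure m],
      ∫ x, f x ∂m = ∫ x, (f x - k x) ∂m + ∫ x, k x ∂m := fun m _ => by
    rw [integral_sub (integrable_of_abs_le hf h1) (integrable_of_abs_le hkm hk1)]; ring
  have hd2 : ∀ x, |f x - k x| ≤ 2 := fun x => by
    have := abs_sub (f x) (k x); linarith [h1 x, hk1 x]
  have hgint : Integrable (fun x => ‖f x - g x‖) (μ + ν) :=
    ((integrable_of_abs_le hf h1).sub (hgc.integrable_of_hasCompactSupport hgs)).norm
  have hsum : |∫ x, (f x - k x) ∂μ| + |∫ x, (f x - k x) ∂ν| ≤ ε / 2 := by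
    have ha : ∀ (m : Measure (Euc d)), Integrable (fun x => ‖f x - g x‖) m →
        |∫ x, (f x - k x) ∂m| ≤ ∫ x, ‖f x - g x‖ ∂m := fun m hm =>
      abs_integral_le_integral hm hfk
    have hμ := ha μ (hgint.mono_measure (Measure.le_add_right le_rfl))
    have hν := ha ν (hgint.mono_measure (Measure.le_add_left le_rfl))
    rw [integral_add_measure (hgint.mono_measure (Measure.le_add_right le_rfl))
      (hgint.mono_measure (Measure.le_add_left le_rfl))] at hgi
    linarith
  rw [hint μ, hint ν]
  have e : (∫ x, (f x - k x) ∂μ + ∫ x, k x ∂μ) - (∫ x, (f x - k x) ∂ν + ∫ x, k x ∂ν)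
      = (∫ x, (f x - k x) ∂μ - ∫ x, (f x - k x) ∂ν) + (∫ x, k x ∂μ - ∫ x, k x ∂ν) := by ring
  rw [e]
  have t1 := abs_add_le (∫ x, (f x - k x) ∂μ - ∫ x, (f x - k x) ∂ν) (∫ x, k x ∂μ - ∫ x, k x ∂ν)
  have t2 := abs_sub (∫ x, (f x - k x) ∂μ) (∫ x, (f x - k x) ∂ν)
  have key' : |∫ x, k x ∂μ - ∫ x, k x ∂ν| ≤ r := key
  linarith

lemma abs_apply_le_norm (g : C₀(Euc d, ℝ)) (x : Euc d) : |g x| ≤ ‖g‖ := by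
  rw [← ZeroAtInftyContinuousMap.norm_toBCF_eq_norm]
  exact g.toBCF.norm_coe_le_norm x

lemma integral_toSignedMeasure_sub (μ ν : Measure (Euc d)) [IsFiniteMeasure μ]
    [IsFiniteMeasure ν] {g : Euc d → ℝ} {c : ℝ} (hg : Measurable g) (hc : ∀ x, |g x| ≤ c) :
    ∫ᵛ x, g x ∂<•(μ.toSignedMeasure - ν.toSignedMeasure) = ∫ x, g x ∂μ - ∫ x, g x ∂ν := by
  rw [VectorMeasure.integral_sub_vectorMeasure, VectorMeasure.integral_toSignedMeasure,
    VectorMeasure.integral_toSignedMeasure]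
  · simpa [VectorMeasure.Integrable] using integrable_of_abs_le hg hc
  · simpa [VectorMeasure.Integrable] using integrable_of_abs_le hg hc

lemma tvLe_of_dualNorm_le {μ ν : Measure (Euc d)} [IsFiniteMeasure μ] [IsFiniteMeasure ν]
    {r : ℝ} (hr : 0 ≤ r)
    (h : dualNorm (μ.toSignedMeasure - ν.toSignedMeasure) ≤ ENNReal.ofReal r) : TVLe μ ν r := by
  refine tvLe_of_forall_zeroAtInfty fun g hg => ?_
  rw [dualNorm, iSup₂_le_iff] at h
  have h1 := h g hg
  rw [integral_toSignedMeasure_sub μ ν (map_continuous g).measurable (abs_apply_le_norm g),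
    Real.enorm_eq_ofReal_abs] at h1
  exact (ENNReal.ofReal_le_ofReal_iff hr).mp h1

lemma dualNorm_le_of_tvLe {μ ν : Measure (Euc d)} [IsFiniteMeasure μ] [IsFiniteMeasure ν]
    {r : ℝ} (h : TVLe μ ν r) :
    dualNorm (μ.toSignedMeasure - ν.toSignedMeasure) ≤ ENNReal.ofReal r := by
  refine iSup₂_le fun g hg => ?_
  rw [integral_toSignedMeasure_sub μ ν (map_continuous g).measurable (abs_apply_le_norm g),
    Real.enorm_eq_ofReal_abs]
  exact ENNReal.ofReal_le_ofReal
    (h g (map_continuous g).measurable fun x => (abs_apply_le_norm g x).trans hg)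

lemma ofProb_mem_unitBall (ρ : ProbabilityMeasure (Euc d)) : ofProb ρ ∈ unitBall d := by
  rw [unitBall, mem_ofPred_eq, dualNorm]
  refine iSup₂_le fun g hg => ?_
  rw [ofProb, VectorMeasure.integral_toSignedMeasure, Real.enorm_eq_ofReal_abs]
  exact ENNReal.ofReal_le_one.mpr
    (abs_integral_le_of_prob fun x => (abs_apply_le_norm g x).trans hg)

end ContinuousTest

/-! ### Functionals of probability measures with a second order averaging estimate -/

section Gap

variable {E Y : Type*} [MeasurableSpace E] [MeasurableSpace Y]

/-- `ρ'` is the mean of the random probability measure `η`, defined on the probability space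
`(Y, κ)`, whose total variation distance to `ρ₀` is at most `r`. -/
structure Spread (κ : Measure Y) (η : Y → ProbabilityMeasure E) (ρ₀ ρ' : ProbabilityMeasure E)
    (r : Y → ℝ) : Prop where
  prob : IsProbabilityMeasure κ
  meas : Measurable η
  meas_radius : Measurable r
  bdd_radius : ∃ R, ∀ y, r y ≤ R
  close : ∀ y, TVLe (η y : Measure E) ρ₀ (r y)
  mean : ∀ f : E → ℝ, Measurable f → (∀ x, |f x| ≤ 1) →
    ∫ x, f x ∂(ρ' : Measure E) = ∫ y, (∫ x, f x ∂(η y : Measure E)) ∂κ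

/-- `W` commutes with averaging up to `c` times the mean square of the total variation spread.
Functionals with bounded second variational derivatives have this property. -/
def HasGap (Y : Type*) [MeasurableSpace Y] (W : ProbabilityMeasure E → ℝ) (c : ℝ) : Prop :=
  ∀ (κ : Measure Y) (η : Y → ProbabilityMeasure E) (ρ₀ ρ' : ProbabilityMeasure E) (r : Y → ℝ),
    Spread κ η ρ₀ ρ' r → |∫ y, W (η y) ∂κ - W ρ'| ≤ c * ∫ y, r y ^ 2 ∂κ

lemma measurable_integral_of_abs_le {X : Type*} [MeasurableSpace X] {f : X → E → ℝ}
    (hf : Measurable (Function.uncurry f)) (m : Measure E) [SFinite m] :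
    Measurable fun z => ∫ x, f z x ∂m :=
  (hf.stronglyMeasurable.integral_prod_right (ν := m)).measurable

/-- The tautological kernel on the space of probability measures. -/
noncomputable def idKernel (E : Type*) [MeasurableSpace E] : Kernel (ProbabilityMeasure E) E :=
  ⟨fun ρ => (ρ : Measure E), measurable_subtype_coe⟩

@[simp] lemma idKernel_apply (ρ : ProbabilityMeasure E) : idKernel E ρ = (ρ : Measure E) := rfl

instance : IsMarkovKernel (idKernel E) := ⟨fun ρ => by rw [idKernel_apply]; infer_instance⟩

lemma measurable_integral_kernel {X : Type*} [MeasurableSpace X] {f : X → E → ℝ}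
    (hf : Measurable (Function.uncurry f)) (m : Kernel X E) [IsSFiniteKernel m] :
    Measurable fun z => ∫ x, f z x ∂(m z) :=
  (hf.stronglyMeasurable.integral_kernel_prod_right (κ := m)).measurable

lemma measurable_integral_probabilityMeasure {X : Type*} [MeasurableSpace X] {f : X → E → ℝ}
    (hf : Measurable (Function.uncurry f)) {ρ : X → ProbabilityMeasure E} (hρ : Measurable ρ) :
    Measurable fun z => ∫ x, f z x ∂(ρ z : Measure E) :=
  measurable_integral_kernel hf ((idKernel E).comap ρ hρ)

namespace Spread

variable {κ : Measure Y} {η : Y → ProbabilityMeasure E} {ρ₀ ρ' : ProbabilityMeasure E} {r : Y → ℝ}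

lemma integrable_radius (h : Spread κ η ρ₀ ρ' r) : Integrable r κ := by
  obtain ⟨R, hR⟩ := h.bdd_radius
  have := h.prob
  exact integrable_of_abs_le h.meas_radius fun y => by
    rw [abs_of_nonneg (h.close y).nonneg]; exact hR y

lemma integrable_sq (h : Spread κ η ρ₀ ρ' r) : Integrable (fun y => r y ^ 2) κ := by
  obtain ⟨R, hR⟩ := h.bdd_radius
  have := h.prob
  exact integrable_of_abs_le (h.meas_radius.pow_const 2) (c := R ^ 2) fun y => by
    rw [abs_of_nonneg (sq_nonneg _)]
    exact pow_le_pow_left₀ (h.close y).nonneg (hR y) 2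

lemma sq_nonneg (_ : Spread κ η ρ₀ ρ' r) : 0 ≤ ∫ y, r y ^ 2 ∂κ :=
  integral_nonneg fun _ => _root_.sq_nonneg _

lemma measurable_integral (h : Spread κ η ρ₀ ρ' r) {f : E → ℝ} (hf : Measurable f) :
    Measurable fun y => ∫ x, f x ∂(η y : Measure E) :=
  measurable_integral_probabilityMeasure (f := fun _ => f) (hf.comp measurable_snd) h.meas

lemma mean_of_abs_le (h : Spread κ η ρ₀ ρ' r) {f : E → ℝ} {c : ℝ} (hf : Measurable f)
    (hc : ∀ x, |f x| ≤ c) :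
    ∫ x, f x ∂(ρ' : Measure E) = ∫ y, (∫ x, f x ∂(η y : Measure E)) ∂κ := by
  have hp : 0 < |c| + 1 := by positivity
  have := h.mean (fun x => (|c| + 1)⁻¹ * f x) (hf.const_mul _) fun x => by
    rw [abs_mul, abs_inv, abs_of_pos hp, inv_mul_le_iff₀ hp, mul_one]
    linarith [hc x, le_abs_self c]
  simp only [integral_const_mul] at this
  exact mul_left_cancel₀ (inv_ne_zero hp.ne') this

/-- The mean is as close to `ρ₀` as the average spread. -/
lemma mean_close (h : Spread κ η ρ₀ ρ' r) :
    TVLe (ρ' : Measure E) ρ₀ (∫ y, r y ∂κ) ∧ (∫ y, r y ∂κ) ^ 2 ≤ ∫ y, r y ^ 2 ∂κ := by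
  have := h.prob
  constructor
  · intro f hf h1
    rw [h.mean f hf h1]
    have e : ∫ y, (∫ x, f x ∂(η y : Measure E)) ∂κ - ∫ x, f x ∂(ρ₀ : Measure E)
        = ∫ y, (∫ x, f x ∂(η y : Measure E) - ∫ x, f x ∂(ρ₀ : Measure E)) ∂κ := by
      rw [integral_sub (integrable_of_abs_le (h.measurable_integral hf)
        fun y => abs_integral_le_of_prob h1) (integrable_const _)]
      simp
    rw [e]
    exact abs_integral_le_integral h.integrable_radius fun y => h.close y f hf h1
  · set s := ∫ y, r y ∂κ
    -- The second claim is the nonnegativity of the variance of `r`.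
    have h0 : 0 ≤ ∫ y, (r y - s) ^ 2 ∂κ := integral_nonneg fun _ => _root_.sq_nonneg _
    have e : ∫ y, (r y - s) ^ 2 ∂κ = ∫ y, r y ^ 2 ∂κ - s ^ 2 := by
      have e1 : ∀ y, (r y - s) ^ 2 = r y ^ 2 - (2 * s) * r y + s ^ 2 := fun y => by ring
      simp only [e1]
      have i1 : Integrable (fun y => 2 * s * r y) κ := h.integrable_radius.const_mul _
      have i2 : Integrable (fun y => r y ^ 2 - 2 * s * r y) κ := h.integrable_sq.sub i1
      rw [integral_add i2 (integrable_const _), integral_sub h.integrable_sq i1,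
        integral_const_mul]
      simp only [integral_const, probReal_univ, smul_eq_mul, one_mul]
      ring
    linarith

end Spread

lemma HasGap.mono {W : ProbabilityMeasure E → ℝ} {c c' : ℝ} (h : HasGap Y W c) (hc : c ≤ c') :
    HasGap Y W c' := fun κ η ρ₀ ρ' r hs =>
  (h κ η ρ₀ ρ' r hs).trans (mul_le_mul_of_nonneg_right hc hs.sq_nonneg)

/-- Integrals of functionals with a common averaging estimate. -/
lemma HasGap.integral {X : Type*} [MeasurableSpace X] {W : X → ProbabilityMeasure E → ℝ}
    {c a : ℝ} (hW : ∀ z, HasGap Y (W z) c) (hm : Measurable (Function.uncurry W))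
    (ha : ∀ z ρ, |W z ρ| ≤ a) (m : Measure X) [IsFiniteMeasure m] :
    HasGap Y (fun ρ => ∫ z, W z ρ ∂m) (c * m.real univ) := by
  intro κ η ρ₀ ρ' r hs
  have := hs.prob
  have hm' : Measurable (Function.uncurry fun y z => W z (η y)) :=
    hm.comp (measurable_snd.prodMk (hs.meas.comp measurable_fst))
  have hswap : ∫ y, (∫ z, W z (η y) ∂m) ∂κ = ∫ z, (∫ y, W z (η y) ∂κ) ∂m :=
    integral_integral_swap (integrable_of_abs_le hm' fun p => ha _ _)
  have hi1 : Integrable (fun z => ∫ y, W z (η y) ∂κ) m :=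
    integrable_of_abs_le (measurable_integral_of_abs_le (f := fun z y => W z (η y))
      (hm'.comp measurable_swap) κ) fun z => abs_integral_le_of_prob fun y => ha _ _
  have hi2 : Integrable (fun z => W z ρ') m :=
    integrable_of_abs_le (hm.comp (measurable_id.prodMk measurable_const)) fun z => ha z ρ'
  rw [hswap, ← integral_sub hi1 hi2]
  calc |∫ z, (∫ y, W z (η y) ∂κ - W z ρ') ∂m|
      ≤ (c * ∫ y, r y ^ 2 ∂κ) * m.real univ :=
        abs_integral_le_of_abs_le fun z => hW z κ η ρ₀ ρ' r hs
    _ = c * m.real univ * ∫ y, r y ^ 2 ∂κ := by ring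

/-- Linear functionals commute with averaging, hence the constant zero. -/
lemma HasGap.integral_probabilityMeasure {f : E → ℝ} {c : ℝ} (hf : Measurable f)
    (hc : ∀ x, |f x| ≤ c) :
    HasGap Y (fun ρ : ProbabilityMeasure E => ∫ x, f x ∂(ρ : Measure E)) 0 := by
  intro κ η ρ₀ ρ' r hs
  simp [hs.mean_of_abs_le hf hc]

/-- The averaging estimate on the diagonal of a function of two measures. -/
lemma HasGap.diag {M : ProbabilityMeasure E → ProbabilityMeasure E → ℝ} {c₁ c₂ e a : ℝ}
    (h₁ : ∀ ρ₀, HasGap Y (fun ρ => M ρ ρ₀) c₁) (h₂ : ∀ ρ₀, HasGap Y (fun ρ => M ρ₀ ρ) c₂)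
    (hm : Measurable (Function.uncurry M)) (ha : ∀ ρ ρ', |M ρ ρ'| ≤ a) (he0 : 0 ≤ e)
    (he : ∀ ρ ρ₀ : ProbabilityMeasure E, ∀ r, TVLe (ρ : Measure E) ρ₀ r →
      |M ρ ρ - M ρ ρ₀ - M ρ₀ ρ + M ρ₀ ρ₀| ≤ e * r ^ 2) :
    HasGap Y (fun ρ => M ρ ρ) (c₁ + c₂ + 2 * e) := by
  intro κ η ρ₀ ρ' r hs
  have := hs.prob
  obtain ⟨hcl, hsq⟩ := hs.mean_close
  have k₁ := h₁ ρ₀ κ η ρ₀ ρ' r hs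
  have k₂ := h₂ ρ₀ κ η ρ₀ ρ' r hs
  -- `M ρ ρ` equals `M ρ ρ₀ + M ρ₀ ρ - M ρ₀ ρ₀` plus a mixed second difference. The first two terms
  -- are covered by `k₁` and `k₂`. The mixed difference enters twice, at the mean `ρ'` (here) and
  -- averaged over `η` (`k₄`), which gives `2 * e`.
  have k₃ := he ρ' ρ₀ _ hcl
  have i0 : Integrable (fun y => M (η y) (η y)) κ :=
    integrable_of_abs_le (hm.comp (hs.meas.prodMk hs.meas)) fun y => ha _ _
  have i1 : Integrable (fun y => M (η y) ρ₀) κ :=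
    integrable_of_abs_le (hm.comp (hs.meas.prodMk measurable_const)) fun y => ha _ _
  have i2 : Integrable (fun y => M ρ₀ (η y)) κ :=
    integrable_of_abs_le (hm.comp (measurable_const.prodMk hs.meas)) fun y => ha _ _
  have k₄ : |∫ y, (M (η y) (η y) - M (η y) ρ₀ - M ρ₀ (η y) + M ρ₀ ρ₀) ∂κ|
      ≤ e * ∫ y, r y ^ 2 ∂κ := by
    rw [← integral_const_mul]
    exact abs_integral_le_integral (hs.integrable_sq.const_mul _)
      fun y => he _ _ _ (hs.close y)
  have i3 : Integrable (fun y => M (η y) (η y) - M (η y) ρ₀) κ := i0.sub i1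
  have i4 : Integrable (fun y => M (η y) (η y) - M (η y) ρ₀ - M ρ₀ (η y)) κ := i3.sub i2
  rw [integral_add i4 (integrable_const _), integral_sub i3 i2, integral_sub i0 i1] at k₄
  simp only [integral_const, probReal_univ, smul_eq_mul, one_mul] at k₄
  have k₅ : e * (∫ y, r y ∂κ) ^ 2 ≤ e * ∫ y, r y ^ 2 ∂κ := mul_le_mul_of_nonneg_left hsq he0
  rw [abs_le] at *
  constructor <;> linarith

/-- The mean of a random probability measure. -/
lemma exists_mean (κ : Measure Y) [IsProbabilityMeasure κ] {η : Y → ProbabilityMeasure E}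
    (hη : Measurable η) : ∃ ρ' : ProbabilityMeasure E,
      ∀ f : E → ℝ, Measurable f → (∀ x, |f x| ≤ 1) →
        ∫ x, f x ∂(ρ' : Measure E) = ∫ y, (∫ x, f x ∂(η y : Measure E)) ∂κ := by
  let k : Kernel Y E := (idKernel E).comap η hη
  refine ⟨⟨κ.bind k, inferInstance⟩, fun f hf h1 => ?_⟩
  exact integral_bind_kernel κ k hf h1

/-- The averaging estimate for a composition. -/
lemma HasGap.comp {W : ProbabilityMeasure E → ℝ} {b c q e : ℝ}
    {Φ : ProbabilityMeasure E → ProbabilityMeasure E} (hW : HasGap Y W c)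
    (hb : ∀ ρ ρ' : ProbabilityMeasure E, ∀ r, TVLe (ρ : Measure E) ρ' r → |W ρ - W ρ'| ≤ b * r)
    (hΦ : Measurable Φ)
    (hq : ∀ ρ ρ' : ProbabilityMeasure E, ∀ r, TVLe (ρ : Measure E) ρ' r →
      TVLe (Φ ρ : Measure E) (Φ ρ') (q * r))
    (he : ∀ f : E → ℝ, Measurable f → (∀ x, |f x| ≤ 1) →
      HasGap Y (fun ρ => ∫ x, f x ∂(Φ ρ : Measure E)) e) :
    HasGap Y (fun ρ => W (Φ ρ)) (c * q ^ 2 + b * e) := by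
  intro κ η ρ₀ ρ' r hs
  have := hs.prob
  obtain ⟨ρ₁, hρ₁⟩ := exists_mean κ (hΦ.comp hs.meas)
  -- The image measures are again a spread, around `Φ ρ₀` and with radius enlarged by `q`; their
  -- mean is `ρ₁`, which in general is not `Φ ρ'`.
  have hs' : Spread κ (fun y => Φ (η y)) (Φ ρ₀) ρ₁ (fun y => q * r y) := by
    refine ⟨hs.prob, hΦ.comp hs.meas, hs.meas_radius.const_mul q, ?_,
      fun y => hq _ _ _ (hs.close y), hρ₁⟩
    obtain ⟨R, hR⟩ := hs.bdd_radius
    refine ⟨|q| * R, fun y => ?_⟩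
    calc q * r y ≤ |q| * r y := mul_le_mul_of_nonneg_right (le_abs_self q) (hs.close y).nonneg
      _ ≤ |q| * R := mul_le_mul_of_nonneg_left (hR y) (abs_nonneg q)
  have k₁ := hW κ _ _ _ _ hs'
  -- The averaging estimate for `Φ`, over all test functions, says exactly that `ρ₁` and `Φ ρ'` are
  -- close in total variation; the Lipschitz bound for `W` then produces the term `b * e`.
  have k₂ : TVLe (ρ₁ : Measure E) (Φ ρ') (e * ∫ y, r y ^ 2 ∂κ) := fun f hf h1 => by
    rw [hρ₁ f hf h1]
    exact he f hf h1 κ η ρ₀ ρ' r hs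
  have k₃ := hb _ _ _ k₂
  have e1 : ∫ y, (q * r y) ^ 2 ∂κ = q ^ 2 * ∫ y, r y ^ 2 ∂κ := by
    simp only [mul_pow, integral_const_mul]
  rw [e1] at k₁
  rw [abs_le] at *
  constructor <;> linarith

end Gap

/-! ### Functionals with variational derivatives -/

section Variational

variable {d : ℕ}

lemma measurable_to_meas {X : Type*} [MeasurableSpace X] {f : X → Meas d}
    (h : ∀ B : Set (Euc d), MeasurableSet B → Measurable fun x => f x B) : Measurable f := by
  refine measurable_iff_comap_le.mpr ?_
  rw [instMeasurableSpaceMeas, MeasurableSpace.comap_iSup]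
  refine iSup_le fun B => ?_
  rw [MeasurableSpace.comap_comp]
  exact measurable_iff_comap_le.mp (h B.1 B.2)

lemma ofProb_apply (ρ : ProbabilityMeasure (Euc d)) {B : Set (Euc d)} (hB : MeasurableSet B) :
    ofProb ρ B = (ρ : Measure (Euc d)).real B :=
  Measure.toSignedMeasure_apply_measurable hB

lemma measurable_ofProb : Measurable (ofProb (d := d)) := by
  refine measurable_to_meas fun B hB => ?_
  simp only [ofProb_apply _ hB]
  exact ((Measure.measurable_coe hB).comp measurable_subtype_coe).ennreal_toReal

/-- The segment between two probability measures. -/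
lemma exists_segment (ρ η : ProbabilityMeasure (Euc d)) {s : ℝ} (hs : s ∈ Icc (0 : ℝ) 1) :
    ∃ ζ : ProbabilityMeasure (Euc d), ofProb ζ = ofProb ρ + s • (ofProb η - ofProb ρ) ∧
      ∀ f : Euc d → ℝ, ∀ c, Measurable f → (∀ x, |f x| ≤ c) →
        ∫ x, f x ∂(ζ : Measure (Euc d))
          = (1 - s) * ∫ x, f x ∂(ρ : Measure (Euc d)) + s * ∫ x, f x ∂(η : Measure (Euc d)) := by
  have h1 : 0 ≤ 1 - s := by linarith [hs.2]
  have hp : IsProbabilityMeasure (ENNReal.ofReal (1 - s) • (ρ : Measure (Euc d))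
      + ENNReal.ofReal s • (η : Measure (Euc d))) := ⟨by
    simp only [Measure.coe_add, Measure.coe_smul, Pi.add_apply, Pi.smul_apply, measure_univ,
      smul_eq_mul, mul_one]
    rw [← ENNReal.ofReal_add h1 hs.1]
    simp⟩
  let ζ : ProbabilityMeasure (Euc d) := ⟨_, hp⟩
  have hζ : (ζ : Measure (Euc d)) = ENNReal.ofReal (1 - s) • (ρ : Measure (Euc d))
      + ENNReal.ofReal s • (η : Measure (Euc d)) := rfl
  refine ⟨ζ, ?_, fun f c hf hc => ?_⟩
  · ext B hB
    rw [ofProb_apply _ hB, hζ]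
    simp only [add_apply, smul_apply, sub_apply,
      ofProb_apply _ hB, smul_eq_mul]
    have := Measure.smul_finite (ρ : Measure (Euc d)) (ENNReal.ofReal_ne_top (r := 1 - s))
    have := Measure.smul_finite (η : Measure (Euc d)) (ENNReal.ofReal_ne_top (r := s))
    rw [measureReal_add_apply, measureReal_ennreal_smul_apply, measureReal_ennreal_smul_apply,
      ENNReal.toReal_ofReal h1, ENNReal.toReal_ofReal hs.1]
    ring
  · rw [hζ]
    have i1 := integrable_of_abs_le (μ := (ρ : Measure (Euc d))) hf hc
    have i2 := integrable_of_abs_le (μ := (η : Measure (Euc d))) hf hc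
    rw [integral_add_measure (i1.smul_measure ENNReal.ofReal_ne_top)
      (i2.smul_measure ENNReal.ofReal_ne_top), integral_smul_measure, integral_smul_measure,
      ENNReal.toReal_ofReal h1, ENNReal.toReal_ofReal hs.1]
    rfl

/-- A functional with variational derivative `D`, along segments of probability measures. -/
def HasVarDeriv (G : Meas d → ℝ) (D : Meas d → Euc d → ℝ) : Prop :=
  ∀ μ ∈ unitBall d, ∀ η ∈ unitBall d,
    HasDerivWithinAt (fun s : ℝ => G (μ + s • (η - μ))) (∫ᵛ x, D μ x ∂<•(η - μ)) (Icc 0 1) 0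

/-- The derivative is given only at the initial point of a segment. An interior point `ζ` of the
segment from `ρ` to `η` is itself a probability measure, so the hypothesis applies to the segment
from `ζ` to `η`. The time change `(u - s) / (1 - s)` contributes a factor `1 / (1 - s)`, which
cancels against `η - ζ = (1 - s) (η - ρ)`. A right derivative together with continuity is what the
mean value inequality requires. -/
lemma HasVarDeriv.segment {G : Meas d → ℝ} {D : Meas d → Euc d → ℝ} {c : ℝ}
    (h : HasVarDeriv G D) (hDm : ∀ μ ∈ unitBall d, Measurable (D μ))
    (hDc : ∀ μ ∈ unitBall d, ∀ x, |D μ x| ≤ c) (ρ η : ProbabilityMeasure (Euc d)) :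
    ContinuousOn (fun s : ℝ => G (ofProb ρ + s • (ofProb η - ofProb ρ))) (Icc 0 1) ∧
    ∀ s ∈ Ico (0 : ℝ) 1,
      HasDerivWithinAt (fun s : ℝ => G (ofProb ρ + s • (ofProb η - ofProb ρ)))
        (∫ x, D (ofProb ρ + s • (ofProb η - ofProb ρ)) x ∂(η : Measure (Euc d))
          - ∫ x, D (ofProb ρ + s • (ofProb η - ofProb ρ)) x ∂(ρ : Measure (Euc d))) (Ici s) s := by
  set φ : ℝ → ℝ := fun s => G (ofProb ρ + s • (ofProb η - ofProb ρ)) with hφ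
  have right : ∀ s ∈ Ico (0 : ℝ) 1, HasDerivWithinAt φ
      (∫ x, D (ofProb ρ + s • (ofProb η - ofProb ρ)) x ∂(η : Measure (Euc d))
        - ∫ x, D (ofProb ρ + s • (ofProb η - ofProb ρ)) x ∂(ρ : Measure (Euc d)))
      (Icc s 1) s := by
    intro s hs
    obtain ⟨ζ, hζ, hζi⟩ := exists_segment ρ η ⟨hs.1, hs.2.le⟩
    have h1s : 0 < 1 - s := by linarith [hs.2]
    rw [← hζ]
    have hζb := ofProb_mem_unitBall ζ
    have h0 := h _ hζb _ (ofProb_mem_unitBall η)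
    have hlin : HasDerivWithinAt (fun u : ℝ => (u - s) / (1 - s)) (1 / (1 - s)) (Icc s 1) s :=
      (((hasDerivAt_id s).sub_const s).div_const (1 - s)).hasDerivWithinAt
    have hmaps : MapsTo (fun u : ℝ => (u - s) / (1 - s)) (Icc s 1) (Icc 0 1) := fun u hu =>
      ⟨div_nonneg (by linarith [hu.1]) h1s.le, (div_le_one h1s).mpr (by linarith [hu.2])⟩
    have h0' : HasDerivWithinAt (fun r : ℝ => G (ofProb ζ + r • (ofProb η - ofProb ζ)))
        (∫ᵛ x, D (ofProb ζ) x ∂<•(ofProb η - ofProb ζ)) (Icc 0 1) ((s - s) / (1 - s)) := by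
      simpa using h0
    have hcomp := h0'.comp s hlin hmaps
    have e : (∫ᵛ x, D (ofProb ζ) x ∂<•(ofProb η - ofProb ζ)) * (1 / (1 - s))
        = ∫ x, D (ofProb ζ) x ∂(η : Measure (Euc d))
          - ∫ x, D (ofProb ζ) x ∂(ρ : Measure (Euc d)) := by
      have e' := integral_toSignedMeasure_sub (η : Measure (Euc d)) (ζ : Measure (Euc d))
        (hDm _ hζb) (hDc _ hζb)
      rw [hζi _ _ (hDm _ hζb) (hDc _ hζb)] at e'
      change (∫ᵛ x, D (ofProb ζ) x ∂<•(ofProb η - ofProb ζ)) = _ at e'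
      rw [e', mul_one_div, div_eq_iff h1s.ne']
      ring
    rw [e] at hcomp
    refine hcomp.congr_of_eventuallyEq (Eventually.of_forall fun u => ?_) ?_
    · simp only [hφ, Function.comp_def, hζ]
      congr 1
      have : ofProb η - (ofProb ρ + s • (ofProb η - ofProb ρ))
          = (1 - s) • (ofProb η - ofProb ρ) := by module
      rw [this, smul_smul, div_mul_cancel₀ _ h1s.ne', add_assoc, ← add_smul]
      congr 2; ring
    · simp [hφ, hζ]
  -- Continuity from the left comes from running the segment backwards, from `ζ` to `ρ`.
  have left : ∀ s ∈ Ioc (0 : ℝ) 1, ContinuousWithinAt φ (Icc 0 s) s := by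
    intro s hs
    obtain ⟨ζ, hζ, -⟩ := exists_segment ρ η ⟨hs.1.le, hs.2⟩
    have h0 := (h _ (ofProb_mem_unitBall ζ) _ (ofProb_mem_unitBall ρ)).continuousWithinAt
    have hlin : ContinuousWithinAt (fun u : ℝ => (s - u) / s) (Icc 0 s) s := by fun_prop
    have hmaps : MapsTo (fun u : ℝ => (s - u) / s) (Icc 0 s) (Icc 0 1) := fun u hu =>
      ⟨div_nonneg (by linarith [hu.2]) hs.1.le, (div_le_one hs.1).mpr (by linarith [hu.1])⟩
    have h0' : ContinuousWithinAt (fun r : ℝ => G (ofProb ζ + r • (ofProb ρ - ofProb ζ)))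
        (Icc 0 1) ((s - s) / s) := by simpa using h0
    have hcomp := ContinuousWithinAt.comp (f := fun u : ℝ => (s - u) / s) h0' hlin hmaps
    refine hcomp.congr (fun u _ => ?_) ?_
    · simp only [hφ, Function.comp_def, hζ]
      congr 1
      have : ofProb ρ - (ofProb ρ + s • (ofProb η - ofProb ρ))
          = (-s) • (ofProb η - ofProb ρ) := by module
      rw [this, smul_smul, add_assoc, ← add_smul]
      congr 2
      have := hs.1.ne'
      field_simp
      ring
    · simp [hφ, hζ]
  constructor
  · intro s hs
    have hsub : Icc (0 : ℝ) 1 ⊆ Icc 0 s ∪ Icc s 1 := fun u hu =>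
      (le_total u s).elim (fun h => Or.inl ⟨hu.1, h⟩) (fun h => Or.inr ⟨h, hu.2⟩)
    refine ContinuousWithinAt.mono (ContinuousWithinAt.union ?_ ?_) hsub
    · rcases hs.1.eq_or_lt with rfl | h0
      · simp [continuousWithinAt_singleton]
      · exact left s ⟨h0, hs.2⟩
    · rcases hs.2.eq_or_lt with rfl | h0
      · simp [continuousWithinAt_singleton]
      · exact (right s ⟨hs.1, h0⟩).continuousWithinAt
  · intro s hs
    exact (right s hs).mono_of_mem_nhdsWithin (Icc_mem_nhdsGE hs.2)

lemma HasVarDeriv.abs_sub_le {G : Meas d → ℝ} {D : Meas d → Euc d → ℝ} {c : ℝ}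
    (h : HasVarDeriv G D) (hDm : ∀ μ ∈ unitBall d, Measurable (D μ))
    (hDc : ∀ μ ∈ unitBall d, ∀ x, |D μ x| ≤ c) (hc : 0 ≤ c) {ρ η : ProbabilityMeasure (Euc d)}
    {r : ℝ} (hr : TVLe (η : Measure (Euc d)) ρ r) :
    |G (ofProb η) - G (ofProb ρ)| ≤ c * r := by
  obtain ⟨hcont, hder⟩ := h.segment hDm hDc ρ η
  have := norm_image_sub_le_of_norm_deriv_right_le_segment hcont hder (C := c * r)
    (fun s hs => by
      obtain ⟨ζ, hζ, -⟩ := exists_segment ρ η ⟨hs.1, hs.2.le⟩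
      rw [← hζ]
      have hb := ofProb_mem_unitBall ζ
      exact hr.abs_sub_le (hDm _ hb) (hDc _ hb) hc) 1 ⟨zero_le_one, le_rfl⟩
  simpa using this

/-- Taylor's formula to first order along the segment. After the affine part is subtracted, the
derivative at `s` is the integral of `D ζ - D ρ` against `η - ρ`. The integrand is at most `c' * r`,
because each `D · x` is Lipschitz and `ζ` is no farther from `ρ` than `η` is; the signed measure
contributes the second factor `r`. -/
lemma HasVarDeriv.abs_sub_sub_le {G : Meas d → ℝ} {D : Meas d → Euc d → ℝ}
    {D' : Euc d → Meas d → Euc d → ℝ} {c c' : ℝ}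
    (h : HasVarDeriv G D) (hDm : ∀ μ ∈ unitBall d, Measurable (D μ))
    (hDc : ∀ μ ∈ unitBall d, ∀ x, |D μ x| ≤ c)
    (h' : ∀ x, HasVarDeriv (fun μ => D μ x) (D' x))
    (hDm' : ∀ x, ∀ μ ∈ unitBall d, Measurable (D' x μ))
    (hDc' : ∀ x, ∀ μ ∈ unitBall d, ∀ y, |D' x μ y| ≤ c') (hc' : 0 ≤ c')
    {ρ η : ProbabilityMeasure (Euc d)} {r : ℝ} (hr : TVLe (η : Measure (Euc d)) ρ r) :
    |G (ofProb η) - G (ofProb ρ) - (∫ x, D (ofProb ρ) x ∂(η : Measure (Euc d))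
      - ∫ x, D (ofProb ρ) x ∂(ρ : Measure (Euc d)))| ≤ c' * r ^ 2 := by
  obtain ⟨hcont, hder⟩ := h.segment hDm hDc ρ η
  set a := ∫ x, D (ofProb ρ) x ∂(η : Measure (Euc d))
      - ∫ x, D (ofProb ρ) x ∂(ρ : Measure (Euc d)) with ha
  have hcont' := hcont.sub (f := fun s : ℝ => G (ofProb ρ + s • (ofProb η - ofProb ρ)))
    (g := fun s : ℝ => s * a) (by fun_prop)
  have hder' := fun s (hs : s ∈ Ico (0 : ℝ) 1) => (hder s hs).sub
    (((hasDerivAt_id s).mul_const a).hasDerivWithinAt (s := Ici s))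
  have hρb := ofProb_mem_unitBall ρ
  have := norm_image_sub_le_of_norm_deriv_right_le_segment hcont' hder' (C := c' * r ^ 2)
    (fun s hs => by
      obtain ⟨ζ, hζ, hζi⟩ := exists_segment ρ η ⟨hs.1, hs.2.le⟩
      rw [← hζ]
      have hb := ofProb_mem_unitBall ζ
      have hζr : TVLe (ζ : Measure (Euc d)) ρ r := fun f hf h1 => by
        rw [hζi f 1 hf h1]
        have e : (1 - s) * ∫ x, f x ∂(ρ : Measure (Euc d)) + s * ∫ x, f x ∂(η : Measure (Euc d))
            - ∫ x, f x ∂(ρ : Measure (Euc d)) = s * (∫ x, f x ∂(η : Measure (Euc d))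
              - ∫ x, f x ∂(ρ : Measure (Euc d))) := by ring
        rw [e, abs_mul, abs_of_nonneg hs.1]
        have h2 := hr f hf h1
        have h3 := mul_le_mul_of_nonneg_right hs.2.le
          (abs_nonneg (∫ x, f x ∂(η : Measure (Euc d)) - ∫ x, f x ∂(ρ : Measure (Euc d))))
        linarith
      have hdiff : ∀ x, |D (ofProb ζ) x - D (ofProb ρ) x| ≤ c' * r := fun x =>
        (h' x).abs_sub_le (hDm' x) (hDc' x) hc' hζr
      have key := hr.abs_sub_le ((hDm _ hb).sub (hDm _ hρb)) hdiff (mul_nonneg hc' hr.nonneg)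
      rw [Real.norm_eq_abs]
      have hi : ∀ m : ProbabilityMeasure (Euc d),
          ∫ x, (D (ofProb ζ) x - D (ofProb ρ) x) ∂(m : Measure (Euc d))
            = ∫ x, D (ofProb ζ) x ∂(m : Measure (Euc d))
              - ∫ x, D (ofProb ρ) x ∂(m : Measure (Euc d)) := fun m =>
        integral_sub (integrable_of_abs_le (hDm _ hb) (hDc _ hb))
          (integrable_of_abs_le (hDm _ hρb) (hDc _ hρb))
      simp only [Pi.sub_apply] at key
      rw [hi, hi] at key
      refine le_trans (le_of_eq ?_) (key.trans (le_of_eq (by ring)))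
      congr 1
      simp only [ha, one_mul]
      ring) 1 ⟨zero_le_one, le_rfl⟩
  simpa [sub_right_comm] using this

variable {Y : Type*} [MeasurableSpace Y]

/-- Expand `G` at `ρ₀`, once at each `η y` and once at the mean `ρ'`. The affine terms cancel after
averaging, and the two quadratic remainders give the constant `2 * c`. -/
lemma JumpGame.HasVarDeriv2.lip_and_gap {G : Meas d → ℝ} {D1 : Meas d → C₀(Euc d, ℝ)}
    {D2 : Meas d → C₀(Euc d × Euc d, ℝ)} (h : HasVarDeriv2 G D1 D2) {a c : ℝ} (hc : 0 ≤ c)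
    (hm : Measurable fun ρ : ProbabilityMeasure (Euc d) => G (ofProb ρ))
    (ha : ∀ ρ : ProbabilityMeasure (Euc d), |G (ofProb ρ)| ≤ a)
    (hD : ∀ μ ∈ unitBall d, ‖D1 μ‖ + ‖D2 μ‖ ≤ c) :
    (∀ ρ ρ' : ProbabilityMeasure (Euc d), ∀ r, TVLe (ρ : Measure (Euc d)) ρ' r →
      |G (ofProb ρ) - G (ofProb ρ')| ≤ c * r) ∧ HasGap Y (fun ρ => G (ofProb ρ)) (2 * c) := by
  have hD1 : ∀ μ ∈ unitBall d, ∀ x, |D1 μ x| ≤ c := fun μ hμ x =>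
    (abs_apply_le_norm _ x).trans (by linarith [hD μ hμ, norm_nonneg (D2 μ)])
  have hD2 : ∀ x, ∀ μ ∈ unitBall d, ∀ y, |D2 μ (x, y)| ≤ c := fun x μ hμ y => by
    have h1 : |D2 μ (x, y)| ≤ ‖D2 μ‖ := by
      rw [← ZeroAtInftyContinuousMap.norm_toBCF_eq_norm]
      exact (D2 μ).toBCF.norm_coe_le_norm (x, y)
    linarith [hD μ hμ, norm_nonneg (D1 μ)]
  have hDm1 : ∀ μ ∈ unitBall d, Measurable (D1 μ) := fun μ _ => (map_continuous _).measurable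
  have hDm2 : ∀ x, ∀ μ ∈ unitBall d, Measurable fun y => D2 μ (x, y) := fun x μ _ =>
    ((map_continuous (D2 μ)).comp (by fun_prop : Continuous fun y => (x, y))).measurable
  have hv : HasVarDeriv G (fun μ => D1 μ) := h.first
  have hv' : ∀ x, HasVarDeriv (fun μ => D1 μ x) (fun μ y => D2 μ (x, y)) := h.second
  refine ⟨fun ρ ρ' r hr => hv.abs_sub_le hDm1 hD1 hc hr, ?_⟩
  intro κ η ρ₀ ρ' r hs
  have := hs.prob
  have hρ₀ := ofProb_mem_unitBall ρ₀
  have taylor := fun (ζ : ProbabilityMeasure (Euc d)) s (hs : TVLe (ζ : Measure (Euc d)) ρ₀ s) =>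
    hv.abs_sub_sub_le hDm1 hD1 hv' hDm2 hD2 hc hs
  obtain ⟨hcl, hsq⟩ := hs.mean_close
  have k₁ := taylor _ _ hcl
  rw [hs.mean_of_abs_le (hDm1 _ hρ₀) (hD1 _ hρ₀)] at k₁
  have i0 : Integrable (fun y => G (ofProb (η y))) κ :=
    integrable_of_abs_le (hm.comp hs.meas) fun y => ha _
  have i1 : Integrable (fun y => ∫ x, D1 (ofProb ρ₀) x ∂(η y : Measure (Euc d))) κ :=
    integrable_of_abs_le (hs.measurable_integral (hDm1 _ hρ₀))
      fun y => abs_integral_le_of_prob (hD1 _ hρ₀)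
  have k₂ : |∫ y, (G (ofProb (η y)) - G (ofProb ρ₀)
      - (∫ x, D1 (ofProb ρ₀) x ∂(η y : Measure (Euc d))
        - ∫ x, D1 (ofProb ρ₀) x ∂(ρ₀ : Measure (Euc d)))) ∂κ| ≤ c * ∫ y, r y ^ 2 ∂κ := by
    rw [← integral_const_mul]
    exact abs_integral_le_integral (hs.integrable_sq.const_mul _)
      fun y => taylor _ _ (hs.close y)
  have i2 : Integrable (fun y => G (ofProb (η y)) - G (ofProb ρ₀)) κ := i0.sub (integrable_const _)
  have i3 : Integrable (fun y => ∫ x, D1 (ofProb ρ₀) x ∂(η y : Measure (Euc d))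
        - ∫ x, D1 (ofProb ρ₀) x ∂(ρ₀ : Measure (Euc d))) κ := i1.sub (integrable_const _)
  rw [integral_sub i2 i3, integral_sub i0 (integrable_const _),
    integral_sub i1 (integrable_const _)] at k₂
  simp only [integral_const, probReal_univ, smul_eq_mul, one_mul] at k₂
  have k₃ : c * (∫ y, r y ∂κ) ^ 2 ≤ c * ∫ y, r y ^ 2 ∂κ := mul_le_mul_of_nonneg_left hsq hc
  rw [abs_le] at *
  constructor <;> linarith

end Variational

/-! ### Regular functionals and regular jump rates -/

/-- Functionals of a state and a probability measure that are bounded and Lipschitz continuous in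
total variation and satisfy the second order averaging estimate, all with the constant `M`. -/
structure RegularFunctional {E : Type*} [MeasurableSpace E] (Y : Type*) [MeasurableSpace Y]
    (M : ℝ) (V : E → ProbabilityMeasure E → ℝ) : Prop where
  meas : Measurable (Function.uncurry V)
  bdd : ∀ x ρ, |V x ρ| ≤ M
  lip : ∀ x, ∀ ρ ρ' : ProbabilityMeasure E, ∀ r, TVLe (ρ : Measure E) ρ' r →
    |V x ρ - V x ρ'| ≤ M * r
  gap : ∀ x, HasGap Y (V x) M

/-- Jump rates, as a function of time, state and population, that are uniformly bounded, Lipschitz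
continuous in total variation and of second order in the population. -/
structure RegularRate {E : Type*} [MeasurableSpace E] [PseudoMetricSpace E] (Y : Type*)
    [MeasurableSpace Y] (T Θ : ℝ) (R : Kernel (ℝ × (E × ProbabilityMeasure E)) E) : Prop where
  finite : IsFiniteKernel R
  mass : ∀ p, (R p).real univ ≤ Θ
  lip_measure : ∀ t ∈ Icc 0 T, ∀ x, ∀ ρ ρ' : ProbabilityMeasure E, ∀ r,
    TVLe (ρ : Measure E) ρ' r → TVLe (R (t, x, ρ)) (R (t, x, ρ')) (Θ * r)
  lip_space : ∀ t ∈ Icc 0 T, ∀ x x' ρ, TVLe (R (t, x, ρ)) (R (t, x', ρ)) (Θ * dist x x')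
  gap : ∀ t ∈ Icc 0 T, ∀ x, ∀ f : E → ℝ, Measurable f → (∀ y, |f y| ≤ 1) →
    HasGap Y (fun ρ => ∫ y, f y ∂(R (t, x, ρ))) Θ

/-! ### From the class `C^{2,2}` to regular functionals -/

section C22

variable {d : ℕ} {F : Euc d → Meas d → ℝ} {D1 : Euc d → Meas d → C₀(Euc d, ℝ)}
  {D2 : Euc d → Meas d → C₀(Euc d × Euc d, ℝ)} {m : ℝ}

lemma abs_le_of_c22Norm_le (hm : c22Norm F D1 D2 ≤ ENNReal.ofReal m) (hm0 : 0 ≤ m) (x : Euc d)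
    {μ : Meas d} (hμ : μ ∈ unitBall d) : |F x μ| ≤ m := by
  have h1 : ‖F x μ‖ₑ ≤ c22Norm F D1 D2 := by
    refine le_trans ?_ le_add_self
    refine le_trans ?_ (le_iSup (fun x => c2Norm (F x) (D1 x) (D2 x)) x)
    exact le_trans (le_iSup₂ (f := fun μ (_ : μ ∈ unitBall d) => ‖F x μ‖ₑ) μ hμ) le_self_add
  have := h1.trans hm
  rwa [Real.enorm_eq_ofReal_abs, ENNReal.ofReal_le_ofReal_iff hm0] at this

lemma norm_add_norm_le_of_c22Norm_le (hm : c22Norm F D1 D2 ≤ ENNReal.ofReal m) (hm0 : 0 ≤ m)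
    (x : Euc d) {μ : Meas d} (hμ : μ ∈ unitBall d) : ‖D1 x μ‖ + ‖D2 x μ‖ ≤ m := by
  have h1 : ‖D1 x μ‖ₑ + ‖D2 x μ‖ₑ ≤ c22Norm F D1 D2 := by
    refine le_trans ?_ le_add_self
    refine le_trans ?_ (le_iSup (fun x => c2Norm (F x) (D1 x) (D2 x)) x)
    exact le_trans (le_iSup₂ (f := fun μ (_ : μ ∈ unitBall d) => ‖D1 x μ‖ₑ + ‖D2 x μ‖ₑ) μ hμ)
      le_add_self
  have := h1.trans hm
  rwa [← ofReal_norm, ← ofReal_norm, ← ENNReal.ofReal_add (norm_nonneg _) (norm_nonneg _),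
    ENNReal.ofReal_le_ofReal_iff hm0] at this

lemma norm_fderiv_le_of_c22Norm_le (hm : c22Norm F D1 D2 ≤ ENNReal.ofReal m) (hm0 : 0 ≤ m)
    (x : Euc d) {μ : Meas d} (hμ : μ ∈ unitBall d) : ‖fderiv ℝ (fun x => F x μ) x‖ ≤ m := by
  have h1 : ‖fderiv ℝ (fun x => F x μ) x‖ₑ ≤ c22Norm F D1 D2 := by
    refine le_trans ?_ le_self_add
    refine le_trans ?_
      (le_iSup₂ (f := fun μ (_ : μ ∈ unitBall d) => spaceC2Norm fun x => F x μ) μ hμ)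
    refine le_trans ?_ (le_iSup (fun y => ‖F y μ‖ₑ + ‖fderiv ℝ (fun x => F x μ) y‖ₑ
      + ‖fderiv ℝ (fderiv ℝ fun x => F x μ) y‖ₑ) x)
    exact le_add_self.trans le_self_add
  have := h1.trans hm
  rwa [← ofReal_norm, ENNReal.ofReal_le_ofReal_iff hm0] at this

lemma JumpGame.IsC22.abs_sub_le (h : IsC22 F D1 D2) (hm : c22Norm F D1 D2 ≤ ENNReal.ofReal m)
    (hm0 : 0 ≤ m) (x x' : Euc d) {μ : Meas d} (hμ : μ ∈ unitBall d) :
    |F x μ - F x' μ| ≤ m * ‖x - x'‖ :=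
  convex_univ.norm_image_sub_le_of_norm_fderiv_le (𝕜 := ℝ)
    (fun y _ => ((h.space μ hμ).differentiable (by norm_num)).differentiableAt)
    (fun y _ => norm_fderiv_le_of_c22Norm_le hm hm0 y hμ) (mem_univ x') (mem_univ x)

/-- A functional whose sections at fixed states come from functionals in `C^{2,2}` is regular. -/
lemma regularFunctional_of_forall_isC22 (Y : Type*) [MeasurableSpace Y]
    {V : Euc d → ProbabilityMeasure (Euc d) → ℝ} (hm0 : 0 ≤ m)
    (hV : Measurable (Function.uncurry V))
    (h : ∀ x, ∃ F D1 D2, IsC22 (d := d) F D1 D2 ∧ c22Norm F D1 D2 ≤ ENNReal.ofReal m ∧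
      ∀ ρ, V x ρ = F x (ofProb ρ)) : RegularFunctional Y (2 * m) V := by
  have bdd : ∀ x ρ, |V x ρ| ≤ m := fun x ρ => by
    obtain ⟨F, D1, D2, -, hm, hF⟩ := h x
    rw [hF]
    exact abs_le_of_c22Norm_le hm hm0 x (ofProb_mem_unitBall ρ)
  have key : ∀ x, (∀ ρ ρ' : ProbabilityMeasure (Euc d), ∀ r, TVLe (ρ : Measure (Euc d)) ρ' r →
      |V x ρ - V x ρ'| ≤ m * r) ∧ HasGap Y (V x) (2 * m) := fun x => by
    -- The functional may change with `x`: a running cost is later taken at the control `γ t x`, and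
    -- the section at fixed `x` is all that enters here.
    obtain ⟨F, D1, D2, hC, hm, hF⟩ := h x
    have e : V x = fun ρ => F x (ofProb ρ) := funext hF
    have := (hC.var x).lip_and_gap (Y := Y) hm0
      (by rw [← e]; exact hV.comp (measurable_const.prodMk measurable_id))
      (fun ρ => abs_le_of_c22Norm_le hm hm0 x (ofProb_mem_unitBall ρ))
      (fun μ hμ => norm_add_norm_le_of_c22Norm_le hm hm0 x hμ)
    rwa [e]
  exact ⟨hV, fun x ρ => (bdd x ρ).trans (by linarith),
    fun x ρ ρ' r hr => ((key x).1 ρ ρ' r hr).trans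
      (mul_le_mul_of_nonneg_right (by linarith) hr.nonneg), fun x => (key x).2⟩

end C22

/-! ### Regularity of the jump rates under a strategy -/

section Rates

variable {d m : ℕ}

/-- For fixed data the gap compares two measures, the mixture of the `k (η y)` and `k ρ'`. Testing
them with `C_∞` bounds their total variation distance, so the estimate extends to bounded measurable
test functions. -/
lemma hasGap_kernel_of_zeroAtInfty {Y : Type*} [MeasurableSpace Y]
    {k : Kernel (ProbabilityMeasure (Euc d)) (Euc d)} [IsFiniteKernel k] {c : ℝ}
    (h : ∀ g : C₀(Euc d, ℝ), ‖g‖ ≤ 1 → HasGap Y (fun ρ => ∫ x, g x ∂k ρ) c)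
    {f : Euc d → ℝ} (hf : Measurable f) (h1 : ∀ x, |f x| ≤ 1) :
    HasGap Y (fun ρ => ∫ x, f x ∂k ρ) c := by
  intro κ η ρ₀ ρ' r hs
  have := hs.prob
  have key : TVLe (κ.bind (k.comap η hs.meas)) (k ρ') (c * ∫ y, r y ^ 2 ∂κ) :=
    tvLe_of_forall_zeroAtInfty fun g hg => by
      rw [integral_bind_kernel κ _ (map_continuous g).measurable (abs_apply_le_norm g)]
      exact h g hg κ η ρ₀ ρ' r hs
  have := key f hf h1
  rwa [integral_bind_kernel κ _ hf h1] at this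

/-- A Carathéodory function: continuous in one variable and measurable in the other. Projecting the
time to `[0, T]` makes this hold for all real times, since `γ` is unrestricted outside. -/
lemma measurable_strategy {T L : ℝ} (hT : 0 ≤ T) {U : Set (Euc m)} {γ : ℝ → Euc d → Euc m}
    (hγ : IsStrategy T U L γ) :
    Measurable fun p : ℝ × Euc d => γ (projIcc 0 T hT p.1) p.2 := by
  have hc : ∀ t ∈ Icc 0 T, Continuous (γ t) := fun t ht =>
    (LipschitzWith.of_dist_le_mul (K := L.toNNReal) fun x y => by
      rw [dist_eq_norm, dist_eq_norm]
      exact (hγ.lipschitz t ht x y).trans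
        (mul_le_mul_of_nonneg_right (le_max_left _ _) (norm_nonneg _))).continuous
  refine measurable_uncurry_of_continuous_of_measurable
    (u := fun (t : ℝ) (x : Euc d) => γ (projIcc 0 T hT t) x) (fun x => ?_) (fun t => ?_)
  · have := (hγ.time_cont x).comp_continuous (f := fun t => (projIcc 0 T hT t : ℝ))
      (continuous_subtype_val.comp continuous_projIcc) fun t => (projIcc 0 T hT t).2
    exact this
  · exact (hc _ (projIcc 0 T hT t).2).measurable

/-- The jump rates of a player with strategy `γ` are regular, uniformly in the strategy. -/
theorem exists_regularRate {T L : ℝ} (hT : 0 ≤ T) (hL : 0 ≤ L) {U : Set (Euc m)}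
    {ν : JumpKernel d m} (hν : KernelHyp T U ν) :
    ∃ Θ : ℝ, 0 ≤ Θ ∧ ∀ (Y : Type) [MeasurableSpace Y] (γ : ℝ → Euc d → Euc m),
      IsStrategy T U L γ → ∃ R : Kernel (ℝ × (Euc d × ProbabilityMeasure (Euc d))) (Euc d),
        RegularRate Y T Θ R ∧ ∀ t ∈ Icc 0 T, ∀ x ρ, R (t, x, ρ) = ν (t, x, ofProb ρ, γ t x) := by
  have := hν.bounded
  obtain ⟨K₁, hK₁⟩ := hν.lipschitz
  obtain ⟨K₂, hK₂⟩ := hν.var_deriv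
  -- The three summands bound the mass, the Lipschitz constants (with `1 + L` because the strategy
  -- moves with `x`), and the gap (twice the bound on the derivatives, as in `lip_and_gap`).
  -- Absolute values are needed because the sign of `K₁`, `K₂` is not prescribed.
  set Θ := ν.bound.toReal + |K₁| * (1 + L) + 2 * |K₂| with hΘ
  have hb : 0 ≤ ν.bound.toReal := ENNReal.toReal_nonneg
  have hΘ₁ : |K₁| * (1 + L) ≤ Θ := by linarith [abs_nonneg K₂]
  have hK₁0 := abs_nonneg K₁
  have hΘ₂ : 2 * |K₂| ≤ Θ := by
    have : 0 ≤ |K₁| * (1 + L) := by positivity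
    linarith
  -- `Θ` is fixed before `Y`; with `Y` the configuration space of `N` players this makes the final
  -- constant independent of `N`.
  refine ⟨Θ, by positivity, fun Y _ γ hγ => ?_⟩
  have hmeas : Measurable fun p : ℝ × (Euc d × ProbabilityMeasure (Euc d)) =>
      ((p.1, p.2.1, ofProb p.2.2, γ (projIcc 0 T hT p.1) p.2.1) : ℝ × Euc d × Meas d × Euc m) :=
    measurable_fst.prodMk ((measurable_fst.comp measurable_snd).prodMk
      ((measurable_ofProb.comp (measurable_snd.comp measurable_snd)).prodMk
        ((measurable_strategy hT hγ).comp
          (measurable_fst.prodMk (measurable_fst.comp measurable_snd)))))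
  have heq : ∀ t ∈ Icc 0 T, ∀ x ρ, ν.comap _ hmeas (t, x, ρ) = ν (t, x, ofProb ρ, γ t x) := by
    intro t ht x ρ
    rw [Kernel.comap_apply]
    simp [projIcc_of_mem hT ht]
  have lip : ∀ t ∈ Icc 0 T, ∀ x x' : Euc d, ∀ ρ ρ' : ProbabilityMeasure (Euc d), ∀ u ∈ U, ∀ u' ∈ U,
      ∀ r, TVLe (ρ : Measure (Euc d)) ρ' r →
      TVLe (ν (t, x, ofProb ρ, u)) (ν (t, x', ofProb ρ', u'))
        (|K₁| * (‖x - x'‖ + r + ‖u - u'‖)) := by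
    intro t ht x x' ρ ρ' u hu u' hu' r hr
    have hr0 := hr.nonneg
    refine tvLe_of_dualNorm_le (by positivity) ((hK₁ t ht x x' _ (ofProb_mem_unitBall ρ) _
      (ofProb_mem_unitBall ρ') u hu u' hu').trans ?_)
    rw [ENNReal.ofReal_mul hK₁0, ENNReal.ofReal_add (by positivity) (norm_nonneg _),
      ENNReal.ofReal_add (norm_nonneg _) hr0, ofReal_norm, ofReal_norm]
    gcongr
    · exact le_abs_self _
    · exact dualNorm_le_of_tvLe hr
  refine ⟨ν.comap _ hmeas, ⟨inferInstance, fun p => ?_, ?_, ?_, ?_⟩, heq⟩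
  · have h1 : (ν.comap _ hmeas p).real univ ≤ ν.bound.toReal :=
      ENNReal.toReal_mono (Kernel.bound_ne_top ν) (by
        rw [Kernel.comap_apply]; exact Kernel.measure_le_bound ν _ _)
    have : 0 ≤ |K₁| * (1 + L) := by positivity
    linarith [abs_nonneg K₂]
  · intro t ht x ρ ρ' r hr
    rw [heq t ht, heq t ht]
    refine (lip t ht x x ρ ρ' _ (hγ.mem t ht x) _ (hγ.mem t ht x) r hr).mono ?_
    simp only [sub_self, norm_zero, zero_add, add_zero]
    refine mul_le_mul_of_nonneg_right (le_trans ?_ hΘ₁) hr.nonneg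
    nlinarith
  · intro t ht x x' ρ
    rw [heq t ht, heq t ht]
    refine (lip t ht x x' ρ ρ _ (hγ.mem t ht x) _ (hγ.mem t ht x') 0 (TVLe.refl _)).mono ?_
    rw [dist_eq_norm]
    have h1 := hγ.lipschitz t ht x x'
    calc |K₁| * (‖x - x'‖ + 0 + ‖γ t x - γ t x'‖)
        ≤ |K₁| * (‖x - x'‖ + 0 + L * ‖x - x'‖) := by gcongr
      _ = |K₁| * (1 + L) * ‖x - x'‖ := by ring
      _ ≤ Θ * ‖x - x'‖ := by gcongr
  · intro t ht x f hf h1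
    simp only [heq t ht]
    have hm' : Measurable fun ρ : ProbabilityMeasure (Euc d) =>
        ((t, x, ofProb ρ, γ t x) : ℝ × Euc d × Meas d × Euc m) :=
      measurable_const.prodMk (measurable_const.prodMk
        (measurable_ofProb.prodMk measurable_const))
    refine hasGap_kernel_of_zeroAtInfty (k := ν.comap _ hm') (fun g hg => ?_) hf h1
    obtain ⟨D1, D2, hD, hbd⟩ := hK₂ t ht x _ (hγ.mem t ht x) g
    refine ((hD.lip_and_gap (Y := Y) (c := |K₂|) (a := ‖g‖ * ν.bound.toReal) (abs_nonneg _) ?_ ?_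
      ?_).2).mono hΘ₂
    · exact measurable_integral_kernel (f := fun _ => g)
        ((map_continuous g).measurable.comp measurable_snd) (ν.comap _ hm')
    · intro ρ
      refine (abs_integral_le_of_abs_le (abs_apply_le_norm g)).trans ?_
      gcongr
      exact ENNReal.toReal_mono (Kernel.bound_ne_top ν) (Kernel.measure_le_bound ν _ _)
    · intro ρ hρ
      refine (hbd ρ hρ).trans ?_
      calc K₂ * ‖g‖ ≤ |K₂| * ‖g‖ := by gcongr; exact le_abs_self _
        _ ≤ |K₂| * 1 := by gcongr
        _ = |K₂| := mul_one _

end Rates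

/-! ### One step of the discretized dynamics -/

section Step

variable {E Y : Type*} [MeasurableSpace E] [MeasurableSpace Y]

/-- Transition probabilities of one time step that depend regularly on state and population. -/
structure RegularStep [PseudoMetricSpace E] (Y : Type*) [MeasurableSpace Y] (φ : ℝ)
    (K : Kernel (E × ProbabilityMeasure E) E) : Prop where
  nonneg : 0 ≤ φ
  lip_measure : ∀ x, ∀ ρ ρ' : ProbabilityMeasure E, ∀ r,
    TVLe (ρ : Measure E) ρ' r → TVLe (K (x, ρ)) (K (x, ρ')) (φ * r)
  space : ∀ x x' ρ, ∀ f : E → ℝ, ∀ a, Measurable f → (∀ y, |f y| ≤ a) →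
    |∫ y, f y ∂(K (x, ρ)) - ∫ y, f y ∂(K (x', ρ))| ≤ |f x - f x'| + a * (φ * dist x x')
  gap : ∀ x, ∀ f : E → ℝ, Measurable f → (∀ y, |f y| ≤ 1) →
    HasGap Y (fun ρ => ∫ y, f y ∂(K (x, ρ))) φ

/-- The law at the next time of a player whose present law is `ρ`. -/
noncomputable def evolve (K : Kernel (E × ProbabilityMeasure E) E) [IsMarkovKernel K]
    (ρ : ProbabilityMeasure E) : ProbabilityMeasure E :=
  ⟨(ρ : Measure E).bind (K.comap (fun x => (x, ρ)) (measurable_id.prodMk measurable_const)),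
    inferInstance⟩

variable {K K' : Kernel (E × ProbabilityMeasure E) E} [IsMarkovKernel K] [IsMarkovKernel K']

lemma integral_evolve (ρ : ProbabilityMeasure E) {f : E → ℝ} {c : ℝ} (hf : Measurable f)
    (hc : ∀ x, |f x| ≤ c) :
    ∫ x, f x ∂(evolve K ρ : Measure E) = ∫ x, (∫ y, f y ∂(K (x, ρ))) ∂(ρ : Measure E) :=
  integral_bind_kernel (ρ : Measure E) _ hf hc

lemma measurable_evolve : Measurable (evolve K) := by
  refine Measurable.subtype_mk (Measure.measurable_of_measurable_coe _ fun B hB => ?_)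
  have h1 : ∀ ρ : ProbabilityMeasure E, (ρ : Measure E).bind
      (K.comap (fun x => (x, ρ)) (measurable_id.prodMk measurable_const)) B
      = ∫⁻ x, K (x, ρ) B ∂(idKernel E ρ) := fun ρ => by
    rw [Measure.bind_apply hB (Kernel.aemeasurable _)]; rfl
  simp only [h1]
  exact Measurable.lintegral_kernel_prod_right (f := fun ρ x => K (x, ρ) B)
    ((Kernel.measurable_coe K hB).comp measurable_swap)

lemma measurable_integral_step {f : E → ℝ} (hf : Measurable f) :
    Measurable fun p => ∫ y, f y ∂(K p) :=
  measurable_integral_kernel (f := fun _ => f) (hf.comp measurable_snd) K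

/-- One step of the discretized backward evolution of a pair of a tagged player, moving according
to `K'`, and a population, evolving according to `K`. -/
noncomputable def stepOp (K' K : Kernel (E × ProbabilityMeasure E) E) [IsMarkovKernel K]
    (V : E → ProbabilityMeasure E → ℝ) (x : E) (ρ : ProbabilityMeasure E) : ℝ :=
  ∫ y, V y (evolve K ρ) ∂(K' (x, ρ))

variable [PseudoMetricSpace E] {φ M l : ℝ}

/-- The law `ρ` enters twice: as initial law, which contributes `r`, and as population inside the
kernel, which contributes `φ * r`. -/
lemma RegularStep.evolve_lip (hK : RegularStep Y φ K) {ρ ρ' : ProbabilityMeasure E} {r : ℝ}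
    (hr : TVLe (ρ : Measure E) ρ' r) :
    TVLe (evolve K ρ : Measure E) (evolve K ρ') ((1 + φ) * r) := by
  intro f hf h1
  rw [integral_evolve ρ hf h1, integral_evolve ρ' hf h1]
  have hm : ∀ σ : ProbabilityMeasure E, Measurable fun x => ∫ y, f y ∂(K (x, σ)) := fun σ =>
    (measurable_integral_step hf).comp (measurable_id.prodMk measurable_const)
  have hb : ∀ (σ : ProbabilityMeasure E) x, |∫ y, f y ∂(K (x, σ))| ≤ 1 := fun σ x =>
    abs_integral_le_of_prob h1
  have t1 := hr _ (hm ρ) (hb ρ)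
  have t2 : |∫ x, (∫ y, f y ∂(K (x, ρ)) - ∫ y, f y ∂(K (x, ρ'))) ∂(ρ' : Measure E)| ≤ φ * r :=
    abs_integral_le_of_prob fun x => hK.lip_measure x ρ ρ' r hr f hf h1
  rw [integral_sub (integrable_of_abs_le (hm ρ) (hb ρ)) (integrable_of_abs_le (hm ρ') (hb ρ'))]
    at t2
  rw [abs_le] at *
  constructor <;> linarith

/-- Separate the two roles of `ρ` and use `HasGap.diag`: linear in the initial law (gap `0`), gap
`φ` in the population, and mixed difference at most `φ * r ^ 2`. The total is `0 + φ + 2 * φ`. -/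
lemma RegularStep.evolve_gap (hK : RegularStep Y φ K) {f : E → ℝ} (hf : Measurable f)
    (h1 : ∀ x, |f x| ≤ 1) :
    HasGap Y (fun ρ => ∫ x, f x ∂(evolve K ρ : Measure E)) (3 * φ) := by
  simp only [integral_evolve _ hf h1]
  have hm : ∀ σ : ProbabilityMeasure E, Measurable fun x => ∫ y, f y ∂(K (x, σ)) := fun σ =>
    (measurable_integral_step hf).comp (measurable_id.prodMk measurable_const)
  have hb : ∀ (σ : ProbabilityMeasure E) x, |∫ y, f y ∂(K (x, σ))| ≤ 1 := fun σ x =>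
    abs_integral_le_of_prob h1
  have := HasGap.diag (Y := Y) (c₁ := 0) (c₂ := φ) (e := φ) (a := 1)
    (M := fun ρ σ : ProbabilityMeasure E => ∫ x, (∫ y, f y ∂(K (x, σ))) ∂(ρ : Measure E))
    (fun σ => HasGap.integral_probabilityMeasure (hm σ) (hb σ))
    (fun ρ => by
      have := HasGap.integral (W := fun x σ => ∫ y, f y ∂(K (x, σ))) (fun x => hK.gap x f hf h1)
        (measurable_integral_step hf) (fun x σ => hb σ x) (ρ : Measure E)
      simpa using this)
    (measurable_integral_probabilityMeasure
      (f := fun (p : ProbabilityMeasure E × ProbabilityMeasure E) x => ∫ y, f y ∂(K (x, p.2)))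
      ((measurable_integral_step hf).comp
        (measurable_snd.prodMk (measurable_snd.comp measurable_fst))) measurable_fst)
    (fun ρ σ => abs_integral_le_of_prob (hb σ)) hK.nonneg
    (fun ρ ρ₀ r hr => by
      have key := hr.abs_sub_le ((hm ρ).sub (hm ρ₀))
        (fun x => hK.lip_measure x ρ ρ₀ r hr f hf h1) (mul_nonneg hK.nonneg hr.nonneg)
      simp only [Pi.sub_apply] at key
      rw [integral_sub (integrable_of_abs_le (hm ρ) (hb ρ)) (integrable_of_abs_le (hm ρ₀) (hb ρ₀)),
        integral_sub (integrable_of_abs_le (hm ρ) (hb ρ))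
          (integrable_of_abs_le (hm ρ₀) (hb ρ₀))] at key
      refine le_trans (le_of_eq ?_) (key.trans (le_of_eq (by ring)))
      congr 1
      ring)
  exact this.mono (by linarith)

/-- Regularity of functionals is propagated by the discretized evolution. -/
theorem RegularFunctional.step {V : E → ProbabilityMeasure E → ℝ}
    (hV : RegularFunctional Y M V) (hK : RegularStep Y φ K) (hK' : RegularStep Y φ K')
    (hφ : φ ≤ 1) (hM : 0 ≤ M) : RegularFunctional Y ((1 + 11 * φ) * M) (stepOp K' K V) := by
  have h0 := hK.nonneg
  set W : E → ProbabilityMeasure E → ℝ := fun y ρ => V y (evolve K ρ) with hW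
  have hWm : Measurable (Function.uncurry W) :=
    hV.meas.comp (measurable_fst.prodMk (measurable_evolve.comp measurable_snd))
  have hWb : ∀ y ρ, |W y ρ| ≤ M := fun y ρ => hV.bdd y _
  have hWl : ∀ y, ∀ ρ ρ' : ProbabilityMeasure E, ∀ r, TVLe (ρ : Measure E) ρ' r →
      |W y ρ - W y ρ'| ≤ M * ((1 + φ) * r) := fun y ρ ρ' r hr => hV.lip y _ _ _ (hK.evolve_lip hr)
  have hWg : ∀ y, HasGap Y (W y) (M * (1 + φ) ^ 2 + M * (3 * φ)) := fun y =>
    (hV.gap y).comp (hV.lip y) measurable_evolve (fun ρ ρ' r hr => hK.evolve_lip hr)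
      fun f hf h1 => hK.evolve_gap hf h1
  have hWs : ∀ ρ, Measurable fun y => W y ρ := fun ρ =>
    hWm.comp (measurable_id.prodMk measurable_const)
  have hle : M ≤ (1 + 11 * φ) * M := by nlinarith [mul_nonneg h0 hM]
  have hφM := mul_nonneg h0 hM
  have hφ2 : φ ^ 2 * M ≤ φ * M := by nlinarith
  refine ⟨?_, fun x ρ => (abs_integral_le_of_prob fun y => hWb y ρ).trans hle, ?_, fun x => ?_⟩
  · exact measurable_integral_kernel (f := fun (p : E × ProbabilityMeasure E) y => W y p.2)
      (hWm.comp (measurable_snd.prodMk (measurable_snd.comp measurable_fst))) K'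
  · intro x ρ ρ' r hr
    have hr0 := hr.nonneg
    have t1 : |∫ y, (W y ρ - W y ρ') ∂(K' (x, ρ))| ≤ M * ((1 + φ) * r) :=
      abs_integral_le_of_prob fun y => hWl y ρ ρ' r hr
    rw [integral_sub (integrable_of_abs_le (hWs ρ) fun y => hWb y ρ)
      (integrable_of_abs_le (hWs ρ') fun y => hWb y ρ')] at t1
    have t2 := (hK'.lip_measure x ρ ρ' r hr).abs_sub_le (hWs ρ') (fun y => hWb y ρ') hM
    have t3 : M * ((1 + φ) * r) + M * (φ * r) ≤ (1 + 11 * φ) * M * r := by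
      nlinarith [mul_nonneg hφM hr0]
    unfold stepOp
    rw [abs_le] at *
    constructor <;> linarith
  -- Here `ρ` acts through the evolved law in `W` and through the kernel `K'`. The diagonal estimate
  -- yields `M * ((1 + φ) ^ 2 + 3 * φ + φ + 2 * (1 + φ) * φ) = M * (1 + 8 * φ + 3 * φ ^ 2)`, and `φ
  -- ≤ 1` turns this into the factor `1 + 11 * φ`.
  · have := HasGap.diag (Y := Y) (c₁ := M * (1 + φ) ^ 2 + M * (3 * φ)) (c₂ := M * φ)
      (e := M * (1 + φ) * φ) (a := M)
      (M := fun ρ σ : ProbabilityMeasure E => ∫ y, W y ρ ∂(K' (x, σ)))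
      (fun σ => by
        have := HasGap.integral hWg hWm hWb (K' (x, σ))
        simpa using this)
      (fun ρ => by
        rcases hM.eq_or_lt with h | hpos
        · have : ∀ y, W y ρ = 0 := fun y => abs_nonpos_iff.mp ((hWb y ρ).trans h.symm.le)
          intro κ η ρ₀ ρ' r hs
          simp [this, ← h]
        · have := hK'.gap x (fun y => M⁻¹ * W y ρ) ((hWs ρ).const_mul _) fun y => by
            rw [abs_mul, abs_inv, abs_of_pos hpos, inv_mul_le_iff₀ hpos, mul_one]
            exact hWb y ρ
          intro κ η ρ₀ ρ' r hs
          have h2 := this κ η ρ₀ ρ' r hs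
          simp only [integral_const_mul] at h2
          rw [← mul_sub, abs_mul, abs_inv, abs_of_pos hpos, inv_mul_le_iff₀ hpos, ← mul_assoc] at h2
          exact h2)
      (measurable_integral_kernel
        (f := fun (p : ProbabilityMeasure E × ProbabilityMeasure E) y => W y p.1)
        (hWm.comp (measurable_snd.prodMk (measurable_fst.comp measurable_fst)))
        (K'.comap (fun p : ProbabilityMeasure E × ProbabilityMeasure E => (x, p.2))
          (measurable_const.prodMk measurable_snd)))
      (fun ρ σ => abs_integral_le_of_prob fun y => hWb y ρ) (by positivity)
      (fun ρ ρ₀ r hr => by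
        have hr0 := hr.nonneg
        have key := (hK'.lip_measure x ρ ρ₀ r hr).abs_sub_le ((hWs ρ).sub (hWs ρ₀))
          (hWl · ρ ρ₀ r hr) (by positivity)
        simp only [Pi.sub_apply] at key
        rw [integral_sub (integrable_of_abs_le (hWs ρ) fun y => hWb y ρ)
            (integrable_of_abs_le (hWs ρ₀) fun y => hWb y ρ₀),
          integral_sub (integrable_of_abs_le (hWs ρ) fun y => hWb y ρ)
            (integrable_of_abs_le (hWs ρ₀) fun y => hWb y ρ₀)] at key
        refine le_trans (le_of_eq ?_) (key.trans (le_of_eq (by ring)))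
        congr 1
        ring)
    refine this.mono ?_
    nlinarith

/-- Lipschitz continuity in the state is propagated by the discretized evolution. -/
lemma RegularFunctional.step_space {V : E → ProbabilityMeasure E → ℝ}
    {K₁ : Kernel (E × ProbabilityMeasure E) E}
    (hV : RegularFunctional Y M V) (hK₁ : RegularStep Y φ K₁)
    (hl : ∀ x x' ρ, |V x ρ - V x' ρ| ≤ l * dist x x') (x x' : E) (ρ : ProbabilityMeasure E) :
    |stepOp K₁ K V x ρ - stepOp K₁ K V x' ρ| ≤ (l + M * φ) * dist x x' := by
  have := hK₁.space x x' ρ (fun y => V y (evolve K ρ)) M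
    (hV.meas.comp (measurable_id.prodMk measurable_const)) fun y => hV.bdd y _
  have h2 := hl x x' (evolve K ρ)
  unfold stepOp
  linarith

end Step

/-! ### Jump rates cumulated over a time interval, and the Euler step -/

section Euler

variable {E Y : Type*} [MeasurableSpace E] [MeasurableSpace Y]

/-- The jump rates `R`, integrated over the time interval `(s, t]`. -/
noncomputable def cumRate {X : Type*} [MeasurableSpace X] (R : Kernel (ℝ × X) E) (s t : ℝ) :
    Kernel X E :=
  ⟨fun p => (volume.restrict (Ioc s t)).bind
    (R.comap (fun r => (r, p)) (measurable_id.prodMk measurable_const)),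
    Measure.measurable_of_measurable_coe _ fun B hB => by
      have h1 : ∀ p, (volume.restrict (Ioc s t)).bind
          (R.comap (fun r => (r, p)) (measurable_id.prodMk measurable_const)) B
          = ∫⁻ r in Ioc s t, R (r, p) B := fun p => by
        rw [Measure.bind_apply hB (Kernel.aemeasurable _)]; rfl
      simp only [h1]
      exact Measurable.lintegral_prod_left' (f := fun q => R q B) (Kernel.measurable_coe R hB)⟩

instance {X : Type*} [MeasurableSpace X] (R : Kernel (ℝ × X) E) [IsFiniteKernel R] (s t : ℝ) :
    IsFiniteKernel (cumRate R s t) := by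
  refine ⟨R.bound * volume (Ioc s t), ENNReal.mul_lt_top R.bound_lt_top
    measure_Ioc_lt_top, fun p => ?_⟩
  change (volume.restrict (Ioc s t)).bind
    (R.comap (fun r => (r, p)) (measurable_id.prodMk measurable_const)) univ ≤ _
  rw [Measure.bind_apply MeasurableSet.univ (Kernel.aemeasurable _)]
  refine (lintegral_mono (g := fun _ => R.bound) fun r => ?_).trans (by simp)
  exact Kernel.measure_le_bound R _ _

lemma integral_cumRate {X : Type*} [MeasurableSpace X] (R : Kernel (ℝ × X) E) [IsFiniteKernel R]
    {s t : ℝ} (hst : s ≤ t) (p : X) {f : E → ℝ} {c : ℝ} (hf : Measurable f) (hc : ∀ x, |f x| ≤ c) :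
    ∫ x, f x ∂(cumRate R s t p) = ∫ r in s..t, ∫ x, f x ∂(R (r, p)) := by
  rw [intervalIntegral.integral_of_le hst]
  exact integral_bind_kernel _ _ hf hc

lemma intervalIntegrable_integral_kernel {X : Type*} [MeasurableSpace X] (R : Kernel (ℝ × X) E)
    [IsFiniteKernel R] (s t : ℝ) (p : X) {f : E → ℝ} {c : ℝ} (hf : Measurable f)
    (hc : ∀ x, |f x| ≤ c) :
    IntervalIntegrable (fun r => ∫ x, f x ∂(R (r, p))) volume s t := by
  have hm : Measurable fun r => ∫ x, f x ∂(R (r, p)) :=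
    measurable_integral_kernel (f := fun _ => f) (hf.comp measurable_snd)
      (R.comap (fun r => (r, p)) (measurable_id.prodMk measurable_const))
  refine ⟨integrable_of_abs_le hm (c := |c| * R.bound.toReal) fun r => ?_,
    integrable_of_abs_le hm (c := |c| * R.bound.toReal) fun r => ?_⟩ <;>
  · refine (abs_integral_le_of_abs_le fun x => (hc x).trans (le_abs_self c)).trans ?_
    gcongr
    exact ENNReal.toReal_mono (Kernel.bound_ne_top R) (Kernel.measure_le_bound R _ _)

/-- Jump probabilities within one time step that are at most `θ` and depend regularly on state and
population. -/
structure RegularJump [PseudoMetricSpace E] (Y : Type*) [MeasurableSpace Y] (θ : ℝ)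
    (n : Kernel (E × ProbabilityMeasure E) E) : Prop where
  mass : ∀ p, (n p).real univ ≤ θ
  lip_measure : ∀ x, ∀ ρ ρ' : ProbabilityMeasure E, ∀ r,
    TVLe (ρ : Measure E) ρ' r → TVLe (n (x, ρ)) (n (x, ρ')) (θ * r)
  lip_space : ∀ x x' ρ, TVLe (n (x, ρ)) (n (x', ρ)) (θ * dist x x')
  gap : ∀ x, ∀ f : E → ℝ, Measurable f → (∀ y, |f y| ≤ 1) →
    HasGap Y (fun ρ => ∫ y, f y ∂(n (x, ρ))) θ

lemma abs_intervalIntegral_le {f : ℝ → ℝ} {s t c : ℝ} (hst : s ≤ t)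
    (h : ∀ r ∈ Icc s t, |f r| ≤ c) : |∫ r in s..t, f r| ≤ c * (t - s) := by
  have := intervalIntegral.norm_integral_le_of_norm_le_const (f := f) (a := s) (b := t) (C := c)
    fun r hr => h r (Ioc_subset_Icc_self (by rwa [uIoc_of_le hst] at hr))
  rwa [abs_of_nonneg (sub_nonneg.mpr hst)] at this

lemma abs_intervalIntegral_sub_le {f g : ℝ → ℝ} {s t c : ℝ} (hst : s ≤ t)
    (hf : IntervalIntegrable f volume s t) (hg : IntervalIntegrable g volume s t)
    (h : ∀ r ∈ Icc s t, |f r - g r| ≤ c) :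
    |(∫ r in s..t, f r) - ∫ r in s..t, g r| ≤ c * (t - s) := by
  rw [← intervalIntegral.integral_sub hf hg]
  exact abs_intervalIntegral_le hst h

/-- The transition probabilities `n + (1 - |n|) δ_x` of the Euler step with jump probabilities
`n`. -/
noncomputable def eulerKernel (n : Kernel (E × ProbabilityMeasure E) E) :
    Kernel (E × ProbabilityMeasure E) E :=
  ⟨fun p => n p + (1 - n p univ) • Measure.dirac p.1,
    Measure.measurable_of_measurable_coe _ fun B hB => by
      simp only [Measure.coe_add, Measure.coe_smul, Pi.add_apply, Pi.smul_apply, smul_eq_mul,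
        Measure.dirac_apply' _ hB]
      exact (Kernel.measurable_coe n hB).add
        ((measurable_const.sub (Kernel.measurable_coe n MeasurableSet.univ)).mul
          ((measurable_one.indicator hB).comp measurable_fst))⟩

variable {n : Kernel (E × ProbabilityMeasure E) E}

lemma eulerKernel_apply (p : E × ProbabilityMeasure E) :
    eulerKernel n p = n p + (1 - n p univ) • Measure.dirac p.1 := rfl

lemma isMarkovKernel_eulerKernel [IsFiniteKernel n] (h : ∀ p, (n p).real univ ≤ 1) :
    IsMarkovKernel (eulerKernel n) := ⟨fun p => ⟨by
  have h1 : n p univ ≤ 1 := by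
    rw [← ENNReal.ofReal_toReal (measure_ne_top (n p) univ)]
    exact ENNReal.ofReal_le_one.mpr (h p)
  simp only [eulerKernel_apply, Measure.coe_add, Measure.coe_smul, Pi.add_apply, Pi.smul_apply,
    measure_univ, smul_eq_mul, mul_one]
  exact add_tsub_cancel_of_le h1⟩⟩

lemma integral_eulerKernel [IsFiniteKernel n] (h : ∀ p, (n p).real univ ≤ 1)
    (p : E × ProbabilityMeasure E) {f : E → ℝ} {c : ℝ} (hf : Measurable f) (hc : ∀ x, |f x| ≤ c) :
    ∫ x, f x ∂(eulerKernel n p) = f p.1 + ∫ x, (f x - f p.1) ∂(n p) := by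
  have h1 : n p univ ≤ 1 := by
    rw [← ENNReal.ofReal_toReal (measure_ne_top (n p) univ)]
    exact ENNReal.ofReal_le_one.mpr (h p)
  have hi := integrable_of_abs_le (μ := n p) hf hc
  rw [eulerKernel_apply, integral_add_measure hi ((integrable_of_abs_le hf hc).smul_measure
      (ne_top_of_le_ne_top ENNReal.one_ne_top tsub_le_self)), integral_smul_measure,
    integral_dirac' _ _ hf.stronglyMeasurable, integral_sub hi (integrable_const _),
    ENNReal.toReal_sub_of_le h1 ENNReal.one_ne_top]
  simp only [integral_const, smul_eq_mul, ENNReal.toReal_one, measureReal_def]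
  ring

variable [PseudoMetricSpace E] {T Θ θ : ℝ}

/-- Each bound on the rates is integrated over the interval and gains the factor `t - s`. Because
the rates are integrated rather than frozen at an endpoint, the local errors below involve no
modulus of continuity in time. -/
lemma RegularRate.regularJump {R : Kernel (ℝ × (E × ProbabilityMeasure E)) E}
    (hR : RegularRate Y T Θ R) {s t : ℝ} (hs : 0 ≤ s) (hst : s ≤ t) (ht : t ≤ T) :
    RegularJump Y (Θ * (t - s)) (cumRate R s t) := by
  have := hR.finite
  have hT : ∀ r ∈ Icc s t, r ∈ Icc 0 T := fun r hr => ⟨hs.trans hr.1, hr.2.trans ht⟩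
  refine ⟨fun p => ?_, ?_, ?_, ?_⟩
  · have h1 := integral_cumRate R hst p (f := fun _ => (1 : ℝ)) measurable_const
      (c := 1) (by simp)
    simp only [integral_const, smul_eq_mul, mul_one] at h1
    rw [h1]
    refine (le_abs_self _).trans (abs_intervalIntegral_le hst fun r hr => ?_)
    rw [abs_of_nonneg measureReal_nonneg]
    exact hR.mass _
  · intro x ρ ρ' r hr f hf h1
    rw [integral_cumRate R hst _ hf h1, integral_cumRate R hst _ hf h1]
    refine (abs_intervalIntegral_sub_le hst (intervalIntegrable_integral_kernel R s t _ hf h1)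
      (intervalIntegrable_integral_kernel R s t _ hf h1)
      fun u hu => hR.lip_measure u (hT u hu) x ρ ρ' r hr f hf h1).trans (le_of_eq (by ring))
  · intro x x' ρ f hf h1
    rw [integral_cumRate R hst _ hf h1, integral_cumRate R hst _ hf h1]
    refine (abs_intervalIntegral_sub_le hst (intervalIntegrable_integral_kernel R s t _ hf h1)
      (intervalIntegrable_integral_kernel R s t _ hf h1)
      fun u hu => hR.lip_space u (hT u hu) x x' ρ f hf h1).trans (le_of_eq (by ring))
  · intro x f hf h1 κ η ρ₀ ρ' r hs'
    have := hs'.prob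
    have hm : Measurable fun q : ℝ × Y => ∫ z, f z ∂(R (q.1, (x, η q.2))) :=
      measurable_integral_kernel (f := fun _ => f) (hf.comp measurable_snd)
        (R.comap (fun q : ℝ × Y => (q.1, (x, η q.2))) (measurable_fst.prodMk
          (measurable_const.prodMk (hs'.meas.comp measurable_snd))))
    have hb : ∀ q : ℝ × Y, |∫ z, f z ∂(R (q.1, (x, η q.2)))| ≤ Θ := fun q => by
      have := abs_integral_le_of_abs_le (μ := R (q.1, (x, η q.2))) h1
      linarith [hR.mass (q.1, (x, η q.2))]
    simp only [integral_cumRate R hst _ hf h1]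
    have hswap : ∫ y, (∫ u in s..t, ∫ z, f z ∂(R (u, (x, η y)))) ∂κ
        = ∫ u in s..t, ∫ y, (∫ z, f z ∂(R (u, (x, η y)))) ∂κ := by
      simp only [intervalIntegral.integral_of_le hst]
      exact integral_integral_swap (integrable_of_abs_le (hm.comp measurable_swap) fun q => hb q.swap)
    rw [hswap]
    have hi : IntervalIntegrable (fun u => ∫ y, (∫ z, f z ∂(R (u, (x, η y)))) ∂κ) volume s t := by
      have hm' := measurable_integral_of_abs_le (f := fun u y => ∫ z, f z ∂(R (u, (x, η y)))) hm κ
      exact ⟨integrable_of_abs_le hm' fun u => abs_integral_le_of_prob fun y => hb (u, y),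
        integrable_of_abs_le hm' fun u => abs_integral_le_of_prob fun y => hb (u, y)⟩
    refine (abs_intervalIntegral_sub_le hst hi (intervalIntegrable_integral_kernel R s t _ hf h1)
      fun u hu => hR.gap u (hT u hu) x f hf h1 κ η ρ₀ ρ' r hs').trans (le_of_eq (by ring))

lemma RegularJump.abs_integral_eulerKernel_sub_le [IsFiniteKernel n] (hn : RegularJump Y θ n)
    (hθ : θ ≤ 1) (p : E × ProbabilityMeasure E) {f : E → ℝ} {a : ℝ} (hf : Measurable f)
    (ha : ∀ x, |f x| ≤ a) (ha0 : 0 ≤ a) :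
    |∫ x, f x ∂(eulerKernel n p) - f p.1| ≤ 2 * a * θ := by
  rw [integral_eulerKernel (fun p => (hn.mass p).trans hθ) p hf ha, add_sub_cancel_left]
  refine (abs_integral_le_of_abs_le (c := 2 * a) fun x => ?_).trans
    (mul_le_mul_of_nonneg_left (hn.mass p) (by positivity))
  exact (abs_sub _ _).trans (by linarith [ha x, ha p.1])

/-- A jump changes `f` by `f y - f x`, which is twice a function bounded by one; this is the factor
`2`. -/
lemma RegularJump.regularStep [IsFiniteKernel n] (hn : RegularJump Y θ n) (hθ : θ ≤ 1)
    (hθ0 : 0 ≤ θ) : RegularStep Y (2 * θ) (eulerKernel n) := by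
  have hmass : ∀ p, (n p).real univ ≤ 1 := fun p => (hn.mass p).trans hθ
  have half : ∀ (x : E) (f : E → ℝ), (∀ y, |f y| ≤ 1) → ∀ y, |(f y - f x) / 2| ≤ 1 :=
    fun x f h1 y => by
      rw [abs_div, abs_two, div_le_one two_pos]
      linarith [abs_sub (f y) (f x), h1 x, h1 y]
  have key : ∀ (x : E) (f : E → ℝ), Measurable f → (∀ y, |f y| ≤ 1) → ∀ ρ,
      ∫ y, f y ∂(eulerKernel n (x, ρ)) = f x + 2 * ∫ y, (f y - f x) / 2 ∂(n (x, ρ)) :=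
    fun x f hf h1 ρ => by
      rw [integral_eulerKernel hmass _ hf h1, integral_div]
      ring
  refine ⟨by positivity, ?_, ?_, ?_⟩
  · intro x ρ ρ' r hr f hf h1
    rw [key x f hf h1, key x f hf h1]
    have := hn.lip_measure x ρ ρ' r hr (fun y => (f y - f x) / 2)
      ((hf.sub_const _).div_const _) (half x f h1)
    rw [abs_le] at *
    constructor <;> linarith
  · intro x x' ρ f a hf ha
    have ha0 : 0 ≤ a := (abs_nonneg _).trans (ha x)
    rw [integral_eulerKernel hmass _ hf ha, integral_eulerKernel hmass _ hf ha]
    have hb : ∀ y, |f y - f x'| ≤ 2 * a := fun y =>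
      (abs_sub _ _).trans (by linarith [ha y, ha x'])
    have t := (hn.lip_space x x' ρ).abs_sub_le (hf.sub_const (f x')) hb (by positivity)
    have e : ∫ y, (f y - f x) ∂(n (x, ρ)) = ∫ y, (f y - f x') ∂(n (x, ρ))
        - (n (x, ρ)).real univ * (f x - f x') := by
      have : ∀ y, f y - f x = (f y - f x') - (f x - f x') := fun y => by ring
      simp only [this]
      rw [integral_sub (integrable_of_abs_le (hf.sub_const _) hb) (integrable_const _)]
      simp
    simp only at e ⊢
    rw [e]
    -- With the common reference value `f x'` in both integrals, `f x - f x'` appears with the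
    -- weight `1 - |n|`, which lies in `[0, 1]`. Thus no Lipschitz constant is lost, and the
    -- integrals only require `f` bounded and measurable.
    have e2 : f x + (∫ y, (f y - f x') ∂(n (x, ρ)) - (n (x, ρ)).real univ * (f x - f x'))
        - (f x' + ∫ y, (f y - f x') ∂(n (x', ρ)))
        = (1 - (n (x, ρ)).real univ) * (f x - f x')
          + (∫ y, (f y - f x') ∂(n (x, ρ)) - ∫ y, (f y - f x') ∂(n (x', ρ))) := by ring
    rw [e2]
    refine (abs_add_le _ _).trans (add_le_add ?_ (t.trans (le_of_eq (by ring))))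
    rw [abs_mul, abs_of_nonneg (by linarith [hmass (x, ρ)])]
    have h0 : 0 ≤ (n (x, ρ)).real univ := measureReal_nonneg
    nlinarith [abs_nonneg (f x - f x')]
  · intro x f hf h1 κ η ρ₀ ρ' r hs
    have := hs.prob
    simp only [key x f hf h1]
    have hg := hn.gap x (fun y => (f y - f x) / 2) ((hf.sub_const _).div_const _) (half x f h1)
      κ η ρ₀ ρ' r hs
    have hm : Measurable fun y => ∫ z, (f z - f x) / 2 ∂(n (x, η y)) :=
      measurable_integral_kernel (f := fun _ z => (f z - f x) / 2)
        (((hf.comp measurable_snd).sub_const _).div_const _)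
        (n.comap (fun y => (x, η y)) (measurable_const.prodMk hs.meas))
    have hi : Integrable (fun y => 2 * ∫ z, (f z - f x) / 2 ∂(n (x, η y))) κ :=
      (integrable_of_abs_le (c := 1) hm fun y =>
        (abs_integral_le_of_abs_le (half x f h1)).trans (by linarith [hmass (x, η y)])).const_mul 2
    rw [integral_add (integrable_const _) hi, integral_const_mul]
    simp only [integral_const, probReal_univ, smul_eq_mul, one_mul]
    rw [abs_le] at *
    constructor <;> linarith

end Euler

/-! ### Empirical measures -/

section Empirical

variable {E : Type*} [MeasurableSpace E] {N : ℕ} [NeZero N]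

/-- The empirical measure of a configuration, as a probability measure. -/
noncomputable def empProb (x : Fin N → E) : ProbabilityMeasure E :=
  ⟨(N : ℝ≥0∞)⁻¹ • ∑ i, Measure.dirac (x i), ⟨by
    simp only [Measure.coe_smul, Measure.coe_finsetSum, Pi.smul_apply, Finset.sum_apply,
      measure_univ, Finset.sum_const, Finset.card_univ, Fintype.card_fin, nsmul_eq_mul, mul_one,
      smul_eq_mul]
    exact ENNReal.inv_mul_cancel (by simp [NeZero.ne]) (by simp)⟩⟩

lemma coe_empProb (x : Fin N → E) :
    (empProb x : Measure E) = (N : ℝ≥0∞)⁻¹ • ∑ i, Measure.dirac (x i) := rfl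

lemma measurable_empProb : Measurable (empProb (E := E) (N := N)) := by
  refine Measurable.subtype_mk (Measure.measurable_of_measurable_coe _ fun B hB => ?_)
  simp only [Measure.coe_smul, Measure.coe_finsetSum, Pi.smul_apply, Finset.sum_apply,
    smul_eq_mul, Measure.dirac_apply' _ hB]
  exact (Finset.measurable_sum _ fun i _ =>
    (measurable_one.indicator hB).comp (measurable_pi_apply i)).const_mul _

lemma integral_empProb (x : Fin N → E) {f : E → ℝ} {c : ℝ} (hf : Measurable f)
    (hc : ∀ x, |f x| ≤ c) : ∫ y, f y ∂(empProb x : Measure E) = (N : ℝ)⁻¹ * ∑ i, f (x i) := by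
  rw [coe_empProb, integral_smul_measure,
    integral_finsetSum_measure fun i _ => integrable_of_abs_le hf hc]
  simp [integral_dirac' _ _ hf.stronglyMeasurable]

lemma ofProb_empProb {d : ℕ} (x : Fin N → Euc d) : ofProb (empProb x) = emp x := by
  ext B hB
  rw [ofProb_apply _ hB, coe_empProb, emp, measureReal_ennreal_smul_apply]
  simp only [smul_apply, ENNReal.toReal_inv, ENNReal.toReal_natCast, smul_eq_mul]
  congr 1
  have h1 : ∀ s : Finset (Fin N), (∑ i ∈ s, Measure.dirac (x i)).real B
      = (∑ i ∈ s, (Measure.dirac (x i)).toSignedMeasure) B := by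
    intro s
    induction s using Finset.induction_on with
    | empty => simp
    | insert i s hi ih =>
      rw [Finset.sum_insert hi, Finset.sum_insert hi, measureReal_add_apply, ih, add_apply,
        Measure.toSignedMeasure_apply_measurable hB]
  exact h1 _

/-- Two empirical measures differ by at most twice the fraction of players in different states. -/
lemma tvLe_empProb (x y : Fin N → E) {b : Fin N → ℝ} (hb0 : ∀ i, 0 ≤ b i)
    (hb : ∀ i, y i ≠ x i → 1 ≤ b i) :
    TVLe (empProb y : Measure E) (empProb x) ((N : ℝ)⁻¹ * ∑ i, 2 * b i) := by
  intro f hf h1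
  rw [integral_empProb y hf h1, integral_empProb x hf h1, ← mul_sub, abs_mul, abs_inv,
    Nat.abs_cast, ← Finset.sum_sub_distrib]
  gcongr
  refine (Finset.abs_sum_le_sum_abs _ _).trans (Finset.sum_le_sum fun i _ => ?_)
  by_cases h : y i = x i
  · simp [h, hb0 i]
  · linarith [abs_sub (f (y i)) (f (x i)), h1 (y i), h1 (x i), hb i h]

lemma tvLe_empProb_update (x : Fin N → E) (i : Fin N) (y : E) :
    TVLe (empProb (Function.update x i y) : Measure E) (empProb x) (2 / N) := by
  refine (tvLe_empProb x (Function.update x i y) (b := fun j => if j = i then 1 else 0)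
    (fun j => by positivity) fun j hj => ?_).mono (le_of_eq ?_)
  · by_cases h : j = i
    · simp [h]
    · simp [h] at hj
  · simp only [mul_ite, mul_one, mul_zero, Finset.sum_ite_eq', Finset.mem_univ, if_true]
    ring

end Empirical

/-! ### Consistency of the discretization for the system of players -/

section Players

variable {E : Type*} [MeasurableSpace E] {N : ℕ}

/-- The law of a configuration in which player `i` jumps with distribution `n i`, at most one
player jumping. -/
lemma exists_oneJump (x : Fin N → E) (n : Fin N → Measure E) [∀ i, IsFiniteMeasure (n i)]
    (h : ∑ i, (n i).real univ ≤ 1) :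
    ∃ κ : Measure (Fin N → E), IsProbabilityMeasure κ ∧
      ∀ (g : (Fin N → E) → ℝ) (c : ℝ), Measurable g → (∀ y, |g y| ≤ c) →
        ∫ y, g y ∂κ = g x + ∑ i, ∫ z, (g (Function.update x i z) - g x) ∂(n i) := by
  have hm : ∀ i, Measurable fun z : E => Function.update x i z := fun i =>
    measurable_update'.comp (measurable_const.prodMk measurable_id)
  have h1 : ∑ i, n i univ ≤ 1 := by
    have e : ∑ i, n i univ = ENNReal.ofReal (∑ i, (n i).real univ) := by
      rw [ENNReal.ofReal_sum_of_nonneg fun i _ => measureReal_nonneg]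
      simp [measureReal_def]
    rw [e]
    exact ENNReal.ofReal_le_one.mpr h
  have hp : IsProbabilityMeasure ((∑ i, (n i).map (Function.update x i))
      + (1 - ∑ i, n i univ) • Measure.dirac x) := ⟨by
    simp only [Measure.coe_add, Measure.coe_finsetSum, Measure.coe_smul, Pi.add_apply,
      Finset.sum_apply, Pi.smul_apply, measure_univ, smul_eq_mul, mul_one,
      Measure.map_apply (hm _) MeasurableSet.univ, preimage_univ]
    exact add_tsub_cancel_of_le h1⟩
  refine ⟨_, hp, fun g c hg hc => ?_⟩
  have hi : ∀ i, Integrable g ((n i).map (Function.update x i)) := fun i =>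
    integrable_of_abs_le hg hc
  rw [integral_add_measure (integrable_finsetSum_measure.mpr fun i _ => hi i)
      ((integrable_of_abs_le hg hc).smul_measure
        (ne_top_of_le_ne_top ENNReal.one_ne_top tsub_le_self)),
    integral_finsetSum_measure fun i _ => hi i, integral_smul_measure,
    integral_dirac' _ _ hg.stronglyMeasurable, ENNReal.toReal_sub_of_le h1 ENNReal.one_ne_top,
    ENNReal.toReal_sum fun i _ => measure_ne_top _ _]
  have e : ∀ i, ∫ z, (g (Function.update x i z) - g x) ∂(n i)
      = ∫ y, g y ∂((n i).map (Function.update x i)) - (n i univ).toReal * g x := fun i => by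
    rw [integral_map (hm i).aemeasurable hg.aestronglyMeasurable,
      integral_sub (f := fun z => g (Function.update x i z))
        (integrable_of_abs_le (hg.comp (hm i)) fun z => hc _) (integrable_const _)]
    simp [measureReal_def]
  simp only [e, Finset.sum_sub_distrib, ← Finset.sum_mul, smul_eq_mul, ENNReal.toReal_one]
  ring

variable [PseudoMetricSpace E] {n n' : Kernel (E × ProbabilityMeasure E) E} [IsFiniteKernel n] [IsFiniteKernel n']
  {θ M : ℝ}

lemma RegularJump.tvLe_evolve {Y : Type*} [MeasurableSpace Y] (hn : RegularJump Y θ n)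
    (hθ : θ ≤ 1) [IsMarkovKernel (eulerKernel n)] (ρ : ProbabilityMeasure E) :
    TVLe (evolve (eulerKernel n) ρ : Measure E) ρ (2 * θ) := by
  intro f hf h1
  have hm : Measurable fun x => ∫ y, f y ∂(eulerKernel n (x, ρ)) :=
    (measurable_integral_step hf).comp (measurable_id.prodMk measurable_const)
  rw [integral_evolve ρ hf h1, ← integral_sub (integrable_of_abs_le hm
    fun x => abs_integral_le_of_prob h1) (integrable_of_abs_le hf h1)]
  refine abs_integral_le_of_prob fun x => ?_
  have := hn.abs_integral_eulerKernel_sub_le hθ (x, ρ) hf h1 zero_le_one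
  linarith

variable [MeasurableSingletonClass E] [NeZero N]

/-- One Euler step of the system of players, in which player `0` jumps with probabilities `n'` and
the others with probabilities `n`, compared with one step of the limiting pair. -/
theorem RegularFunctional.abs_players_sub_stepOp_le {V : E → ProbabilityMeasure E → ℝ}
    (hV : RegularFunctional (Fin N → E) M V) (hM : 0 ≤ M)
    (hn : RegularJump (Fin N → E) θ n) (hn' : RegularJump (Fin N → E) θ n')
    (hθ0 : 0 ≤ θ) (hθ : N * θ ≤ 1) [IsMarkovKernel (eulerKernel n)] (x : Fin N → E) :
    |V (x 0) (empProb x) + ∑ i, ∫ z, (V (Function.update x i z 0) (empProb (Function.update x i z))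
          - V (x 0) (empProb x)) ∂((if i = 0 then n' else n) (x i, empProb x))
        - stepOp (eulerKernel n') (eulerKernel n) V (x 0) (empProb x)|
      ≤ M * (8 * θ / N + 4 * θ ^ 2) := by
  have hN : (0 : ℝ) < N := Nat.cast_pos.mpr (NeZero.pos N)
  have hN1 : (1 : ℝ) ≤ N := Nat.one_le_cast.mpr (NeZero.pos N)
  have hθ1 : θ ≤ 1 := by nlinarith
  set ρ := empProb x with hρ
  set K := eulerKernel n
  have hmass : ∀ p, (n p).real univ ≤ 1 := fun p => (hn.mass p).trans hθ1
  have hmass' : ∀ p, (n' p).real univ ≤ 1 := fun p => (hn'.mass p).trans hθ1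
  have hupd : ∀ i, Measurable fun z : E => Function.update x i z := fun i =>
    measurable_update'.comp (measurable_const.prodMk measurable_id)
  have hsum : ∑ i, (n (x i, ρ)).real univ ≤ 1 := by
    refine (Finset.sum_le_sum fun i _ => hn.mass (x i, ρ)).trans ?_
    simpa using hθ
  -- Under the auxiliary law `κ` all players, including the tagged one, jump with `n`. The mean of
  -- the empirical measure is then exactly `evolve K ρ`.
  obtain ⟨κ, hκ, hκi⟩ := exists_oneJump x (fun i => n (x i, ρ)) hsum
  have hind : ∀ i, MeasurableSet {y : Fin N → E | y i ≠ x i} := fun i =>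
    ((measurable_pi_apply i : Measurable fun y : Fin N → E => y i)
      (measurableSet_singleton (x i))).compl
  set b : (Fin N → E) → Fin N → ℝ := fun y i => indicator {y : Fin N → E | y i ≠ x i} 1 y with hb
  have hb0 : ∀ y i, 0 ≤ b y i := fun y i => indicator_nonneg (fun _ _ => zero_le_one) y
  have hb1 : ∀ y i, b y i ≤ 1 := fun y i => indicator_le_self' (fun _ _ => zero_le_one) y
  -- The spread radius is twice the fraction of players that have moved.
  set r : (Fin N → E) → ℝ := fun y => (N : ℝ)⁻¹ * ∑ i, 2 * b y i with hr
  have hrm : Measurable r := (Finset.measurable_sum _ fun i _ =>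
    (measurable_one.indicator (hind i)).const_mul 2).const_mul _
  have hr0 : ∀ y, 0 ≤ r y := fun y => mul_nonneg (by positivity)
    (Finset.sum_nonneg fun i _ => mul_nonneg two_pos.le (hb0 y i))
  have hr2 : ∀ y, r y ≤ 2 := fun y => by
    rw [hr]
    have : ∑ i, 2 * b y i ≤ N * 2 := by
      refine (Finset.sum_le_sum fun i _ => mul_le_mul_of_nonneg_left (hb1 y i) two_pos.le).trans ?_
      simp
    rw [inv_mul_le_iff₀ hN]
    exact this
  have hrx : r x = 0 := by simp [hr, hb]
  have hru : ∀ i z, r (Function.update x i z) ≤ 2 / N := fun i z => by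
    have : ∑ j, 2 * b (Function.update x i z) j ≤ 2 := by
      rw [Finset.sum_eq_single i]
      · linarith [hb1 (Function.update x i z) i]
      · intro j _ hj
        simp [hb, hj]
      · simp
    rw [div_eq_inv_mul]
    exact mul_le_mul_of_nonneg_left this (by positivity)
  have hspread : Spread κ empProb ρ (evolve K ρ) r := by
    refine ⟨hκ, measurable_empProb, hrm, ⟨2, hr2⟩, fun y => tvLe_empProb x y (hb0 y) ?_, ?_⟩
    · intro i hi
      simp [hb, hi]
    · intro f hf h1
      have hm : Measurable fun x => ∫ y, f y ∂(K (x, ρ)) :=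
        (measurable_integral_step hf).comp (measurable_id.prodMk measurable_const)
      rw [integral_evolve ρ hf h1, integral_empProb x hm fun x => abs_integral_le_of_prob h1]
      simp only [integral_empProb _ hf h1]
      rw [hκi (fun y => (N : ℝ)⁻¹ * ∑ i, f (y i)) 1 ((Finset.measurable_sum _ fun i _ =>
        hf.comp (measurable_pi_apply i)).const_mul _) fun y => by
          rw [← integral_empProb y hf h1]; exact abs_integral_le_of_prob h1]
      have e : ∀ i z, (N : ℝ)⁻¹ * ∑ j, f (Function.update x i z j) - (N : ℝ)⁻¹ * ∑ j, f (x j)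
          = (N : ℝ)⁻¹ * (f z - f (x i)) := fun i z => by
        rw [← mul_sub, ← Finset.sum_sub_distrib, Finset.sum_eq_single i]
        · simp
        · intro j _ hj
          simp [hj]
        · simp
      simp only [e, integral_const_mul, ← Finset.mul_sum, ← mul_add, ← Finset.sum_add_distrib]
      congr 1
      exact Finset.sum_congr rfl fun i _ => integral_eulerKernel hmass _ hf h1
  -- The source of the rate `1/N`: there are `N` possible jumps, each of probability at most `θ` and
  -- squared size at most `(2 / N) ^ 2`.
  have hsq : ∫ y, r y ^ 2 ∂κ ≤ 4 * θ / N := by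
    rw [hκi (fun y => r y ^ 2) 4 (hrm.pow_const 2) fun y => by
      rw [abs_of_nonneg (sq_nonneg _)]; nlinarith [hr0 y, hr2 y]]
    simp only [hrx, ne_eq, OfNat.ofNat_ne_zero, not_false_eq_true, zero_pow, sub_zero, zero_add]
    have : ∀ i, ∫ z, r (Function.update x i z) ^ 2 ∂(n (x i, ρ)) ≤ (2 / N) ^ 2 * θ := fun i => by
      refine (le_abs_self _).trans ((abs_integral_le_of_abs_le (c := (2 / N) ^ 2) fun z => ?_).trans
        (mul_le_mul_of_nonneg_left (hn.mass _) (sq_nonneg _)))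
      rw [abs_of_nonneg (sq_nonneg _)]
      exact pow_le_pow_left₀ (hr0 _) (hru i z) 2
    refine (Finset.sum_le_sum fun i _ => this i).trans (le_of_eq ?_)
    simp only [Finset.sum_const, Finset.card_univ, Fintype.card_fin, nsmul_eq_mul]
    field_simp
    ring
  have hgap := (hV.gap (x 0) κ _ _ _ _ hspread).trans (mul_le_mul_of_nonneg_left hsq hM)
  have hVx : ∀ y : E, Measurable (V y) := fun y =>
    hV.meas.comp (measurable_const.prodMk measurable_id)
  have hVρ : ∀ σ, Measurable fun y => V y σ := fun σ =>
    hV.meas.comp (measurable_id.prodMk measurable_const)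
  rw [hκi (fun y => V (x 0) (empProb y)) M ((hVx _).comp measurable_empProb)
    fun y => hV.bdd _ _] at hgap
  set a : Fin N → ℝ := fun i => ∫ z, (V (x 0) (empProb (Function.update x i z)) - V (x 0) ρ)
    ∂(n (x i, ρ)) with ha
  set a' : Fin N → ℝ := fun i => ∫ z, (V (Function.update x i z 0) (empProb (Function.update x i z))
    - V (x 0) ρ) ∂((if i = 0 then n' else n) (x i, ρ)) with ha'
  -- A jump of another player leaves the tagged state unchanged, so the true dynamics and `κ` differ
  -- only in the term `i = 0`.
  have hsplit : ∑ i, a' i - ∑ i, a i = a' 0 - a 0 := by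
    rw [← Finset.sum_sub_distrib, Finset.sum_eq_single 0]
    · intro i _ hi
      simp [ha, ha', hi, Function.update_of_ne (Ne.symm hi)]
    · simp
  have ha0 : |a 0| ≤ M * (2 / N) * θ :=
    (abs_integral_le_of_abs_le fun z => hV.lip _ _ _ _ (tvLe_empProb_update x 0 z)).trans
      (mul_le_mul_of_nonneg_left (hn.mass _) (by positivity))
  set c := ∫ z, (V z ρ - V (x 0) ρ) ∂(n' (x 0, ρ)) with hc
  have hb2 : ∀ σ z, |V z σ - V (x 0) σ| ≤ 2 * M := fun σ z =>
    (abs_sub _ _).trans (by linarith [hV.bdd z σ, hV.bdd (x 0) σ])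
  -- The tagged jump itself displaces the empirical measure by at most `2 / N`; freezing the measure
  -- at `ρ` costs another `O(θ / N)`.
  have ha'0 : |a' 0 - c| ≤ M * (2 / N) * θ := by
    have e : a' 0 = ∫ z, (V z (empProb (Function.update x 0 z)) - V (x 0) ρ) ∂(n' (x 0, ρ)) := by
      simp [ha']
    have hm1 : Measurable fun z => V z (empProb (Function.update x 0 z)) :=
      hV.meas.comp (measurable_id.prodMk (measurable_empProb.comp (hupd 0)))
    have hm2 : ∀ z, |V z (empProb (Function.update x 0 z)) - V (x 0) ρ| ≤ 2 * M := fun z => by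
      have := abs_sub (V z (empProb (Function.update x 0 z))) (V (x 0) ρ)
      linarith [hV.bdd z (empProb (Function.update x 0 z)), hV.bdd (x 0) ρ]
    rw [e, hc, ← integral_sub (integrable_of_abs_le (hm1.sub_const _) hm2)
      (integrable_of_abs_le ((hVρ ρ).sub_const _) (hb2 ρ))]
    refine (abs_integral_le_of_abs_le (c := M * (2 / N)) fun z => ?_).trans
      (mul_le_mul_of_nonneg_left (hn'.mass _) (by positivity))
    rw [sub_sub_sub_cancel_right]
    exact hV.lip _ _ _ _ (tvLe_empProb_update x 0 z)
  have hev := hn.tvLe_evolve hθ1 ρ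
  have hstep : stepOp (eulerKernel n') K V (x 0) ρ = V (x 0) (evolve K ρ)
      + ∫ z, (V z (evolve K ρ) - V (x 0) (evolve K ρ)) ∂(n' (x 0, ρ)) :=
    integral_eulerKernel hmass' _ (hVρ _) fun z => hV.bdd z _
  -- `stepOp` evaluates the tagged jump at the evolved population. The population moves by at most
  -- `2 * θ` and the jump has probability at most `θ`, so the discrepancy is of second order.
  have hlast : |∫ z, (V z (evolve K ρ) - V (x 0) (evolve K ρ)) ∂(n' (x 0, ρ)) - c|
      ≤ 4 * M * θ * θ := by
    rw [hc, ← integral_sub (integrable_of_abs_le ((hVρ _).sub_const _) (hb2 _))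
      (integrable_of_abs_le ((hVρ _).sub_const _) (hb2 _))]
    refine (abs_integral_le_of_abs_le (c := 4 * M * θ) fun z => ?_).trans
      (mul_le_mul_of_nonneg_left (hn'.mass _) (by positivity))
    have t1 := hV.lip z _ _ _ hev
    have t2 := hV.lip (x 0) _ _ _ hev
    rw [abs_le] at *
    constructor <;> linarith
  rw [hstep]
  have e1 : M * (8 * θ / N + 4 * θ ^ 2)
      = M * (4 * θ / N) + (M * (2 / N) * θ + M * (2 / N) * θ) + 4 * M * θ * θ := by
    field_simp
    ring
  have hs : ∑ i, a' i = ∑ i, a i + (a' 0 - a 0) := by linarith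
  rw [e1, hs]
  rw [abs_le] at *
  constructor <;> linarith

end Players

/-! ### Short time expansions of propagators -/

section Propagator

variable {S : Type*} [MeasurableSpace S] {T Λ c : ℝ} {A : ℝ → (S → ℝ) → S → ℝ}
  {P : ℝ → ℝ → Kernel S S}

/-- The operators `A t`, `t ∈ [0, T]`, are bounded by `Λ` on the bounded measurable functions. -/
def IsBoundedGenerator (T Λ : ℝ) (A : ℝ → (S → ℝ) → S → ℝ) : Prop :=
  ∀ f : S → ℝ, ∀ c, Measurable f → (∀ x, |f x| ≤ c) → ∀ t ∈ Icc 0 T,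
    Measurable (A t f) ∧ ∀ x, |A t f x| ≤ Λ * c

lemma JumpGame.IsPropagator.abs_sub_le (hP : IsPropagator T A P) (hA : IsBoundedGenerator T Λ A)
    {f : S → ℝ} (hf : Measurable f) (hc : ∀ x, |f x| ≤ c) {s t : ℝ} (hs : 0 ≤ s) (hst : s ≤ t)
    (ht : t ≤ T) (x : S) : |∫ y, f y ∂P s t x - f x| ≤ Λ * c * (t - s) := by
  obtain ⟨-, h2⟩ := hP.forward f hf ⟨c, hc⟩ s t hs hst ht x
  rw [h2, add_sub_cancel_left]
  refine abs_intervalIntegral_le hst fun r hr => ?_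
  have := hP.markov s r hs hr.1 (hr.2.trans ht)
  exact abs_integral_le_of_prob (hA f c hf hc r ⟨hs.trans hr.1, hr.2.trans ht⟩).2

/-- In the forward equation the integrand is `P A_r f`. The first order bound applied to `A_r f`,
whose size is at most `Λ * c`, replaces it by `A_r f` at the initial point; `δ` is the price of a
further replacement by `B`. -/
lemma JumpGame.IsPropagator.abs_sub_sub_le (hP : IsPropagator T A P)
    (hA : IsBoundedGenerator T Λ A) {f : S → ℝ} (hf : Measurable f)
    (hc : ∀ x, |f x| ≤ c) (hc0 : 0 ≤ c) {s t δ : ℝ} (hs : 0 ≤ s) (hst : s ≤ t)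
    (ht : t ≤ T) (x : S) {B : ℝ → ℝ} (hB : IntervalIntegrable B volume s t)
    (hδ : ∀ r ∈ Icc s t, |A r f x - B r| ≤ δ) :
    |∫ y, f y ∂P s t x - f x - ∫ r in s..t, B r| ≤ (δ + Λ ^ 2 * c * (t - s)) * (t - s) := by
  obtain ⟨h1, h2⟩ := hP.forward f hf ⟨c, hc⟩ s t hs hst ht x
  rw [h2, add_sub_cancel_left]
  refine abs_intervalIntegral_sub_le hst h1 hB fun r hr => ?_
  obtain ⟨hm, hb⟩ := hA f c hf hc r ⟨hs.trans hr.1, hr.2.trans ht⟩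
  have t1 := hP.abs_sub_le hA hm hb hs hr.1 (hr.2.trans ht) x
  have t2 : Λ * (Λ * c) * (r - s) ≤ Λ ^ 2 * c * (t - s) := by
    have : Λ * (Λ * c) = Λ ^ 2 * c := by ring
    rw [this]
    gcongr
    exact hr.2
  have t3 := hδ r hr
  rw [abs_le] at *
  constructor <;> linarith

lemma integral_cocycle (hP : IsPropagator T A P) {r s t : ℝ} (hr : 0 ≤ r) (hrs : r ≤ s)
    (hst : s ≤ t) (ht : t ≤ T) {f : S → ℝ} (hf : Measurable f) (hc : ∀ x, |f x| ≤ c) (x : S) :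
    ∫ y, f y ∂P r t x = ∫ z, (∫ y, f y ∂P s t z) ∂P r s x := by
  have := hP.markov r t hr (hrs.trans hst) ht
  have e := hP.cocycle r s t hr hrs hst ht
  have hi : Integrable f ((P s t ∘ₖ P r s) x) := by
    rw [e]; exact integrable_of_abs_le hf hc
  rw [← e, Kernel.integral_comp hi]

/-- A backward step: an approximation of `P^{s,t} f` gives one of `P^{r,t} f`. -/
lemma abs_propagator_sub_le (hP : IsPropagator T A P) {r s t a b : ℝ} (hr : 0 ≤ r) (hrs : r ≤ s)
    (hst : s ≤ t) (ht : t ≤ T) {f g w : S → ℝ} {c' : ℝ} (hf : Measurable f) (hc : ∀ x, |f x| ≤ c)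
    (hg : Measurable g) (hc' : ∀ x, |g x| ≤ c') (h1 : ∀ x, |∫ y, f y ∂P s t x - g x| ≤ a)
    (x : S) (h2 : |∫ y, g y ∂P r s x - w x| ≤ b) : |∫ y, f y ∂P r t x - w x| ≤ a + b := by
  have := hP.markov r s hr hrs (hst.trans ht)
  have := hP.markov s t (hr.trans hrs) hst ht
  rw [integral_cocycle hP hr hrs hst ht hf hc]
  have hm : Measurable fun z => ∫ y, f y ∂P s t z :=
    measurable_integral_kernel (f := fun _ => f) (hf.comp measurable_snd) (P s t)
  have t1 : |∫ z, (∫ y, f y ∂P s t z - g z) ∂P r s x| ≤ a := abs_integral_le_of_prob h1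
  rw [integral_sub (integrable_of_abs_le hm fun z => abs_integral_le_of_prob hc)
    (integrable_of_abs_le hg hc')] at t1
  rw [abs_le] at *
  constructor <;> linarith

end Propagator

/-! ### Local errors of the discretization -/

section Local

variable {d m N : ℕ} {T Θ M : ℝ} {ν : JumpKernel d m} {γ γ' : ℝ → Euc d → Euc m}
  {R R' : Kernel (ℝ × (Euc d × ProbabilityMeasure (Euc d))) (Euc d)}

/-- `R` is the jump kernel under the strategy `γ`. -/
def IsRateOf (T : ℝ) (ν : JumpKernel d m) (γ : ℝ → Euc d → Euc m)
    (R : Kernel (ℝ × (Euc d × ProbabilityMeasure (Euc d))) (Euc d)) : Prop :=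
  ∀ t ∈ Icc 0 T, ∀ x ρ, R (t, x, ρ) = ν (t, x, ofProb ρ, γ t x)

lemma IsRateOf.jumpOp_eq (h : IsRateOf T ν γ R) {t : ℝ} (ht : t ∈ Icc 0 T)
    (ρ : ProbabilityMeasure (Euc d)) (f : Euc d → ℝ) (x : Euc d) :
    jumpOp ν γ t (ofProb ρ) f x = ∫ y, (f y - f x) ∂(R (t, x, ρ)) := by
  rw [jumpOp, h t ht]

lemma measurable_jump [IsFiniteKernel R] {f : Euc d → ℝ} (hf : Measurable f) (t : ℝ)
    (ρ : ProbabilityMeasure (Euc d)) :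
    Measurable fun x => ∫ y, (f y - f x) ∂(R (t, x, ρ)) :=
  measurable_integral_kernel (f := fun x y => f y - f x)
    ((hf.comp measurable_snd).sub (hf.comp measurable_fst))
    (R.comap (fun x => (t, x, ρ)) (measurable_const.prodMk (measurable_id.prodMk measurable_const)))

lemma RegularRate.abs_jump_le {Y : Type*} [MeasurableSpace Y] (hR : RegularRate Y T Θ R)
    {f : Euc d → ℝ} {c : ℝ} (hc : ∀ x, |f x| ≤ c) (hc0 : 0 ≤ c) (t : ℝ)
    (ρ : ProbabilityMeasure (Euc d)) (x : Euc d) :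
    |∫ y, (f y - f x) ∂(R (t, x, ρ))| ≤ 2 * Θ * c := by
  have := hR.finite
  refine (abs_integral_le_of_abs_le (c := 2 * c) fun y => ?_).trans
    ((mul_le_mul_of_nonneg_left (hR.mass _) (by positivity)).trans (le_of_eq (by ring)))
  exact (abs_sub _ _).trans (by linarith [hc y, hc x])

lemma RegularRate.abs_jump_sub_le {Y : Type*} [MeasurableSpace Y] (hR : RegularRate Y T Θ R)
    {f : Euc d → ℝ} {c : ℝ} (hf : Measurable f) (hc : ∀ x, |f x| ≤ c) (hc0 : 0 ≤ c) {t : ℝ}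
    (ht : t ∈ Icc 0 T) {ρ ρ' : ProbabilityMeasure (Euc d)} {r : ℝ}
    (hr : TVLe (ρ : Measure (Euc d)) ρ' r) (x : Euc d) :
    |∫ y, (f y - f x) ∂(R (t, x, ρ)) - ∫ y, (f y - f x) ∂(R (t, x, ρ'))| ≤ 2 * c * (Θ * r) :=
  (hR.lip_measure t ht x ρ ρ' r hr).abs_sub_le (hf.sub_const _)
    (fun y => (abs_sub _ _).trans (by linarith [hc y, hc x])) (by positivity)

variable [NeZero N]

lemma playersGen_eq (h : IsRateOf T ν γ R) (h' : IsRateOf T ν γ' R') {t : ℝ} (ht : t ∈ Icc 0 T)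
    (f : (Fin N → Euc d) → ℝ) (x : Fin N → Euc d) :
    playersGen ν γ γ' t f x = ∑ i, ∫ z, (f (Function.update x i z) - f x)
      ∂((if i = 0 then R' else R) (t, x i, empProb x)) := by
  refine Finset.sum_congr rfl fun i _ => ?_
  rw [← ofProb_empProb]
  split_ifs
  · rw [h'.jumpOp_eq ht, Function.update_eq_self]
  · rw [h.jumpOp_eq ht, Function.update_eq_self]

lemma isBoundedGenerator_playersGen {Y : Type*} [MeasurableSpace Y]
    (hR : RegularRate Y T Θ R) (hR' : RegularRate Y T Θ R') (h : IsRateOf T ν γ R)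
    (h' : IsRateOf T ν γ' R') :
    IsBoundedGenerator T (2 * N * Θ) (playersGen (N := N) ν γ γ') := by
  have := hR.finite
  have := hR'.finite
  intro f c hf hc t ht
  have hite : ∀ i : Fin N, IsFiniteKernel (if i = 0 then R' else R) := fun i => by
    split_ifs <;> infer_instance
  constructor
  · have e : playersGen ν γ γ' t f = fun x => ∑ i, ∫ z, (f (Function.update x i z) - f x)
        ∂((if i = 0 then R' else R) (t, x i, empProb x)) :=
      funext fun x => playersGen_eq h h' ht f x
    rw [e]
    refine Finset.measurable_sum _ fun i _ => ?_
    exact measurable_integral_kernel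
      (f := fun (x : Fin N → Euc d) z => f (Function.update x i z) - f x)
      ((hf.comp measurable_update').sub (hf.comp measurable_fst))
      ((if i = 0 then R' else R).comap (fun x : Fin N → Euc d => (t, x i, empProb x))
        (measurable_const.prodMk ((measurable_pi_apply i).prodMk measurable_empProb)))
  · intro x
    have hc0 : 0 ≤ c := (abs_nonneg _).trans (hc x)
    rw [playersGen_eq h h' ht]
    refine (Finset.abs_sum_le_sum_abs _ _).trans ?_
    refine (Finset.sum_le_sum (g := fun _ => 2 * c * Θ) fun i _ => ?_).trans (le_of_eq ?_)
    · refine (abs_integral_le_of_abs_le (c := 2 * c) fun z => ?_).trans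
        (mul_le_mul_of_nonneg_left ?_ (by positivity))
      · exact (abs_sub _ _).trans (by linarith [hc (Function.update x i z), hc x])
      · split_ifs
        · exact hR'.mass _
        · exact hR.mass _
    · simp only [Finset.sum_const, Finset.card_univ, Fintype.card_fin, nsmul_eq_mul]
      ring

lemma isBoundedGenerator_jumpOp {Y : Type*} [MeasurableSpace Y]
    (hR' : RegularRate Y T Θ R') (h' : IsRateOf T ν γ' R')
    (μ : ℝ → ProbabilityMeasure (Euc d)) :
    IsBoundedGenerator T (2 * Θ) fun t => jumpOp ν γ' t (ofProb (μ t)) := by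
  have := hR'.finite
  intro f c hf hc t ht
  have e : jumpOp ν γ' t (ofProb (μ t)) f = fun x => ∫ y, (f y - f x) ∂(R' (t, x, μ t)) :=
    funext fun x => h'.jumpOp_eq ht _ _ _
  beta_reduce
  rw [e]
  exact ⟨measurable_jump hf t _, fun x => hR'.abs_jump_le hc ((abs_nonneg _).trans (hc x)) t _ x⟩

/-- The propagator of the players and one step of the discretized dynamics. -/
theorem abs_players_sub_stepOp_le {P : ℝ → ℝ → Kernel (Fin N → Euc d) (Fin N → Euc d)}
    (hP : IsPropagator T (playersGen ν γ γ') P) (hΘ : 0 ≤ Θ)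
    (hR : RegularRate (Fin N → Euc d) T Θ R) (hR' : RegularRate (Fin N → Euc d) T Θ R')
    (h : IsRateOf T ν γ R) (h' : IsRateOf T ν γ' R') {s t : ℝ} (hs : 0 ≤ s) (hst : s ≤ t)
    (ht : t ≤ T) (hN : N * (Θ * (t - s)) ≤ 1) [IsMarkovKernel (eulerKernel (cumRate R s t))]
    {V : Euc d → ProbabilityMeasure (Euc d) → ℝ} (hV : RegularFunctional (Fin N → Euc d) M V)
    (hM : 0 ≤ M) (x : Fin N → Euc d) :
    |∫ y, V (y 0) (empProb y) ∂P s t x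
        - stepOp (eulerKernel (cumRate R' s t)) (eulerKernel (cumRate R s t)) V (x 0) (empProb x)|
      ≤ M * (8 * (Θ * (t - s)) / N + (4 + 4 * N ^ 2) * (Θ * (t - s)) ^ 2) := by
  have := hR.finite
  have := hR'.finite
  have hts := sub_nonneg.mpr hst
  set f : (Fin N → Euc d) → ℝ := fun y => V (y 0) (empProb y) with hf
  have hfm : Measurable f := hV.meas.comp ((measurable_pi_apply 0).prodMk measurable_empProb)
  have hfb : ∀ y, |f y| ≤ M := fun y => hV.bdd _ _
  have hite : ∀ i : Fin N, IsFiniteKernel (if i = 0 then R' else R) := fun i => by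
    split_ifs <;> infer_instance
  have hgm : ∀ i, Measurable fun z => f (Function.update x i z) - f x := fun i =>
    (hfm.comp (measurable_update'.comp (measurable_const.prodMk measurable_id))).sub_const _
  have hgb : ∀ i z, |f (Function.update x i z) - f x| ≤ 2 * M := fun i z =>
    (abs_sub _ _).trans (by linarith [hfb (Function.update x i z), hfb x])
  have hBi : ∀ i, IntervalIntegrable (fun r => ∫ z, (f (Function.update x i z) - f x)
      ∂((if i = 0 then R' else R) (r, x i, empProb x))) volume s t := fun i =>
    intervalIntegrable_integral_kernel (if i = 0 then R' else R) s t _ (hgm i) (hgb i)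
  have k₁ := hP.abs_sub_sub_le (isBoundedGenerator_playersGen hR hR' h h')
    hfm hfb hM hs hst ht x (δ := 0)
    (B := fun r => ∑ i, ∫ z, (f (Function.update x i z) - f x)
      ∂((if i = 0 then R' else R) (r, x i, empProb x)))
    (by simpa only [Finset.sum_fn] using IntervalIntegrable.sum Finset.univ fun i _ => hBi i) (fun r hr => by
      rw [playersGen_eq h h' ⟨hs.trans hr.1, hr.2.trans ht⟩, sub_self, abs_zero])
  rw [intervalIntegral.integral_finsetSum fun i _ => hBi i] at k₁
  have k₂ := hV.abs_players_sub_stepOp_le hM (hR.regularJump hs hst ht)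
    (hR'.regularJump hs hst ht) (by positivity) hN x
  have e : ∀ i, ∫ z, (f (Function.update x i z) - f x)
      ∂((if i = 0 then cumRate R' s t else cumRate R s t) (x i, empProb x))
      = ∫ r in s..t, ∫ z, (f (Function.update x i z) - f x)
        ∂((if i = 0 then R' else R) (r, x i, empProb x)) := fun i => by
    rw [← integral_cumRate (if i = 0 then R' else R) hst (x i, empProb x) (hgm i) (hgb i)]
    split_ifs <;> rfl
  simp only [hf] at e k₁
  simp only [e] at k₂
  -- The generator of all players has norm `2 * N * Θ`, and its square gives the `N ^ 2`. The growth
  -- in `N` is harmless because this term is quadratic in the step length.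
  have e1 : M * (8 * (Θ * (t - s)) / N + (4 + 4 * N ^ 2) * (Θ * (t - s)) ^ 2)
      = M * (8 * (Θ * (t - s)) / N + 4 * (Θ * (t - s)) ^ 2)
        + (0 + (2 * N * Θ) ^ 2 * M * (t - s)) * (t - s) := by ring
  rw [e1]
  simp only [hf]
  rw [abs_le] at *
  constructor <;> linarith

/-! ### Local error of the kinetic equation and of the limiting tagged player -/

section Kinetic

variable {Y : Type*} [MeasurableSpace Y] {μ : ℝ → ProbabilityMeasure (Euc d)}

/-- Although the kinetic equation is tested with `C_∞` only, these functions determine total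
variation, and the jump operator is bounded by `2 * Θ` on the unit ball. -/
lemma tvLe_kinetic (hμ : IsKineticSolution T ν γ μ) (hR : RegularRate Y T Θ R)
    (h : IsRateOf T ν γ R) {s t : ℝ} (hs : 0 ≤ s) (hst : s ≤ t) (ht : t ≤ T) :
    TVLe (μ t : Measure (Euc d)) (μ s) (2 * Θ * (t - s)) := by
  have := hR.finite
  refine tvLe_of_forall_zeroAtInfty fun g hg => ?_
  have hg1 : ∀ x, |g x| ≤ 1 := fun x => (abs_apply_le_norm g x).trans hg
  obtain ⟨i1, e1⟩ := hμ g t ⟨hs.trans hst, ht⟩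
  obtain ⟨i2, e2⟩ := hμ g s ⟨hs, hst.trans ht⟩
  rw [e1, e2, add_sub_add_left_eq_sub, intervalIntegral.integral_interval_sub_left i1 i2]
  refine abs_intervalIntegral_le hst fun r hr => ?_
  have hr' : r ∈ Icc 0 T := ⟨hs.trans hr.1, hr.2.trans ht⟩
  simp only [h.jumpOp_eq hr']
  refine abs_integral_le_of_prob fun x => ?_
  have := hR.abs_jump_le hg1 zero_le_one r (μ r) x
  linarith

/-- The Euler step freezes `μ r` at `μ s`, both as the integrating measure and inside the rates.
Since `μ r` stays within `2 * Θ * (t - s)` of `μ s`, each replacement costs `4 * Θ ^ 2 * (t - s)`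
per unit time. -/
lemma tvLe_kinetic_evolve (hμ : IsKineticSolution T ν γ μ) (hΘ : 0 ≤ Θ) (hR : RegularRate Y T Θ R)
    (h : IsRateOf T ν γ R) {s t : ℝ} (hs : 0 ≤ s) (hst : s ≤ t) (ht : t ≤ T)
    (hθ : Θ * (t - s) ≤ 1) [IsMarkovKernel (eulerKernel (cumRate R s t))] :
    TVLe (μ t : Measure (Euc d)) (evolve (eulerKernel (cumRate R s t)) (μ s))
      (8 * Θ ^ 2 * (t - s) * (t - s)) := by
  have := hR.finite
  refine tvLe_of_forall_zeroAtInfty fun g hg => ?_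
  have hgm : Measurable g := (map_continuous g).measurable
  have hg1 : ∀ x, |g x| ≤ 1 := fun x => (abs_apply_le_norm g x).trans hg
  have hmass : ∀ p, (cumRate R s t p).real univ ≤ 1 := fun p =>
    ((hR.regularJump hs hst ht).mass p).trans hθ
  have hjb : ∀ (r : ℝ) x (σ : ProbabilityMeasure (Euc d)),
      |∫ y, (g y - g x) ∂(R (r, x, σ))| ≤ 2 * Θ := fun r x σ => by
    have := hR.abs_jump_le hg1 zero_le_one r σ x
    linarith
  obtain ⟨i1, e1⟩ := hμ g t ⟨hs.trans hst, ht⟩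
  obtain ⟨i2, e2⟩ := hμ g s ⟨hs, hst.trans ht⟩
  have hi : IntervalIntegrable (fun r => ∫ x, jumpOp ν γ r (ofProb (μ r)) g x
      ∂(μ r : Measure (Euc d))) volume s t := i2.symm.trans i1
  have hd : ∫ x, g x ∂(μ t : Measure (Euc d)) = ∫ x, g x ∂(μ s : Measure (Euc d))
      + ∫ r in s..t, ∫ x, jumpOp ν γ r (ofProb (μ r)) g x ∂(μ r : Measure (Euc d)) := by
    rw [e1, e2, add_assoc, intervalIntegral.integral_add_adjacent_intervals i2 hi]
  have hgd : ∀ x y, |g y - g x| ≤ 2 := fun x y =>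
    (abs_sub _ _).trans (by linarith [hg1 y, hg1 x])
  have hm : Measurable fun q : ℝ × Euc d => ∫ y, (g y - g q.2) ∂(R (q.1, q.2, μ s)) :=
    measurable_integral_kernel (f := fun (q : ℝ × Euc d) y => g y - g q.2)
      ((hgm.comp measurable_snd).sub (hgm.comp (measurable_snd.comp measurable_fst)))
      (R.comap (fun q : ℝ × Euc d => (q.1, q.2, μ s))
        (measurable_fst.prodMk (measurable_snd.prodMk measurable_const)))
  have hmi : Measurable fun r => ∫ x, (∫ y, (g y - g x) ∂(R (r, x, μ s)))
      ∂(μ s : Measure (Euc d)) :=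
    measurable_integral_of_abs_le (f := fun r x => ∫ y, (g y - g x) ∂(R (r, x, μ s))) hm _
  have hi' : IntervalIntegrable (fun r => ∫ x, (∫ y, (g y - g x) ∂(R (r, x, μ s)))
      ∂(μ s : Measure (Euc d))) volume s t :=
    ⟨integrable_of_abs_le hmi fun r => abs_integral_le_of_prob fun x => hjb r x _,
      integrable_of_abs_le hmi fun r => abs_integral_le_of_prob fun x => hjb r x _⟩
  have hev : ∫ x, g x ∂(evolve (eulerKernel (cumRate R s t)) (μ s) : Measure (Euc d))
      = ∫ x, g x ∂(μ s : Measure (Euc d)) + ∫ r in s..t, ∫ x, (∫ y, (g y - g x) ∂(R (r, x, μ s)))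
        ∂(μ s : Measure (Euc d)) := by
    rw [integral_evolve _ hgm hg1]
    simp only [integral_eulerKernel hmass _ hgm hg1,
      integral_cumRate R hst _ (hgm.sub_const _) (hgd _)]
    have hm2 : Measurable fun x => ∫ r in s..t, ∫ y, (g y - g x) ∂(R (r, x, μ s)) := by
      simp only [intervalIntegral.integral_of_le hst]
      exact measurable_integral_of_abs_le
        (f := fun x r => ∫ y, (g y - g x) ∂(R (r, x, μ s))) (hm.comp measurable_swap) _
    rw [integral_add (integrable_of_abs_le hgm hg1) (integrable_of_abs_le hm2 fun x =>
      abs_intervalIntegral_le hst fun r _ => hjb r x _)]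
    congr 1
    simp only [intervalIntegral.integral_of_le hst]
    exact integral_integral_swap
      (integrable_of_abs_le (hm.comp measurable_swap) fun q => hjb q.2 q.1 _)
  rw [hd, hev, add_sub_add_left_eq_sub]
  refine abs_intervalIntegral_sub_le hst hi hi' fun r hr => ?_
  have hr' : r ∈ Icc 0 T := ⟨hs.trans hr.1, hr.2.trans ht⟩
  simp only [h.jumpOp_eq hr']
  have hcl := (tvLe_kinetic hμ hR h hs hr.1 hr'.2).mono
    (mul_le_mul_of_nonneg_left (sub_le_sub_right hr.2 s) (by positivity : 0 ≤ 2 * Θ))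
  have t1 := hcl.abs_sub_le (measurable_jump (R := R) hgm r (μ r)) (fun x => hjb r x _)
    (by positivity)
  have t2 : |∫ x, (∫ y, (g y - g x) ∂(R (r, x, μ r)) - ∫ y, (g y - g x) ∂(R (r, x, μ s)))
      ∂(μ s : Measure (Euc d))| ≤ 2 * 1 * (Θ * (2 * Θ * (t - s))) :=
    abs_integral_le_of_prob fun x => hR.abs_jump_sub_le hgm hg1 zero_le_one hr' hcl x
  rw [integral_sub (integrable_of_abs_le (measurable_jump hgm r _) fun x => hjb r x _)
    (integrable_of_abs_le (measurable_jump hgm r _) fun x => hjb r x _)] at t2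
  rw [abs_le] at *
  constructor <;> nlinarith

/-- The propagator of the limiting tagged player and one step of the discretized dynamics. -/
theorem abs_limit_sub_stepOp_le (hμ : IsKineticSolution T ν γ μ)
    {Q : ℝ → ℝ → Kernel (Euc d) (Euc d)}
    (hQ : IsPropagator T (fun t => jumpOp ν γ' t (ofProb (μ t))) Q) (hΘ : 0 ≤ Θ)
    (hR : RegularRate Y T Θ R) (hR' : RegularRate Y T Θ R')
    (h : IsRateOf T ν γ R) (h' : IsRateOf T ν γ' R') {s t : ℝ} (hs : 0 ≤ s) (hst : s ≤ t)
    (ht : t ≤ T) (hθ : Θ * (t - s) ≤ 1) [IsMarkovKernel (eulerKernel (cumRate R s t))]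
    {V : Euc d → ProbabilityMeasure (Euc d) → ℝ} (hV : RegularFunctional Y M V) (hM : 0 ≤ M)
    (x : Euc d) :
    |∫ y, V y (μ t) ∂Q s t x
        - stepOp (eulerKernel (cumRate R' s t)) (eulerKernel (cumRate R s t)) V x (μ s)|
      ≤ M * (16 * (Θ * (t - s)) ^ 2) := by
  have := hR.finite
  have := hR'.finite
  have := hQ.markov s t hs hst ht
  have hts := sub_nonneg.mpr hst
  set ρ := evolve (eulerKernel (cumRate R s t)) (μ s)
  have hVρ : ∀ σ, Measurable fun y => V y σ := fun σ =>
    hV.meas.comp (measurable_id.prodMk measurable_const)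
  have hmass : ∀ p, (cumRate R' s t p).real univ ≤ 1 := fun p =>
    ((hR'.regularJump hs hst ht).mass p).trans hθ
  have hcl := tvLe_kinetic_evolve hμ hΘ hR h hs hst ht hθ
  have t1 : |∫ y, (V y (μ t) - V y ρ) ∂Q s t x| ≤ M * (8 * Θ ^ 2 * (t - s) * (t - s)) :=
    abs_integral_le_of_prob fun y => hV.lip y _ _ _ hcl
  rw [integral_sub (integrable_of_abs_le (hVρ _) fun y => hV.bdd y _)
    (integrable_of_abs_le (hVρ _) fun y => hV.bdd y _)] at t1
  have hd : ∀ y, |V y ρ - V x ρ| ≤ 2 * M := fun y =>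
    (abs_sub _ _).trans (by linarith [hV.bdd y ρ, hV.bdd x ρ])
  -- The constant `16` is `8` from replacing `μ t` by the Euler law `ρ` in `t1`, `4` from freezing
  -- the population in the tagged rates (`δ`), and `4` from the squared generator norm `2 * Θ`.
  have t2 := hQ.abs_sub_sub_le (isBoundedGenerator_jumpOp hR' h' μ) (hVρ ρ)
    (fun y => hV.bdd y ρ) hM hs hst ht x (δ := 2 * M * (Θ * (2 * Θ * (t - s))))
    (B := fun r => ∫ y, (V y ρ - V x ρ) ∂(R' (r, x, μ s)))
    (intervalIntegrable_integral_kernel R' s t _ ((hVρ ρ).sub_const _) hd) (fun r hr => by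
      have hr' : r ∈ Icc 0 T := ⟨hs.trans hr.1, hr.2.trans ht⟩
      rw [h'.jumpOp_eq hr']
      refine hR'.abs_jump_sub_le (hVρ ρ) (fun y => hV.bdd y ρ) hM hr' ?_ x
      exact (tvLe_kinetic hμ hR h hs hr.1 hr'.2).mono
        (mul_le_mul_of_nonneg_left (sub_le_sub_right hr.2 s) (by positivity : 0 ≤ 2 * Θ)))
  have e : stepOp (eulerKernel (cumRate R' s t)) (eulerKernel (cumRate R s t)) V x (μ s)
      = V x ρ + ∫ r in s..t, ∫ y, (V y ρ - V x ρ) ∂(R' (r, x, μ s)) := by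
    rw [stepOp, integral_eulerKernel hmass _ (hVρ ρ) fun y => hV.bdd y ρ,
      integral_cumRate R' hst _ ((hVρ ρ).sub_const _) hd]
  rw [e]
  rw [abs_le] at *
  constructor <;> nlinarith

end Kinetic

end Local

/-! ### Comparison of the system of players with its limit -/

section Comparison

variable {d m N : ℕ} [NeZero N] {T Θ M l : ℝ} {ν : JumpKernel d m} {γ γ' : ℝ → Euc d → Euc m}
  {R R' : Kernel (ℝ × (Euc d × ProbabilityMeasure (Euc d))) (Euc d)}
  {μ : ℝ → ProbabilityMeasure (Euc d)} {P : ℝ → ℝ → Kernel (Fin N → Euc d) (Fin N → Euc d)}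
  {Q : ℝ → ℝ → Kernel (Euc d) (Euc d)} {V : Euc d → ProbabilityMeasure (Euc d) → ℝ}

/-- After `j` backward steps of length `h`, a common functional approximates both propagators. -/
theorem exists_common_approximation (hΘ : 0 ≤ Θ) (hR : RegularRate (Fin N → Euc d) T Θ R)
    (hR' : RegularRate (Fin N → Euc d) T Θ R') (hRγ : IsRateOf T ν γ R) (hRγ' : IsRateOf T ν γ' R')
    (hP : IsPropagator T (playersGen ν γ γ') P) (hμ : IsKineticSolution T ν γ μ)
    (hQ : IsPropagator T (fun t => jumpOp ν γ' t (ofProb (μ t))) Q)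
    (hV : RegularFunctional (Fin N → Euc d) M V) (hM : 0 ≤ M) (hl : 0 ≤ l)
    (hVl : ∀ x x' ρ, |V x ρ - V x' ρ| ≤ l * dist x x') {t h : ℝ} {n : ℕ} (ht : t ≤ T)
    (hh : 0 ≤ h) (hn : n * h = t) (hh1 : N * (Θ * h) ≤ 1) (hh2 : 2 * (Θ * h) ≤ 1) {j : ℕ}
    (hj : j ≤ n) :
    ∃ W : Euc d → ProbabilityMeasure (Euc d) → ℝ,
      RegularFunctional (Fin N → Euc d) ((1 + 22 * (Θ * h)) ^ j * M) W ∧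
      (∀ x x' ρ, |W x ρ - W x' ρ|
        ≤ (1 + 22 * (Θ * h)) ^ j * (l + j * (2 * (Θ * h)) * M) * dist x x') ∧
      (∀ x, |∫ y, V (y 0) (empProb y) ∂P (t - j * h) t x - W (x 0) (empProb x)|
        ≤ j * ((1 + 22 * (Θ * h)) ^ n * M
          * (8 * (Θ * h) / N + (4 + 4 * N ^ 2) * (Θ * h) ^ 2))) ∧
      (∀ x, |∫ y, V y (μ t) ∂Q (t - j * h) t x - W x (μ (t - j * h))|
        ≤ j * ((1 + 22 * (Θ * h)) ^ n * M * (16 * (Θ * h) ^ 2))) := by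
  have := hR.finite
  have := hR'.finite
  have hθ : 0 ≤ Θ * h := mul_nonneg hΘ hh
  -- `RegularFunctional.step` with `φ = 2 * (Θ * h)` multiplies the constant by `1 + 11 * φ`.
  set q := 1 + 22 * (Θ * h) with hq
  have hq1 : 1 ≤ q := by linarith
  have ht0 : 0 ≤ t := by rw [← hn]; positivity
  have hfm : Measurable fun y : Fin N → Euc d => V (y 0) (empProb y) :=
    hV.meas.comp ((measurable_pi_apply 0).prodMk measurable_empProb)
  have hVm : ∀ σ, Measurable fun y => V y σ := fun σ =>
    hV.meas.comp (measurable_id.prodMk measurable_const)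
  induction j with
  | zero =>
    refine ⟨V, by simpa using hV, by simpa using hVl, fun x => ?_, fun x => ?_⟩
    · simp [hP.refl t ht0 ht, Kernel.id_apply, integral_dirac' _ _ hfm.stronglyMeasurable]
    · simp [hQ.refl t ht0 ht, Kernel.id_apply, integral_dirac' _ _ (hVm _).stronglyMeasurable]
  | succ j ih =>
    obtain ⟨W, hW, hWl, hWP, hWQ⟩ := ih (by omega)
    set s := t - j * h with hs
    set s' := t - ((j + 1 : ℕ) : ℝ) * h with hs'
    have hss : s - s' = h := by rw [hs, hs']; push_cast; ring
    have hs'0 : 0 ≤ s' := by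
      rw [hs', ← hn, ← sub_mul]
      exact mul_nonneg (sub_nonneg.mpr (Nat.cast_le.mpr hj)) hh
    have hs's : s' ≤ s := by linarith
    have hst : s ≤ t := by rw [hs]; linarith [mul_nonneg (Nat.cast_nonneg (α := ℝ) j) hh]
    have hsT : s ≤ T := hst.trans ht
    have hJ := hR.regularJump hs'0 hs's hsT
    have hJ' := hR'.regularJump hs'0 hs's hsT
    rw [hss] at hJ hJ'
    have hθ1 : Θ * h ≤ 1 := by linarith
    have hK := isMarkovKernel_eulerKernel fun p => (hJ.mass p).trans hθ1
    have hK' := isMarkovKernel_eulerKernel fun p => (hJ'.mass p).trans hθ1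
    have hMj : 0 ≤ q ^ j * M := by positivity
    have hMj' : q ^ j * M ≤ q ^ n * M :=
      mul_le_mul_of_nonneg_right (pow_le_pow_right₀ hq1 (by omega)) hM
    have hstep' := hJ'.regularStep hθ1 hθ
    have hreg := hW.step (hJ.regularStep hθ1 hθ) hstep' hh2 hMj
    have e : (1 + 11 * (2 * (Θ * h))) * (q ^ j * M) = q ^ (j + 1) * M := by
      rw [pow_succ, hq]; ring
    rw [e] at hreg
    refine ⟨_, hreg, fun x x' ρ => ?_, fun x => ?_, fun x => ?_⟩
    · refine (hW.step_space hstep' hWl x x' ρ).trans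
        (mul_le_mul_of_nonneg_right ?_ dist_nonneg)
      have e2 : q ^ j * (l + j * (2 * (Θ * h)) * M) + q ^ j * M * (2 * (Θ * h))
          = q ^ j * (l + ((j + 1 : ℕ) : ℝ) * (2 * (Θ * h)) * M) := by push_cast; ring
      rw [e2]
      exact mul_le_mul_of_nonneg_right (pow_le_pow_right₀ hq1 (Nat.le_succ j)) (by positivity)
    · have loc := abs_players_sub_stepOp_le hP hΘ hR hR' hRγ hRγ' hs'0 hs's hsT
        (by rw [hss]; exact hh1) hW hMj x
      rw [hss] at loc
      refine (abs_propagator_sub_le hP hs'0 hs's hst ht hfm (fun y => hV.bdd _ _)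
        (hW.meas.comp ((measurable_pi_apply 0).prodMk measurable_empProb))
        (fun y => hW.bdd _ _) hWP (w := fun x => stepOp _ _ W (x 0) (empProb x)) x loc).trans ?_
      have := mul_le_mul_of_nonneg_right hMj'
        (by positivity : 0 ≤ 8 * (Θ * h) / N + (4 + 4 * (N : ℝ) ^ 2) * (Θ * h) ^ 2)
      push_cast
      linarith
    · have loc := abs_limit_sub_stepOp_le hμ hQ hΘ hR hR' hRγ hRγ' hs'0 hs's hsT
        (by rw [hss]; exact hθ1) hW hMj x
      rw [hss] at loc
      refine (abs_propagator_sub_le hQ hs'0 hs's hst ht (hVm _) (fun y => hV.bdd _ _)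
        (hW.meas.comp (measurable_id.prodMk measurable_const))
        (fun y => hW.bdd _ _) hWQ (w := fun x => stepOp _ _ W x (μ s')) x loc).trans ?_
      have := mul_le_mul_of_nonneg_right hMj' (by positivity : 0 ≤ 16 * (Θ * h) ^ 2)
      push_cast
      linarith

/-- The propagator of the pair (tagged player, empirical measure) differs from its limit by
`O(1/N)`, on functionals that are regular in the measure and Lipschitz continuous in the state. -/
theorem abs_players_sub_limit_le (hΘ : 0 ≤ Θ) (hR : RegularRate (Fin N → Euc d) T Θ R)
    (hR' : RegularRate (Fin N → Euc d) T Θ R') (hRγ : IsRateOf T ν γ R) (hRγ' : IsRateOf T ν γ' R')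
    (hP : IsPropagator T (playersGen ν γ γ') P) (hμ : IsKineticSolution T ν γ μ)
    (hQ : IsPropagator T (fun t => jumpOp ν γ' t (ofProb (μ t))) Q)
    (hV : RegularFunctional (Fin N → Euc d) M V) (hM : 0 ≤ M) (hl : 0 ≤ l)
    (hVl : ∀ x x' ρ, |V x ρ - V x' ρ| ≤ l * dist x x') {t : ℝ} (ht : t ∈ Icc 0 T) {k₁ k₂ : ℝ}
    {x : Fin N → Euc d} {x₁ : Euc d}
    (hk₁ : TVLe (empProb x : Measure (Euc d)) (μ 0) (k₁ / N)) (hk₂ : dist (x 0) x₁ ≤ k₂ / N) :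
    |∫ y, V (y 0) (empProb y) ∂P 0 t x - ∫ y, V y (μ t) ∂Q 0 t x₁|
      ≤ Real.exp (22 * (Θ * T)) / N
        * ((8 * (Θ * T) + k₁ + 2 * (Θ * T) * k₂) * M + l * k₂) := by
  have hN : (0 : ℝ) < N := Nat.cast_pos.mpr (NeZero.pos N)
  have hk₁0 : 0 ≤ k₁ := by
    have := hk₁.nonneg
    rwa [le_div_iff₀ hN, zero_mul] at this
  have hk₂0 : 0 ≤ k₂ := by
    have := dist_nonneg.trans hk₂
    rwa [le_div_iff₀ hN, zero_mul] at this
  have hT : 0 ≤ T := ht.1.trans ht.2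
  have hθt : Θ * t ≤ Θ * T := mul_le_mul_of_nonneg_left ht.2 hΘ
  have hθt0 : 0 ≤ Θ * t := mul_nonneg hΘ ht.1
  have hθT0 : 0 ≤ Θ * T := mul_nonneg hΘ hT
  set e := Real.exp (22 * (Θ * T)) with he
  have he0 : 0 < e := Real.exp_pos _
  -- The coefficient of the step length in the accumulated error, with `20 = 4 + 16` from the two
  -- local estimates. It grows with `N` but not with the number of steps.
  set D := e * M * (Θ * T) * (20 + 4 * (N : ℝ) ^ 2) * Θ with hD
  have main : ∀ᶠ n : ℕ in atTop,
      |∫ y, V (y 0) (empProb y) ∂P 0 t x - ∫ y, V y (μ t) ∂Q 0 t x₁|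
        ≤ e / N * ((8 * (Θ * T) + k₁ + 2 * (Θ * T) * k₂) * M + l * k₂) + D * (t / n) := by
    have lim : Tendsto (fun n : ℕ => t / (n : ℝ)) atTop (𝓝 0) := tendsto_const_div_atTop_nhds_zero_nat t
    -- This bounds the total jump probability of the `N` players by one, so that the one-jump law
    -- exists; `ev2` is the condition `φ ≤ 1` of `RegularFunctional.step`.
    have ev1 : ∀ᶠ n : ℕ in atTop, N * (Θ * (t / n)) < 1 := by
      have : Tendsto (fun n : ℕ => N * (Θ * (t / (n : ℝ)))) atTop (𝓝 (N * (Θ * 0))) :=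
        (lim.const_mul Θ).const_mul (N : ℝ)
      exact this.eventually_lt_const (by simp)
    have ev2 : ∀ᶠ n : ℕ in atTop, 2 * (Θ * (t / n)) < 1 := by
      have : Tendsto (fun n : ℕ => 2 * (Θ * (t / (n : ℝ)))) atTop (𝓝 (2 * (Θ * 0))) :=
        (lim.const_mul Θ).const_mul 2
      exact this.eventually_lt_const (by simp)
    filter_upwards [ev1, ev2, eventually_gt_atTop 0] with n h1 h2 hn0
    have hnp : (0 : ℝ) < n := Nat.cast_pos.mpr hn0
    have hh : 0 ≤ t / n := div_nonneg ht.1 hnp.le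
    have hnh : (n : ℝ) * (t / n) = t := by field_simp
    set h := t / (n : ℝ)
    -- After all `n` steps both propagators are approximated at time zero by the same `W`. Its
    -- Lipschitz bounds in measure and in state absorb the distance between the initial data,
    -- through `k₁` and `k₂`.
    obtain ⟨W, hW, hWl, hWP, hWQ⟩ := exists_common_approximation hΘ hR hR' hRγ hRγ' hP hμ hQ hV hM
      hl hVl ht.2 hh hnh h1.le h2.le (le_refl n)
    rw [hnh, sub_self] at hWP hWQ
    have hq : (1 + 22 * (Θ * h)) ^ n ≤ e := by
      have hb : 1 + 22 * (Θ * h) ≤ Real.exp (22 * (Θ * h)) := by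
        linarith [Real.add_one_le_exp (22 * (Θ * h))]
      refine (pow_le_pow_left₀ (by positivity) hb n).trans ?_
      rw [← Real.exp_nat_mul, he]
      refine Real.exp_le_exp.mpr ?_
      have : (n : ℝ) * (22 * (Θ * h)) = 22 * (Θ * (n * h)) := by ring
      rw [this, hnh]
      linarith
    set q := (1 + 22 * (Θ * h)) ^ n with hqdef
    have hq0 : 0 ≤ q := by positivity
    have hx := hWP x
    have hx₁ := hWQ x₁
    have hm := hW.lip (x 0) _ _ _ hk₁
    have hs := hWl (x 0) x₁ (μ 0)
    have b1 : n * (q * M * (8 * (Θ * h) / N + (4 + 4 * (N : ℝ) ^ 2) * (Θ * h) ^ 2))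
        + n * (q * M * (16 * (Θ * h) ^ 2))
        = q * (M * (8 * (Θ * (n * h)) / N + (20 + 4 * (N : ℝ) ^ 2) * (Θ * (n * h)) * (Θ * h))) := by
      ring
    rw [hnh] at b1
    have b2 : q * (M * (8 * (Θ * t) / N + (20 + 4 * (N : ℝ) ^ 2) * (Θ * t) * (Θ * h)))
        ≤ e * (M * (8 * (Θ * T) / N + (20 + 4 * (N : ℝ) ^ 2) * (Θ * T) * (Θ * h))) := by
      gcongr
    have b3 : q * M * (k₁ / N) ≤ e * M * (k₁ / N) := by gcongr
    have b4 : q * (l + n * (2 * (Θ * h)) * M) * dist (x 0) x₁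
        ≤ e * (l + 2 * (Θ * T) * M) * (k₂ / N) := by
      have e2 : (n : ℝ) * (2 * (Θ * h)) = 2 * (Θ * (n * h)) := by ring
      rw [e2, hnh]
      gcongr
    have e3 : e / N * ((8 * (Θ * T) + k₁ + 2 * (Θ * T) * k₂) * M + l * k₂) + D * h
        = e * (M * (8 * (Θ * T) / N + (20 + 4 * (N : ℝ) ^ 2) * (Θ * T) * (Θ * h)))
          + e * M * (k₁ / N) + e * (l + 2 * (Θ * T) * M) * (k₂ / N) := by
      rw [hD]
      field_simp
      ring
    rw [e3]
    rw [abs_le] at *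
    constructor <;> linarith
  have lim : Tendsto (fun n : ℕ => e / N * ((8 * (Θ * T) + k₁ + 2 * (Θ * T) * k₂) * M + l * k₂)
      + D * (t / (n : ℝ))) atTop
      (𝓝 (e / N * ((8 * (Θ * T) + k₁ + 2 * (Θ * T) * k₂) * M + l * k₂) + D * 0)) :=
    ((tendsto_const_div_atTop_nhds_zero_nat t).const_mul D).const_add _
  rw [mul_zero, add_zero] at lim
  -- The step length tends to zero with `N` fixed, which removes the term containing `D`.
  exact ge_of_tendsto lim main

end Comparison

/-! ### Right-continuous Markov processes -/

section MarkovProcess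

variable {S Ω : Type*} [MeasurableSpace S] [TopologicalSpace S] [mΩ : MeasurableSpace Ω]
  {T : ℝ} {P : ℝ → ℝ → Kernel S S} {Pr : Measure Ω} {X : ℝ → Ω → S}

lemma JumpGame.IsMarkovProcess.measurable (hX : IsMarkovProcess T P Pr X) {t : ℝ}
    (ht : t ∈ Icc 0 T) : Measurable (X t) := by
  obtain ⟨ℱ, h, -⟩ := hX.markov
  exact (h t ht).mono (ℱ.le t) le_rfl

/-- The Markov property between `0` and `t`, integrated: an expectation at a fixed time involves
only the transition function and the initial state. -/
lemma JumpGame.IsMarkovProcess.integral_eq [IsProbabilityMeasure Pr] (hX : IsMarkovProcess T P Pr X)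
    {t : ℝ} (ht : t ∈ Icc 0 T) {f : S → ℝ} {c : ℝ} (hf : Measurable f) (hc : ∀ x, |f x| ≤ c) :
    ∫ ω, f (X t ω) ∂Pr = ∫ ω, (∫ y, f y ∂P 0 t (X 0 ω)) ∂Pr := by
  obtain ⟨ℱ, -, h⟩ := hX.markov
  rw [← integral_condExp (ℱ.le 0)]
  exact integral_congr_ae (h 0 t le_rfl ht.1 ht.2 f hf ⟨c, hc⟩)

/-- A process with right-continuous paths on `[0, T)` is jointly measurable there. -/
lemma JumpGame.IsMarkovProcess.measurable_uncurry [TopologicalSpace.PseudoMetrizableSpace S]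
    [BorelSpace S] (hX : IsMarkovProcess T P Pr X) (hT : 0 < T) :
    Measurable fun p : ℝ × Ω => X (if p.1 ∈ Ico 0 T then p.1 else 0) p.2 := by
  have h0 : (0 : ℝ) ∈ Icc 0 T := ⟨le_rfl, hT.le⟩
  -- The grid point immediately to the right of `t` on the grid of mesh `1 / (n + 1)`, clamped to
  -- `[0, T]`. Only countably many times occur, so the approximation is jointly measurable, and it
  -- converges because `t` is approached from the right.
  set τ : ℕ → ℤ → ℝ := fun n k => max 0 (min T (((k : ℝ) + 1) / (n + 1))) with hτ
  have hτm : ∀ n k, τ n k ∈ Icc 0 T := fun n k =>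
    ⟨le_max_left _ _, max_le hT.le (min_le_left _ _)⟩
  have hI : MeasurableSet {p : ℝ × Ω | p.1 ∈ Ico 0 T} := measurable_fst measurableSet_Ico
  refine measurable_of_tendsto_metrizable (f := fun (n : ℕ) (p : ℝ × Ω) =>
    X (if p.1 ∈ Ico 0 T then τ n ⌊((n : ℝ) + 1) * p.1⌋ else 0) p.2) (fun n => ?_) ?_
  · have hm : Measurable fun q : ℤ × Ω => X (τ n q.1) q.2 :=
      measurable_from_prod_countable_right fun k => hX.measurable (hτm n k)
    have e : (fun p : ℝ × Ω => X (if p.1 ∈ Ico 0 T then τ n ⌊((n : ℝ) + 1) * p.1⌋ else 0) p.2)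
        = fun p => if p.1 ∈ Ico 0 T then X (τ n ⌊((n : ℝ) + 1) * p.1⌋) p.2 else X 0 p.2 := by
      funext p
      split_ifs <;> rfl
    rw [e]
    exact Measurable.ite hI (hm.comp ((Int.measurable_floor.comp
      (measurable_fst.const_mul _)).prodMk measurable_snd)) ((hX.measurable h0).comp measurable_snd)
  · rw [tendsto_pi_nhds]
    rintro ⟨t, ω⟩
    by_cases ht : t ∈ Ico 0 T
    · simp only [ht, if_true]
      have hlow : ∀ n : ℕ, t ≤ τ n ⌊((n : ℝ) + 1) * t⌋ := fun n => by
        refine le_max_of_le_right (le_min ht.2.le ?_)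
        rw [le_div_iff₀ (by positivity)]
        linarith [Int.lt_floor_add_one (((n : ℝ) + 1) * t)]
      have hup : ∀ n : ℕ, τ n ⌊((n : ℝ) + 1) * t⌋ ≤ t + 1 / ((n : ℝ) + 1) := fun n => by
        have hn : (0 : ℝ) < n + 1 := by positivity
        refine max_le (by have := ht.1; positivity) ((min_le_right _ _).trans ?_)
        have e : (t + 1 / ((n : ℝ) + 1)) * ((n : ℝ) + 1) = ((n : ℝ) + 1) * t + 1 := by field_simp
        rw [div_le_iff₀ hn, e]
        linarith [Int.floor_le (((n : ℝ) + 1) * t)]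
      have hlim : Tendsto (fun n : ℕ => τ n ⌊((n : ℝ) + 1) * t⌋) atTop (𝓝[≥] t) := by
        refine tendsto_nhdsWithin_iff.mpr ⟨?_, Eventually.of_forall hlow⟩
        refine tendsto_of_tendsto_of_tendsto_of_le_of_le tendsto_const_nhds ?_ hlow hup
        simpa using (tendsto_one_div_add_atTop_nhds_zero_nat (𝕜 := ℝ)).const_add t
      exact (hX.right_cont ω t ht).tendsto.comp hlim
    · simp only [ht, if_false]
      exact tendsto_const_nhds

/-- Time integrals and expectations of bounded functions of a Markov process commute. -/
lemma JumpGame.IsMarkovProcess.integral_intervalIntegral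
    [TopologicalSpace.PseudoMetrizableSpace S] [BorelSpace S] [IsProbabilityMeasure Pr]
    (hX : IsMarkovProcess T P Pr X) (hT : 0 < T) {G : ℝ → S → ℝ} {G' : ℝ × S → ℝ} {c : ℝ}
    (hG : Measurable G') (hGG' : ∀ t ∈ Icc 0 T, ∀ x, G' (t, x) = G t x)
    (hc : ∀ t ∈ Icc 0 T, ∀ x, |G t x| ≤ c) {t : ℝ} (ht : t ∈ Icc 0 T) :
    IntervalIntegrable (fun s => ∫ ω, G s (X s ω) ∂Pr) volume t T ∧
    ∫ ω, (∫ s in t..T, G s (X s ω)) ∂Pr = ∫ s in t..T, ∫ ω, G s (X s ω) ∂Pr := by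
  have hc0 : 0 ≤ c ∨ IsEmpty S := by
    by_cases h : Nonempty S
    · exact Or.inl ((abs_nonneg _).trans (hc t ht h.some))
    · exact Or.inr (not_nonempty_iff.mp h)
  have hc0 : 0 ≤ c := hc0.elim id fun _ => by
    have := nonempty_of_isProbabilityMeasure Pr
    exact (IsEmpty.false (X 0 this.some)).elim
  set H : ℝ × Ω → ℝ := fun p => if p.1 ∈ Ico 0 T then
    G' (p.1, X (if p.1 ∈ Ico 0 T then p.1 else 0) p.2) else 0 with hH
  have hHm : Measurable H := Measurable.ite (measurable_fst measurableSet_Ico)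
    (hG.comp (measurable_fst.prodMk (hX.measurable_uncurry hT))) measurable_const
  have hHc : ∀ p, |H p| ≤ c := fun p => by
    by_cases h : p.1 ∈ Ico 0 T
    · simp only [hH, h, if_true]
      rw [hGG' _ ⟨h.1, h.2.le⟩]
      exact hc _ ⟨h.1, h.2.le⟩ _
    · simp only [hH, h, if_false, abs_zero, hc0]
  have hHG : ∀ s ∈ Ico t T, ∀ ω, H (s, ω) = G s (X s ω) := fun s hs ω => by
    have h : s ∈ Ico 0 T := ⟨ht.1.trans hs.1, hs.2⟩
    simp only [hH, h, if_true]
    exact hGG' _ ⟨h.1, h.2.le⟩ _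
  -- Right-continuity is available on `[0, T)` only; the endpoint `T` is a null set.
  have hae : ∀ᵐ s ∂volume.restrict (Ioc t T), s ∈ Ico t T := by
    have h1 : ∀ᵐ s ∂volume.restrict (Ioc t T), s ≠ T :=
      ae_restrict_of_ae (Measure.ae_ne volume T)
    filter_upwards [h1, ae_restrict_mem measurableSet_Ioc] with s hs hs'
    exact ⟨hs'.1.le, lt_of_le_of_ne hs'.2 hs⟩
  simp only [intervalIntegral.integral_of_le ht.2,
    intervalIntegrable_iff_integrableOn_Ioc_of_le ht.2]
  have hswap : ∫ ω, (∫ s in Ioc t T, H (s, ω)) ∂Pr = ∫ s in Ioc t T, ∫ ω, H (s, ω) ∂Pr :=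
    integral_integral_swap (integrable_of_abs_le (hHm.comp measurable_swap) fun p => hHc p.swap)
  have e1 : ∀ ω, ∫ s in Ioc t T, H (s, ω) = ∫ s in Ioc t T, G s (X s ω) := fun ω =>
    integral_congr_ae (hae.mono fun s hs => hHG s hs ω)
  have e2 : (fun s => ∫ ω, H (s, ω) ∂Pr) =ᵐ[volume.restrict (Ioc t T)]
      fun s => ∫ ω, G s (X s ω) ∂Pr := hae.mono fun s hs => by
    simp only [hHG s hs]
  refine ⟨Integrable.congr ?_ e2, ?_⟩
  · exact integrable_of_abs_le (measurable_integral_of_abs_le (f := fun s ω => H (s, ω)) hHm Pr)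
      fun s => abs_integral_le_of_prob fun ω => hHc _
  · simp only [e1] at hswap
    rw [hswap]
    exact integral_congr_ae e2

end MarkovProcess

/-! ### Measurability in time of kinetic solutions -/

section Kinetic

variable {d m : ℕ} {T Θ : ℝ} {ν : JumpKernel d m} {γ : ℝ → Euc d → Euc m}
  {R : Kernel (ℝ × (Euc d × ProbabilityMeasure (Euc d))) (Euc d)}
  {Y : Type*} [MeasurableSpace Y] {μ : ℝ → ProbabilityMeasure (Euc d)}

/-- Solutions of the kinetic equation are measurable in time. -/
lemma measurable_kinetic (hμ : IsKineticSolution T ν γ μ) (hΘ : 0 ≤ Θ) (hR : RegularRate Y T Θ R)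
    (h : IsRateOf T ν γ R) (hT : 0 ≤ T) : Measurable fun t => μ (projIcc 0 T hT t) := by
  refine Measurable.subtype_mk (Measure.measurable_of_measurable_coe _ fun B hB => ?_)
  set φ : Icc 0 T → ℝ := fun t => (μ t : Measure (Euc d)).real B with hφ
  -- The total variation bound, tested with the indicator of `B`, makes `t ↦ μ t B` Lipschitz, hence
  -- measurable.
  have key : ∀ a b : Icc 0 T, a ≤ b → |φ b - φ a| ≤ 2 * Θ * (b - a) := fun a b hab => by
    have := tvLe_kinetic hμ hR h a.2.1 hab b.2.2 (B.indicator 1) (measurable_one.indicator hB)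
      fun x => by
        by_cases hx : x ∈ B <;> simp [hx]
    rw [integral_indicator_one hB, integral_indicator_one hB] at this
    exact this
  have hlip : LipschitzWith (2 * Θ).toNNReal φ := LipschitzWith.of_dist_le_mul fun a b => by
    rw [Real.coe_toNNReal _ (by positivity), Real.dist_eq, Subtype.dist_eq, Real.dist_eq]
    rcases le_total a b with hab | hab
    · rw [abs_sub_comm, abs_sub_comm (a : ℝ), abs_of_nonneg (sub_nonneg.mpr (Subtype.coe_le_coe.mpr hab))]
      exact key a b hab
    · rw [abs_of_nonneg (sub_nonneg.mpr (Subtype.coe_le_coe.mpr hab))]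
      exact key b a hab
  have hc : Continuous fun t => φ (projIcc 0 T hT t) := hlip.continuous.comp continuous_projIcc
  have e : (fun t => (μ (projIcc 0 T hT t) : Measure (Euc d)) B)
      = fun t => ENNReal.ofReal (φ (projIcc 0 T hT t)) := funext fun t => by
    rw [hφ, ofReal_measureReal]
  exact e ▸ hc.measurable.ennreal_ofReal

end Kinetic

/-! ### Running costs -/

section Cost

variable {d m : ℕ} {T L ℓ : ℝ} {U : Set (Euc m)} {γ : ℝ → Euc d → Euc m}
  {J : ℝ → Euc d → Meas d → Euc m → ℝ} {D1 : ℝ → Euc m → Euc d → Meas d → C₀(Euc d, ℝ)}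
  {D2 : ℝ → Euc m → Euc d → Meas d → C₀(Euc d × Euc d, ℝ)}

lemma c22Norm_le_costNorm (hJ : IsCost T U ℓ J D1 D2) {t : ℝ} (ht : t ∈ Icc 0 T) {u : Euc m}
    (hu : u ∈ U) : c22Norm (fun x μ => J t x μ u) (D1 t u) (D2 t u)
      ≤ ENNReal.ofReal (costNorm T U J D1 D2).toReal := by
  rw [ENNReal.ofReal_toReal hJ.finite.ne]
  refine le_trans ?_ (le_iSup₂ (f := fun t (_ : t ∈ Icc 0 T) => ⨆ u ∈ U,
    c22Norm (fun x μ => J t x μ u) (D1 t u) (D2 t u)) t ht)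
  exact le_iSup₂ (f := fun u (_ : u ∈ U) => c22Norm (fun x μ => J t x μ u) (D1 t u) (D2 t u)) u hu

lemma measurable_cost (hJ : IsCost T U ℓ J D1 D2) (hγ : IsStrategy T U L γ) (hT : 0 ≤ T) :
    Measurable fun p : ℝ × Euc d × ProbabilityMeasure (Euc d) =>
      J p.1 p.2.1 (ofProb p.2.2) (γ (projIcc 0 T hT p.1) p.2.1) :=
  hJ.meas.comp (measurable_fst.prodMk ((measurable_fst.comp measurable_snd).prodMk
    ((measurable_ofProb.comp (measurable_snd.comp measurable_snd)).prodMk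
      ((measurable_strategy hT hγ).comp
        (measurable_fst.prodMk (measurable_fst.comp measurable_snd))))))

/-- Running costs under a strategy are regular functionals. -/
lemma regularFunctional_cost (Y : Type*) [MeasurableSpace Y] (hJ : IsCost T U ℓ J D1 D2)
    (hγ : IsStrategy T U L γ) {t : ℝ} (ht : t ∈ Icc 0 T) :
    RegularFunctional Y (2 * (costNorm T U J D1 D2).toReal)
      fun x ρ => J t x (ofProb ρ) (γ t x) := by
  have hT := ht.1.trans ht.2
  refine regularFunctional_of_forall_isC22 Y ENNReal.toReal_nonneg ?_ fun x =>
    ⟨_, _, _, hJ.c22 t ht _ (hγ.mem t ht x), c22Norm_le_costNorm hJ ht (hγ.mem t ht x),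
      fun ρ => rfl⟩
  have := (measurable_cost hJ hγ hT).comp
    ((measurable_const (a := t)).prodMk (measurable_id (α := Euc d × ProbabilityMeasure (Euc d))))
  simpa [Function.comp_def, projIcc_of_mem hT ht] using! this

/-- The state enters directly and through the feedback control; the second route contributes `ℓ *
L`. Inserting the cost at `x'` with the control of `x` separates the two. -/
lemma abs_cost_sub_le (hJ : IsCost T U ℓ J D1 D2) (hγ : IsStrategy T U L γ) (hℓ : 0 ≤ ℓ) {t : ℝ}
    (ht : t ∈ Icc 0 T) (x x' : Euc d) (ρ : ProbabilityMeasure (Euc d)) :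
    |J t x (ofProb ρ) (γ t x) - J t x' (ofProb ρ) (γ t x')|
      ≤ ((costNorm T U J D1 D2).toReal + ℓ * L) * dist x x' := by
  have hρ := ofProb_mem_unitBall ρ
  have hu := hγ.mem t ht x
  have h1 := (hJ.c22 t ht _ hu).abs_sub_le (c22Norm_le_costNorm hJ ht hu) ENNReal.toReal_nonneg
    x x' hρ
  have h2 := hJ.lipschitz t ht x' _ hρ _ hu _ (hγ.mem t ht x')
  have h3 := mul_le_mul_of_nonneg_left (hγ.lipschitz t ht x x') hℓ
  rw [dist_eq_norm, add_mul, mul_assoc ℓ]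
  exact (abs_sub_le _ (J t x' (ofProb ρ) (γ t x)) _).trans (by linarith)

end Cost

/-! ### The two bounds -/

theorem lemmaH {d m : ℕ} (U : Set (Euc m)) (T : ℝ) (hT : 0 < T) (ν : JumpKernel d m)
    (hν : KernelHyp T U ν) (L : ℝ) (hL : 0 ≤ L) :
    ∃ C : ℝ, 0 ≤ C ∧
      ∀ (N : ℕ) [NeZero N] (γ γ' : ℝ → Euc d → Euc m),
      IsStrategy T U L γ → IsStrategy T U L γ' →
      ∀ P : ℝ → ℝ → Kernel (Fin N → Euc d) (Fin N → Euc d),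
      IsPropagator T (playersGen ν γ γ') P →
      ∀ μ : ℝ → ProbabilityMeasure (Euc d), IsKineticSolution T ν γ μ →
      ∀ Q : ℝ → ℝ → Kernel (Euc d) (Euc d),
      IsPropagator T (fun t => jumpOp ν γ' t (ofProb (μ t))) Q →
      ∀ k₁ k₂ : ℝ, 0 ≤ k₁ → 0 ≤ k₂ →
      (∀ (F : Euc d → Meas d → ℝ) (D1 : Euc d → Meas d → C₀(Euc d, ℝ))
          (D2 : Euc d → Meas d → C₀(Euc d × Euc d, ℝ)), IsC22 F D1 D2 →
        ∀ t ∈ Icc 0 T, ∀ (x : Fin N → Euc d) (x₁ : Euc d),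
          dualNorm (emp x - ofProb (μ 0)) ≤ ENNReal.ofReal (k₁ / N) →
          ‖x 0 - x₁‖ ≤ k₂ / N →
          |pairProp P t F x - limitProp Q μ t F x₁|
            ≤ C * (1 + k₁ + k₂) / N * ((c22Norm F D1 D2).toReal + k₁)) ∧
      (∀ (ℓ : ℝ) (J : ℝ → Euc d → Meas d → Euc m → ℝ)
          (D1 : ℝ → Euc m → Euc d → Meas d → C₀(Euc d, ℝ))
          (D2 : ℝ → Euc m → Euc d → Meas d → C₀(Euc d × Euc d, ℝ)),
        0 ≤ ℓ → IsCost T U ℓ J D1 D2 →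
        ∀ (Ω : Type*) [MeasurableSpace Ω] (Pr : Measure Ω) [IsProbabilityMeasure Pr]
          (X : ℝ → Ω → Fin N → Euc d) (X₁ : ℝ → Ω → Euc d),
          IsMarkovProcess T P Pr X → IsMarkovProcess T Q Pr X₁ →
          (∀ᵐ ω ∂Pr, dualNorm (emp (X 0 ω) - ofProb (μ 0)) ≤ ENNReal.ofReal (k₁ / N)) →
          (∀ᵐ ω ∂Pr, ‖X 0 ω 0 - X₁ 0 ω‖ ≤ k₂ / N) →
          ∀ t ∈ Icc 0 T,
            |(∫ ω, (∫ s in t..T, J s (X s ω 0) (emp (X s ω)) (γ' s (X s ω 0))) ∂Pr)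
              - ∫ ω, (∫ s in t..T, J s (X₁ s ω) (ofProb (μ s)) (γ' s (X₁ s ω))) ∂Pr|
              ≤ C * (1 + k₁ + k₂) / N *
                ((T + k₂) * (costNorm T U J D1 D2).toReal + k₂ * ℓ + k₁)) := by
  obtain ⟨Θ, hΘ, hrate⟩ := exists_regularRate hT.le hL hν
  have hΘT : 0 ≤ Θ * T := mul_nonneg hΘ hT.le
  have hTL : 0 ≤ T * L := mul_nonneg hT.le hL
  set e := Real.exp (22 * (Θ * T)) with he
  have he0 : 0 < e := Real.exp_pos _
  -- `16 * (Θ * T) + 3` absorbs the coefficients of the functional norm, as checked in `arith` with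
  -- `M = 2 * a`. The summand `T * L` is for the term `ℓ * L * k₂` of part ii), integrated over a
  -- time of at most `T`.
  refine ⟨e * (16 * (Θ * T) + 3 + T * L), by positivity, ?_⟩
  intro N _ γ γ' hγ hγ' P hP μ hμ Q hQ k₁ k₂ hk₁ hk₂
  have hN : (0 : ℝ) < N := Nat.cast_pos.mpr (NeZero.pos N)
  obtain ⟨R, hR, hRγ⟩ := hrate (Fin N → Euc d) γ hγ
  obtain ⟨R', hR', hRγ'⟩ := hrate (Fin N → Euc d) γ' hγ'
  have initial : ∀ x : Fin N → Euc d,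
      dualNorm (emp x - ofProb (μ 0)) ≤ ENNReal.ofReal (k₁ / N) →
      TVLe (empProb x : Measure (Euc d)) (μ 0) (k₁ / N) := fun x hx => by
    rw [← ofProb_empProb] at hx
    exact tvLe_of_dualNorm_le (by positivity) hx
  have arith : ∀ a : ℝ, 0 ≤ a →
      (8 * (Θ * T) + k₁ + 2 * (Θ * T) * k₂) * (2 * a) + a * k₂
        ≤ (16 * (Θ * T) + 3) * (1 + k₁ + k₂) * a := fun a ha => by
    have h1 := mul_nonneg (mul_nonneg hΘT hk₁) ha
    have h2 := mul_nonneg (mul_nonneg hΘT hk₂) ha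
    have h3 := mul_nonneg hk₁ ha
    have h4 := mul_nonneg hk₂ ha
    nlinarith
  constructor
  · intro F D1 D2 hF t ht x x₁ hx hx₁
    set a := (c22Norm F D1 D2).toReal with ha
    have ha0 : 0 ≤ a := ENNReal.toReal_nonneg
    have hle : c22Norm F D1 D2 ≤ ENNReal.ofReal a := by rw [ha, ENNReal.ofReal_toReal hF.finite.ne]
    have hV : RegularFunctional (Fin N → Euc d) (2 * a) fun x ρ => F x (ofProb ρ) :=
      regularFunctional_of_forall_isC22 _ ha0
        (hF.meas.comp (measurable_fst.prodMk (measurable_ofProb.comp measurable_snd)))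
        fun x => ⟨F, D1, D2, hF, hle, fun ρ => rfl⟩
    have key := abs_players_sub_limit_le hΘ hR hR' hRγ hRγ' hP hμ hQ hV (by positivity) ha0
      (fun x x' ρ => by
        rw [dist_eq_norm]; exact hF.abs_sub_le hle ha0 x x' (ofProb_mem_unitBall ρ))
      ht (initial x hx) (by rwa [dist_eq_norm])
    simp only [ofProb_empProb] at key
    refine key.trans ?_
    rw [← he, div_mul_eq_mul_div, div_mul_eq_mul_div]
    refine div_le_div_of_nonneg_right ?_ hN.le
    have h1 := mul_le_mul_of_nonneg_left (arith a ha0) he0.le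
    have h2 : 0 ≤ e * (T * L * (1 + k₁ + k₂) * a) := by positivity
    have h3 : 0 ≤ e * (16 * (Θ * T) + 3 + T * L) * ((1 + k₁ + k₂) * k₁) := by positivity
    linarith
  · intro ℓ J D1 D2 hℓ hJ Ω _ Pr _ X X₁ hX hX₁ hk₁X hk₂X t ht
    set a := (costNorm T U J D1 D2).toReal with ha
    have ha0 : 0 ≤ a := ENNReal.toReal_nonneg
    have hVs : ∀ s ∈ Icc 0 T, RegularFunctional (Fin N → Euc d) (2 * a)
        fun x ρ => J s x (ofProb ρ) (γ' s x) := fun s hs => regularFunctional_cost _ hJ hγ' hs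
    have hJm := measurable_cost hJ hγ' hT.le
    obtain ⟨i₁, e₁⟩ := hX.integral_intervalIntegral hT
      (G := fun s x => J s (x 0) (emp x) (γ' s (x 0)))
      (hJm.comp (measurable_fst.prodMk (((measurable_pi_apply 0).comp measurable_snd).prodMk
        (measurable_empProb.comp measurable_snd))))
      (fun s hs x => by simp [projIcc_of_mem hT.le hs, ofProb_empProb])
      (fun s hs x => by rw [← ofProb_empProb]; exact (hVs s hs).bdd (x 0) (empProb x)) ht
    obtain ⟨i₂, e₂⟩ := hX₁.integral_intervalIntegral hT
      (G := fun s x => J s x (ofProb (μ s)) (γ' s x))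
      (hJm.comp (measurable_fst.prodMk (measurable_snd.prodMk
        ((measurable_kinetic hμ hΘ hR hRγ hT.le).comp measurable_fst))))
      (fun s hs x => by simp [projIcc_of_mem hT.le hs])
      (fun s hs x => (hVs s hs).bdd x (μ s)) ht
    rw [e₁, e₂]
    set b := e / N * ((8 * (Θ * T) + k₁ + 2 * (Θ * T) * k₂) * (2 * a) + (a + ℓ * L) * k₂) with hb
    have hb0 : 0 ≤ b := by positivity
    have pointwise : ∀ s ∈ Icc t T, |∫ ω, J s (X s ω 0) (emp (X s ω)) (γ' s (X s ω 0)) ∂Pr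
        - ∫ ω, J s (X₁ s ω) (ofProb (μ s)) (γ' s (X₁ s ω)) ∂Pr| ≤ b := by
      intro s hs
      have hs' : s ∈ Icc 0 T := ⟨ht.1.trans hs.1, hs.2⟩
      have hV := hVs s hs'
      have hPm := hP.markov 0 s le_rfl hs'.1 hs'.2
      have hQm := hQ.markov 0 s le_rfl hs'.1 hs'.2
      have h0 : (0 : ℝ) ∈ Icc 0 T := ⟨le_rfl, hT.le⟩
      set f : (Fin N → Euc d) → ℝ := fun y => J s (y 0) (ofProb (empProb y)) (γ' s (y 0)) with hf
      set g : Euc d → ℝ := fun y => J s y (ofProb (μ s)) (γ' s y) with hg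
      have hfm : Measurable f := hV.meas.comp ((measurable_pi_apply 0).prodMk measurable_empProb)
      have hgm : Measurable g := hV.meas.comp (measurable_id.prodMk measurable_const)
      have hfb : ∀ y, |f y| ≤ 2 * a := fun y => hV.bdd _ _
      have hgb : ∀ y, |g y| ≤ 2 * a := fun y => hV.bdd _ _
      have hPf : Measurable fun x => ∫ y, f y ∂P 0 s x :=
        measurable_integral_kernel (f := fun _ => f) (hfm.comp measurable_snd) (P 0 s)
      have hQg : Measurable fun x => ∫ y, g y ∂Q 0 s x :=
        measurable_integral_kernel (f := fun _ => g) (hgm.comp measurable_snd) (Q 0 s)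
      have hPX : Measurable fun ω => ∫ y, f y ∂P 0 s (X 0 ω) := hPf.comp (hX.measurable h0)
      have hQX : Measurable fun ω => ∫ y, g y ∂Q 0 s (X₁ 0 ω) := hQg.comp (hX₁.measurable h0)
      have hfX : ∫ ω, J s (X s ω 0) (emp (X s ω)) (γ' s (X s ω 0)) ∂Pr
          = ∫ ω, f (X s ω) ∂Pr := by simp only [hf, ofProb_empProb]
      rw [hfX, hX.integral_eq hs' hfm hfb]
      change |_ - ∫ ω, g (X₁ s ω) ∂Pr| ≤ b
      rw [hX₁.integral_eq hs' hgm hgb, ← integral_sub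
        (integrable_of_abs_le hPX fun ω => abs_integral_le_of_prob hfb)
        (integrable_of_abs_le hQX fun ω => abs_integral_le_of_prob hgb)]
      -- For almost every `ω` the deterministic comparison applies with the realized initial states;
      -- no other information about the joint law of the two processes is needed.
      have hae : ∀ᵐ ω ∂Pr, ‖∫ y, f y ∂P 0 s (X 0 ω) - ∫ y, g y ∂Q 0 s (X₁ 0 ω)‖ ≤ b := by
        filter_upwards [hk₁X, hk₂X] with ω h₁ h₂
        exact abs_players_sub_limit_le hΘ hR hR' hRγ hRγ' hP hμ hQ hV (by positivity)
          (by positivity) (fun x x' ρ => abs_cost_sub_le hJ hγ' hℓ hs' x x' ρ)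
          hs' (initial _ h₁) (by rwa [dist_eq_norm])
      simpa using norm_integral_le_of_norm_le_const hae
    refine (abs_intervalIntegral_sub_le ht.2 i₁ i₂ pointwise).trans ?_
    have hTt : b * (T - t) ≤ b * T := mul_le_mul_of_nonneg_left (by linarith [ht.1]) hb0
    refine hTt.trans ?_
    rw [hb, div_mul_eq_mul_div, div_mul_eq_mul_div, div_mul_eq_mul_div]
    refine div_le_div_of_nonneg_right ?_ hN.le
    have h1 := mul_le_mul_of_nonneg_left (arith a ha0) (mul_nonneg he0.le hT.le)
    have h2 : 0 ≤ e * (16 * (Θ * T) + 3) * (1 + k₁ + k₂) * (k₂ * a + k₂ * ℓ + k₁) := by positivity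
    have h3 : 0 ≤ e * (T * L) * (1 + k₁ + k₂) * ((T + k₂) * a + k₁) := by positivity
    have h4 : 0 ≤ e * (T * L) * (k₁ + k₂) * (k₂ * ℓ) := by positivity
    linarith
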